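/- For functions $f,g:\mathbb N\to\{z\in\mathbb C:|z|\le 1\}$ put $\mathbb D(f,g;\infty)=\Big(\sum_{p}\frac{1-\operatorname{Re}(f(p)\overline{g(p)})}{p}\Big)^{1/2}\in[0,\infty]$, the sum being over all primes. Let $f:\mathbb N\to\mathbb C$ be multiplicative with $|f(n)|\le 1$ for all $n$, let $\chi$ be a primitive Dirichlet character of conductor $q\ge 1$, let $t\in\mathbb R$, and suppose that $\mathbb D(f(n),n^{it}\chi(n);\infty)<\infty$. Let $F$ be the multiplicative function with $F(p^k)=f(p^k)\overline{\chi(p^k)}p^{-ikt}$ if $p\nmid q$ and $F(p^k)=1$ if $p\mid q$ ($k\ge 1$). For a prime $p$ let $F_p$ be the multiplicative function with $F_p(p^k)=F(p^k)$ and $F_p(r^k)=1$ for primes $r\ne p$ ($k\ge 1$). Let $d$ be a non-zero integer; in the sums below, terms with $n+d\le 0$ are omitted. Then for every prime $p\nmid q$ the limit $$M_p(F,\overline F;d)=\lim_{x\to\infty}\frac1x\sum_{n\le x}F_p(n)\overline{F_p(n+d)}$$ exists, and, as $x\to\infty$, $$\frac1x\sum_{n\le x}f(n)\overline{f(n+d)}=\prod_{\substack{p\le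 x\\ p\nmid q}}M_p(F,\overline F;d)\ \prod_{p^{\ell}\| q}M_{p^{\ell}}(f,\overline f,d)+o(1),$$ where, for $p^\ell\|q$ with $\ell\ge1$, $$M_{p^{\ell}}(f,\overline f,d)=\begin{cases}0,& p^{\ell-1}\nmid d,\\ -\frac1p,& p^{\ell-1}\| d,\\ \left(1-\frac1p\right)\sum_{j=0}^{k}\frac{|f(p^j)|^2}{p^j}-\frac{|f(p^{k+1})|^2}{p^{k+2}},& p^{\ell+k}\| d,\ k\ge 0,\end{cases}$$ and, for $p\nmid q$ and $p^n\|d$ with $n\ge 0$, $$M_p(F,\overline F;d)=\left(1-\frac1p\right)\sum_{0\le j<n}\frac{|F(p^j)|^2}{p^j}+\left(1-\frac2p\right)\frac{|F(p^n)|^2}{p^n}+\left(1-\frac1p\right)\sum_{j>n}\frac{F(p^n)\overline{F(p^j)}+\overline{F(p^n)}F(p^j)}{p^j},$$ the series being absolutely convergent; if moreover $|f(p^j)|=1$ for all $0\le j\le n$, then $$M_p(F,\overline F;d)=1-\frac{2}{p^{n+1}}+\left(1-\frac1p\right)\sum_{j>n}\frac{F(p^n)\overline{F(p^j)}+\overline{F(p^n)}F(p^j)}{p^j}.$$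 In particular, $\frac1x\sum_{n\le x}f(n)\overline{f(n+d)}=o(1)$ if $q\nmid d\prod_{p\mid q}p$. -/

import Mathlib

open Filter Topology
open scoped ComplexConjugate ENNReal

namespace Klurman

noncomputable section

/-- The function on positive integers obtained by multiplying prescribed values `g p k` over all
exact prime powers `p ^ k ∥ n`, `k ≥ 1`: the multiplicative function with value `g p k`
at `p ^ k`. -/
def ofPrimePowers (g : ℕ → ℕ → ℂ) (n : ℕ) : ℂ :=
  n.factorization.prod g

/-- The `p`-part of `f`: the multiplicative function which agrees with `f` on powers
of `p` and is `1` on powers of the other primes. -/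
def localPart (p : ℕ) (f : ℕ → ℂ) : ℕ → ℂ :=
  ofPrimePowers fun r k => if r = p then f (r ^ k) else 1

/-- The distance `𝔻(f, g; ∞) = (∑_p (1 - Re (f p * conj (g p))) / p) ^ (1/2)` of two functions
bounded by `1` (so that all the terms are nonnegative), with values in `[0, ∞]`. -/
def distInfty (f g : ℕ → ℂ) : ℝ≥0∞ :=
  (∑' p : Nat.Primes, ENNReal.ofReal ((1 - (f p * conj (g p)).re) / (p : ℝ))) ^ (1 / 2 : ℝ)

/-- The twisted character `n ↦ n ^ (i t) * χ n`. -/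
def twistedChar {q : ℕ} (χ : DirichletCharacter ℂ q) (t : ℝ) (n : ℕ) : ℂ :=
  (n : ℂ) ^ ((t : ℂ) * Complex.I) * χ (n : ZMod q)

/-- The multiplicative function `F` with `F (p ^ k) = f (p ^ k) * conj (χ (p ^ k)) * p ^ (- i k t)`
if `p ∤ q` and `F (p ^ k) = 1` if `p ∣ q`. -/
def twist (f : ℕ → ℂ) {q : ℕ} (χ : DirichletCharacter ℂ q) (t : ℝ) : ℕ → ℂ :=
  ofPrimePowers fun p k =>
    if p ∣ q then 1
    else f (p ^ k) * conj (χ ((p ^ k : ℕ) : ZMod q)) * (p : ℂ) ^ (-((k : ℂ) * (t : ℂ) * Complex.I))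

/-- The correlation `(1/x) ∑_{n ≤ x} f n * conj (f (n + d))`; the sum is over the positive
integers `n ≤ x` for which `n + d` is positive as well. -/
def correlation (f : ℕ → ℂ) (d : ℤ) (x : ℝ) : ℂ :=
  (1 / (x : ℂ)) * ∑ n ∈ (Finset.Icc 1 ⌊x⌋₊).filter (fun n : ℕ => 0 < (n : ℤ) + d),
    f n * conj (f ((n : ℤ) + d).toNat)

/-- The local correlation `M_p(F, conj F; d) = lim_{x → ∞} (1/x) ∑_{n ≤ x} F_p n * conj (F_p (n + d))`
with `F_p` the `p`-part of `F`. -/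
def localCorrelation (p : ℕ) (F : ℕ → ℂ) (d : ℤ) : ℂ :=
  limUnder atTop fun x : ℝ => correlation (localPart p F) d x

/-- The local factor `M_{p ^ l}(f, conj f; d)`, for `p ^ l ∥ q` with `l ≥ 1` and `d ≠ 0`. In the last
case `p ^ l ∣ d`, and `k` is the integer `k ≥ 0` with `p ^ (l + k) ∥ d`. -/
def charLocalFactor (f : ℕ → ℂ) (p l : ℕ) (d : ℤ) : ℝ :=
  if ¬ (p : ℤ) ^ (l - 1) ∣ d then 0
  else if ¬ (p : ℤ) ^ l ∣ d then -(1 / (p : ℝ))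
  else
    let k := padicValInt p d - l
    (1 - 1 / (p : ℝ)) * ∑ j ∈ Finset.range (k + 1), ‖f (p ^ j)‖ ^ 2 / (p : ℝ) ^ j
      - ‖f (p ^ (k + 1))‖ ^ 2 / (p : ℝ) ^ (k + 2)

/-- The `j`-th term of the series in the formula for `M_p(F, conj F; d)`, where `p ^ n ∥ d`. -/
def tailTerm (F : ℕ → ℂ) (p n j : ℕ) : ℂ :=
  F (p ^ n) * conj (F (p ^ j)) / (p : ℂ) ^ j + conj (F (p ^ n)) * F (p ^ j) / (p : ℂ) ^ j

end

end Klurman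

/-!
A multiplicative function at finite distance from `n ↦ χ n * n ^ (i t)` is, after removing the
slowly varying factor `n ^ (i t)`, a product of functions each depending on `n` only as a `p`-adic
integer (`mul_cpow_eq_prod_localPiece`). For `p ∤ q` this is `p ^ a * m ↦ F (p ^ a)`; for `p ∣ q` it
is `p ^ a * m ↦ c a * ψ m` with `ψ` the component of `χ` at `p`, the values at `p ^ a` of the other
components being moved into `c a` (`localCoeff`). In the correlation, the product over the primes
`p ≤ y` is limit periodic, and by the Chinese remainder theorem its mean value is the product of the
local mean values (`LimitPeriodic.finsetProd`). The product `Λ` over the primes `p > y` need not be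
close to `1`, since `∑ Im F(p) / p` may diverge. But it is close on average to the exponential of
the additive function `∑_{p ∣ n, p > y} (F p - 1)`, which by the Turán–Kubilius inequality
concentrates at its mean value, so that `Λ n` is close to a constant `z` depending on the range of
`n`, with `|z|` near `1` (`large_primes_near_constant`). Hence `Λ n * conj (Λ (n + d))` is close to
`|z| ^ 2`, thus to `1`. The imaginary parts cancel in the local correlations as well: these are
`1 + 2 (Re F(p) - 1) / p + O(1 / p ^ 2)` for `p ∤ q d`, and their product over `y < p ≤ x` is close
to `1` (`norm_localMean_sub_one_le`).

The local mean values are computed by sorting `n` by the exact powers of `p` dividing `n` and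
`n + d` (`correlationTrunc`), which leaves complete sums `∑ ψ y * conj (ψ (y + D))` and
`∑ ψ (p ^ j z - u) * conj (ψ z)`. Möbius substitutions which multiply the ratio of the two arguments
by a residue `a ≡ 1` modulo `p ^ (l - 1)` with `ψ a ≠ 1` show that most of them vanish
(`charSum_shift_eq_zero`, `charSum_linear_eq_zero`); such an `a` exists because `χ` is primitive.
-/

namespace Klurman

/-! ### Mean values and limit periodic functions -/

/-- `u` has mean value `m`: the averages of `u` over `1 ≤ n ≤ N` tend to `m`. -/
def HasMean (u : ℕ → ℂ) (m : ℂ) : Prop :=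
  Tendsto (fun N : ℕ => (∑ n ∈ Finset.Ioc 0 N, u n) / (N : ℂ)) atTop (𝓝 m)

theorem norm_avg_sub_avg_le {u v : ℕ → ℂ} {ε : ℝ} {N : ℕ} (hN : 0 < N)
    (h : ∑ n ∈ Finset.Ioc 0 N, ‖u n - v n‖ ≤ ε * N) :
    ‖(∑ n ∈ Finset.Ioc 0 N, u n) / (N : ℂ) - (∑ n ∈ Finset.Ioc 0 N, v n) / (N : ℂ)‖ ≤ ε := by
  have hN' : (0 : ℝ) < N := by exact_mod_cast hN
  rw [← sub_div, ← Finset.sum_sub_distrib, norm_div, Complex.norm_natCast, div_le_iff₀ hN']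
  exact (norm_sum_le _ _).trans h

/-- If `u` is approximated on average by functions whose mean values approximate `K`, then the
averages of `u` follow `K`. -/
theorem tendsto_avg_sub_of_approx {u K : ℕ → ℂ}
    (h : ∀ ε : ℝ, 0 < ε → ∃ (v : ℕ → ℂ) (m : ℂ), HasMean v m ∧
      (∀ᶠ N : ℕ in atTop, ‖m - K N‖ ≤ ε) ∧
      ∀ᶠ N : ℕ in atTop, ∑ n ∈ Finset.Ioc 0 N, ‖u n - v n‖ ≤ ε * N) :
    Tendsto (fun N : ℕ => (∑ n ∈ Finset.Ioc 0 N, u n) / (N : ℂ) - K N) atTop (𝓝 0) := by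
  rw [Metric.tendsto_nhds]
  intro ε hε
  obtain ⟨v, m, hv, hK, hu⟩ := h (ε / 4) (by positivity)
  have hv' := (Metric.tendsto_nhds.1 hv) (ε / 4) (by positivity)
  filter_upwards [hK, hu, hv', eventually_gt_atTop 0] with N h1 h2 h3 hN
  have h4 := norm_avg_sub_avg_le hN h2
  rw [dist_eq_norm] at h3
  rw [dist_zero_right]
  calc ‖(∑ n ∈ Finset.Ioc 0 N, u n) / (N : ℂ) - K N‖
      = ‖((∑ n ∈ Finset.Ioc 0 N, u n) / (N : ℂ) - (∑ n ∈ Finset.Ioc 0 N, v n) / (N : ℂ)) +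
          (((∑ n ∈ Finset.Ioc 0 N, v n) / (N : ℂ) - m) + (m - K N))‖ := by congr 1; ring
    _ ≤ ε / 4 + (ε / 4 + ε / 4) :=
        (norm_add_le _ _).trans (add_le_add h4 ((norm_add_le _ _).trans (add_le_add h3.le h1)))
    _ < ε := by linarith

theorem HasMean.of_approx {u : ℕ → ℂ} {m : ℂ}
    (h : ∀ ε : ℝ, 0 < ε → ∃ (v : ℕ → ℂ) (m' : ℂ), HasMean v m' ∧ ‖m' - m‖ ≤ ε ∧
      ∀ᶠ N : ℕ in atTop, ∑ n ∈ Finset.Ioc 0 N, ‖u n - v n‖ ≤ ε * N) : HasMean u m := by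
  have := tendsto_avg_sub_of_approx (u := u) (K := fun _ => m) fun ε hε => by
    obtain ⟨v, m', h1, h2, h3⟩ := h ε hε
    exact ⟨v, m', h1, Eventually.of_forall fun _ => h2, h3⟩
  simpa [HasMean] using this.add_const m

theorem HasMean.norm_sub_le {u v : ℕ → ℂ} {m m' : ℂ} {ε : ℝ} (hu : HasMean u m)
    (hv : HasMean v m')
    (h : ∀ᶠ N : ℕ in atTop, ∑ n ∈ Finset.Ioc 0 N, ‖u n - v n‖ ≤ ε * N) : ‖m - m'‖ ≤ ε := by
  refine le_of_tendsto (hu.sub hv).norm ?_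
  filter_upwards [h, eventually_gt_atTop 0] with N h1 hN
  exact norm_avg_sub_avg_le hN h1

theorem hasMean_zero : HasMean (fun _ => 0) 0 := by simp [HasMean]

theorem HasMean.norm_le_one {u : ℕ → ℂ} {m : ℂ} (hu : HasMean u m) (h : ∀ n, ‖u n‖ ≤ 1) :
    ‖m‖ ≤ 1 := by
  have := hu.norm_sub_le (ε := 1) hasMean_zero (Eventually.of_forall fun N => by
    simpa using Finset.sum_le_card_nsmul (Finset.Ioc 0 N) (fun n => ‖u n‖) 1 fun n _ => h n)
  simpa using this

theorem HasMean.congr {u v : ℕ → ℂ} {m : ℂ} (hu : HasMean u m) (h : ∀ n, 0 < n → u n = v n) :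
    HasMean v m := by
  refine Tendsto.congr (fun N => ?_) hu
  rw [Finset.sum_congr rfl fun n hn => h n (Finset.mem_Ioc.1 hn).1]

theorem HasMean.add {u v : ℕ → ℂ} {m m' : ℂ} (hu : HasMean u m) (hv : HasMean v m') :
    HasMean (fun n => u n + v n) (m + m') := by
  refine Tendsto.congr (fun N => ?_) (Tendsto.add hu hv)
  rw [Finset.sum_add_distrib, add_div]

theorem HasMean.const_mul {u : ℕ → ℂ} {m : ℂ} (c : ℂ) (hu : HasMean u m) :
    HasMean (fun n => c * u n) (c * m) := by
  refine Tendsto.congr (fun N => ?_) (Tendsto.const_mul c hu)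
  rw [← Finset.mul_sum, mul_div_assoc]

theorem HasMean.finsetSum {ι : Type*} (s : Finset ι) {u : ι → ℕ → ℂ} {m : ι → ℂ}
    (h : ∀ i ∈ s, HasMean (u i) (m i)) : HasMean (fun n => ∑ i ∈ s, u i n) (∑ i ∈ s, m i) := by
  refine Tendsto.congr (fun N => ?_) (tendsto_finsetSum s h)
  rw [Finset.sum_comm, Finset.sum_div]

theorem sum_Ioc_zero_eq_sum_range (u : ℕ → ℂ) (N : ℕ) :
    ∑ n ∈ Finset.Ioc 0 N, u n = ∑ n ∈ Finset.range N, u (n + 1) := by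
  rw [Finset.range_eq_Ico, Finset.sum_Ico_add' u 0 N 1]
  rfl

theorem HasMean.shift {u : ℕ → ℂ} {m : ℂ} (hu : HasMean u m) (d : ℕ) :
    HasMean (fun n => u (n + d)) m := by
  have h1 : Tendsto (fun N : ℕ => (∑ n ∈ Finset.Ioc 0 (N + d), u n) / ((N + d : ℕ) : ℂ))
      atTop (𝓝 m) := hu.comp (tendsto_add_atTop_nat d)
  have h2 : Tendsto (fun N : ℕ => (((N + d : ℕ) : ℂ)) / (N : ℂ)) atTop (𝓝 1) := by
    have : Tendsto (fun N : ℕ => 1 + (d : ℂ) / (N : ℂ)) atTop (𝓝 (1 + 0)) :=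
      tendsto_const_nhds.add (tendsto_const_div_atTop_nhds_zero_nat _)
    rw [add_zero] at this
    refine this.congr' ?_
    filter_upwards [eventually_gt_atTop 0] with N hN
    have : (N : ℂ) ≠ 0 := by exact_mod_cast hN.ne'
    push_cast
    field_simp
  have h3 : Tendsto (fun N : ℕ => (∑ n ∈ Finset.Ioc 0 d, u n) / (N : ℂ)) atTop (𝓝 0) :=
    tendsto_const_div_atTop_nhds_zero_nat _
  have h4 := (h1.mul h2).sub h3
  rw [mul_one, sub_zero] at h4
  refine h4.congr' ?_
  filter_upwards [eventually_gt_atTop 0] with N hN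
  have hN' : (N : ℂ) ≠ 0 := by exact_mod_cast hN.ne'
  have hNd : ((N + d : ℕ) : ℂ) ≠ 0 := by exact_mod_cast (by omega : N + d ≠ 0)
  have h5 : ∑ n ∈ Finset.Ioc 0 (N + d), u n =
      ∑ n ∈ Finset.Ioc 0 d, u n + ∑ n ∈ Finset.Ioc 0 N, u (n + d) := by
    simp only [sum_Ioc_zero_eq_sum_range]
    rw [add_comm N d, Finset.sum_range_add]
    congr 1
    exact Finset.sum_congr rfl fun n _ => by congr 1; ring
  rw [h5]
  field_simp
  ring

/-- Multiples of `k` have density `1 / k`. -/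
theorem HasMean.dilate {w : ℕ → ℂ} {m : ℂ} (hw : HasMean w m) {k : ℕ} (hk : 0 < k) :
    HasMean (fun n => if k ∣ n then w (n / k) else 0) (m / k) := by
  have hk' : (k : ℂ) ≠ 0 := by exact_mod_cast hk.ne'
  have h1 : Tendsto (fun N : ℕ => (∑ n ∈ Finset.Ioc 0 (N / k), w n) / ((N / k : ℕ) : ℂ))
      atTop (𝓝 m) := hw.comp (Nat.tendsto_div_const_atTop hk.ne')
  have h2 : Tendsto (fun N : ℕ => (((N / k : ℕ) : ℂ)) / (N : ℂ)) atTop (𝓝 (1 / k)) := by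
    have h : Tendsto (fun N : ℕ => (⌊(N : ℝ) / k⌋₊ : ℝ) / N) atTop (𝓝 (1 / k)) := by
      have := (tendsto_nat_floor_mul_div_atTop (R := ℝ) (a := 1 / k) (by positivity)).comp
        tendsto_natCast_atTop_atTop
      refine this.congr fun N => ?_
      simp [div_eq_inv_mul]
    have h' := (Complex.continuous_ofReal.tendsto _).comp h
    simp only [Complex.ofReal_div, Complex.ofReal_one, Complex.ofReal_natCast] at h'
    refine h'.congr fun N => ?_
    simp [Nat.floor_div_eq_div]
  have h3 := h1.mul h2
  rw [mul_one_div] at h3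
  refine h3.congr' ?_
  filter_upwards [eventually_ge_atTop k] with N hN
  have h4 : ((N / k : ℕ) : ℂ) ≠ 0 := by exact_mod_cast (Nat.div_pos hN hk).ne'
  rw [← Finset.sum_filter]
  have h5 : ∑ n ∈ (Finset.Ioc 0 N).filter (k ∣ ·), w (n / k) =
      ∑ n ∈ Finset.Ioc 0 (N / k), w n := by
    symm
    refine Finset.sum_bij (fun n _ => k * n) ?_ ?_ ?_ ?_
    · intro n hn
      simp only [Finset.mem_Ioc, Finset.mem_filter] at hn ⊢
      refine ⟨⟨Nat.mul_pos hk hn.1, ?_⟩, dvd_mul_right _ _⟩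
      exact (Nat.mul_le_mul_left k hn.2).trans (Nat.mul_div_le N k)
    · intro a _ b _ hab
      exact Nat.eq_of_mul_eq_mul_left hk hab
    · rintro n hn
      simp only [Finset.mem_Ioc, Finset.mem_filter] at hn
      obtain ⟨⟨hn0, hnN⟩, c, rfl⟩ := hn
      refine ⟨c, Finset.mem_Ioc.2 ⟨Nat.pos_of_mul_pos_left hn0, ?_⟩, rfl⟩
      exact (Nat.le_div_iff_mul_le hk).2 (by rwa [mul_comm])
    · intro n _
      rw [Nat.mul_div_cancel_left _ hk]
  rw [h5]
  field_simp

theorem sum_range_natCast_zmod (M : ℕ) [NeZero M] (g : ZMod M → ℂ) :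
    ∑ i ∈ Finset.range M, g (i : ZMod M) = ∑ x, g x := by
  refine Finset.sum_bij' (fun i _ => (i : ZMod M)) (fun x _ => x.val) ?_ ?_ ?_ ?_ ?_
  · simp
  · intro x _
    exact Finset.mem_range.2 (ZMod.val_lt x)
  · intro i hi
    exact ZMod.val_cast_of_lt (Finset.mem_range.1 hi)
  · simp
  · simp

/-- A periodic function has its average over a period as mean value. -/
theorem hasMean_zmod (M : ℕ) [NeZero M] (g : ZMod M → ℂ) :
    HasMean (fun n => g (n : ZMod M)) ((∑ x, g x) / M) := by
  have hM : (M : ℂ) ≠ 0 := by exact_mod_cast NeZero.ne M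
  set m := (∑ x, g x) / (M : ℂ) with hm
  let R : ℕ → ℂ := fun N => ∑ n ∈ Finset.Ioc 0 N, g (n : ZMod M) - N * m
  have hR : Function.Periodic R M := by
    intro N
    simp only [R, sum_Ioc_zero_eq_sum_range]
    rw [Finset.sum_range_add]
    have : ∑ x ∈ Finset.range M, g ((N + x + 1 : ℕ) : ZMod M) = ∑ x, g x := by
      rw [← Equiv.sum_comp (Equiv.addRight ((N : ZMod M) + 1)) g,
        ← sum_range_natCast_zmod M]
      refine Finset.sum_congr rfl fun x _ => ?_
      simp only [Equiv.coe_addRight]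
      congr 1
      push_cast
      ring
    rw [this, hm]
    push_cast
    field_simp
    ring
  have hb : ∀ N, ‖R N‖ ≤ ∑ r ∈ Finset.range M, ‖R r‖ := by
    intro N
    rw [← hR.map_mod_nat N]
    exact Finset.single_le_sum (f := fun r => ‖R r‖) (fun _ _ => norm_nonneg _)
      (Finset.mem_range.2 (Nat.mod_lt _ (NeZero.pos M)))
  have h0 : Tendsto (fun N : ℕ => R N / (N : ℂ)) atTop (𝓝 0) := by
    refine squeeze_zero_norm (a := fun N : ℕ => (∑ r ∈ Finset.range M, ‖R r‖) / (N : ℝ)) ?_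
      (tendsto_const_div_atTop_nhds_zero_nat _)
    intro N
    rw [norm_div, Complex.norm_natCast]
    exact div_le_div_of_nonneg_right (hb N) (Nat.cast_nonneg N)
  have h1 := h0.add_const m
  rw [zero_add] at h1
  refine h1.congr' ?_
  filter_upwards [eventually_gt_atTop 0] with N hN
  have hN' : (N : ℂ) ≠ 0 := by exact_mod_cast hN.ne'
  simp only [R]
  field_simp
  ring

theorem eq_val_of_periodic {v : ℕ → ℂ} {M : ℕ} [NeZero M] (hv : Function.Periodic v M) (n : ℕ) :
    v n = v (n : ZMod M).val := by
  rw [ZMod.val_natCast, hv.map_mod_nat]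

theorem exists_hasMean_of_periodic {v : ℕ → ℂ} {M : ℕ} [NeZero M] (hv : Function.Periodic v M) :
    ∃ m, HasMean v m :=
  ⟨_, (hasMean_zmod M fun x => v x.val).congr fun n _ => (eq_val_of_periodic hv n).symm⟩

theorem HasMean.unique {u : ℕ → ℂ} {m m' : ℂ} (h : HasMean u m) (h' : HasMean u m') :
    m = m' := tendsto_nhds_unique h h'

/-- Chinese remainder theorem: the mean value is multiplicative on periodic functions with coprime
periods. -/
theorem HasMean.mul_of_periodic {v w : ℕ → ℂ} {m m' : ℂ} {A B : ℕ} [NeZero A] [NeZero B]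
    (hAB : A.Coprime B) (hv : Function.Periodic v A) (hw : Function.Periodic w B)
    (hvm : HasMean v m) (hwm : HasMean w m') : HasMean (fun n => v n * w n) (m * m') := by
  have h1 := HasMean.unique hvm ((hasMean_zmod A fun x => v x.val).congr fun n _ =>
    (eq_val_of_periodic hv n).symm)
  have h2 := HasMean.unique hwm ((hasMean_zmod B fun x => w x.val).congr fun n _ =>
    (eq_val_of_periodic hw n).symm)
  have h3 := hasMean_zmod (A * B) fun x =>
    v (ZMod.chineseRemainder hAB x).1.val * w (ZMod.chineseRemainder hAB x).2.val
  rw [h1, h2]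
  have h4 : (∑ x : ZMod A, v x.val) / (A : ℂ) * ((∑ x : ZMod B, w x.val) / (B : ℂ)) =
      (∑ x : ZMod (A * B), v (ZMod.chineseRemainder hAB x).1.val *
        w (ZMod.chineseRemainder hAB x).2.val) / ((A * B : ℕ) : ℂ) := by
    have h5 : ∑ x : ZMod (A * B), v (ZMod.chineseRemainder hAB x).1.val *
        w (ZMod.chineseRemainder hAB x).2.val = ∑ y : ZMod A × ZMod B, v y.1.val * w y.2.val :=
      Equiv.sum_comp (ZMod.chineseRemainder hAB).toEquiv
        (fun y : ZMod A × ZMod B => v y.1.val * w y.2.val)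
    rw [h5, ← Finset.univ_product_univ, Finset.sum_product]
    dsimp only
    rw [← Finset.sum_mul_sum]
    push_cast
    rw [div_mul_div_comm]
  rw [h4]
  refine h3.congr fun n _ => ?_
  rw [map_natCast, eq_val_of_periodic hv n, eq_val_of_periodic hw n]
  rfl

/-- `u` is bounded by `1`, and is arbitrarily well approximated on average by functions bounded by
`1` and periodic modulo a power of `Q`. -/
structure LimitPeriodic (Q : ℕ) (u : ℕ → ℂ) : Prop where
  norm_le_one : ∀ n, ‖u n‖ ≤ 1
  approx : ∀ ε : ℝ, 0 < ε → ∃ (v : ℕ → ℂ) (k : ℕ), Function.Periodic v (Q ^ k) ∧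
    (∀ n, ‖v n‖ ≤ 1) ∧ ∀ᶠ N : ℕ in atTop, ∑ n ∈ Finset.Ioc 0 N, ‖u n - v n‖ ≤ ε * N

theorem norm_mul_sub_mul_le {a b a' b' : ℂ} (hb : ‖b‖ ≤ 1) (ha' : ‖a'‖ ≤ 1) :
    ‖a * b - a' * b'‖ ≤ ‖a - a'‖ + ‖b - b'‖ := by
  calc ‖a * b - a' * b'‖ = ‖(a - a') * b + a' * (b - b')‖ := by congr 1; ring
    _ ≤ ‖a - a'‖ * ‖b‖ + ‖a'‖ * ‖b - b'‖ := by
        refine (norm_add_le _ _).trans ?_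
        rw [norm_mul, norm_mul]
    _ ≤ _ := by
        gcongr
        · exact mul_le_of_le_one_right (norm_nonneg _) hb
        · exact mul_le_of_le_one_left (norm_nonneg _) ha'

theorem norm_mul_le_one {a b : ℂ} (ha : ‖a‖ ≤ 1) (hb : ‖b‖ ≤ 1) : ‖a * b‖ ≤ 1 := by
  rw [norm_mul]
  exact mul_le_one₀ ha (norm_nonneg _) hb

theorem LimitPeriodic.mul {u u' : ℕ → ℂ} {Q Q' : ℕ} {m m' : ℂ} (hQ : 0 < Q) (hQ' : 0 < Q')
    (hc : Q.Coprime Q') (hu : LimitPeriodic Q u) (hu' : LimitPeriodic Q' u') (hm : HasMean u m)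
    (hm' : HasMean u' m') : LimitPeriodic (Q * Q') (fun n => u n * u' n) ∧
      HasMean (fun n => u n * u' n) (m * m') := by
  have key : ∀ {ε : ℝ} {v v' : ℕ → ℂ}, (∀ n, ‖v n‖ ≤ 1) →
      (∀ᶠ N : ℕ in atTop, ∑ n ∈ Finset.Ioc 0 N, ‖u n - v n‖ ≤ ε / 2 * N) →
      (∀ᶠ N : ℕ in atTop, ∑ n ∈ Finset.Ioc 0 N, ‖u' n - v' n‖ ≤ ε / 2 * N) →
      ∀ᶠ N : ℕ in atTop, ∑ n ∈ Finset.Ioc 0 N, ‖u n * u' n - v n * v' n‖ ≤ ε * N := by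
    intro ε v v' hv h h'
    filter_upwards [h, h'] with N h1 h2
    calc ∑ n ∈ Finset.Ioc 0 N, ‖u n * u' n - v n * v' n‖
        ≤ ∑ n ∈ Finset.Ioc 0 N, (‖u n - v n‖ + ‖u' n - v' n‖) :=
          Finset.sum_le_sum fun n _ => norm_mul_sub_mul_le (hu'.norm_le_one n) (hv n)
      _ ≤ ε / 2 * N + ε / 2 * N := by rw [Finset.sum_add_distrib]; exact add_le_add h1 h2
      _ = ε * N := by ring
  refine ⟨⟨fun n => norm_mul_le_one (hu.norm_le_one n) (hu'.norm_le_one n), fun ε hε => ?_⟩,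
    HasMean.of_approx fun ε hε => ?_⟩
  · obtain ⟨v, k, hvp, hv1, hv⟩ := hu.approx (ε / 2) (by positivity)
    obtain ⟨v', k', hvp', hv1', hv'⟩ := hu'.approx (ε / 2) (by positivity)
    refine ⟨fun n => v n * v' n, k + k', fun n => ?_,
      fun n => norm_mul_le_one (hv1 n) (hv1' n), key hv1 hv hv'⟩
    have h1 : (Q * Q') ^ (k + k') = (Q ^ k' * Q' ^ (k + k')) * Q ^ k := by ring
    have h2 : (Q * Q') ^ (k + k') = (Q ^ (k + k') * Q' ^ k) * Q' ^ k' := by ring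
    have h3 : v (n + (Q * Q') ^ (k + k')) = v n := by
      rw [h1]; exact (hvp.nat_mul _) n
    have h4 : v' (n + (Q * Q') ^ (k + k')) = v' n := by
      rw [h2]; exact (hvp'.nat_mul _) n
    change v _ * v' _ = _
    rw [h3, h4]
  · obtain ⟨v, k, hvp, hv1, hv⟩ := hu.approx (ε / 2) (by positivity)
    obtain ⟨v', k', hvp', hv1', hv'⟩ := hu'.approx (ε / 2) (by positivity)
    have : NeZero (Q ^ k) := ⟨(pow_pos hQ k).ne'⟩
    have : NeZero (Q' ^ k') := ⟨(pow_pos hQ' k').ne'⟩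
    obtain ⟨μ, hμ⟩ := exists_hasMean_of_periodic hvp
    obtain ⟨μ', hμ'⟩ := exists_hasMean_of_periodic hvp'
    refine ⟨fun n => v n * v' n, μ * μ', HasMean.mul_of_periodic
      (Nat.Coprime.pow k k' hc) hvp hvp' hμ hμ', ?_, key hv1 hv hv'⟩
    have h1 := hm.norm_sub_le hμ hv
    have h2 := hm'.norm_sub_le hμ' hv'
    rw [norm_sub_rev] at h1 h2
    have h3 := norm_mul_sub_mul_le (a := μ) (b' := m') (hμ'.norm_le_one hv1')
      (hm.norm_le_one hu.norm_le_one)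
    linarith

/-- The mean value is multiplicative on functions which are limit periodic with respect to
distinct primes. -/
theorem LimitPeriodic.finsetProd (s : Finset ℕ) (hs : ∀ p ∈ s, p.Prime) {u : ℕ → ℕ → ℂ}
    {m : ℕ → ℂ} (hu : ∀ p ∈ s, LimitPeriodic p (u p)) (hm : ∀ p ∈ s, HasMean (u p) (m p)) :
    LimitPeriodic (∏ p ∈ s, p) (fun n => ∏ p ∈ s, u p n) ∧
      HasMean (fun n => ∏ p ∈ s, u p n) (∏ p ∈ s, m p) := by
  induction s using Finset.induction_on with
  | empty =>
    simp only [Finset.prod_empty]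
    refine ⟨⟨by simp, fun ε hε => ⟨fun _ => 1, 0, fun _ => rfl, by simp, ?_⟩⟩, ?_⟩
    · filter_upwards with N
      simp only [sub_self, norm_zero, Finset.sum_const_zero]
      positivity
    · simpa using hasMean_zmod 1 fun _ => 1
  | insert p s hp ih =>
    obtain ⟨h1, h2⟩ := ih (fun r hr => hs r (Finset.mem_insert_of_mem hr))
      (fun r hr => hu r (Finset.mem_insert_of_mem hr))
      (fun r hr => hm r (Finset.mem_insert_of_mem hr))
    simp only [Finset.prod_insert hp]
    have hpp := hs p (Finset.mem_insert_self p s)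
    refine LimitPeriodic.mul hpp.pos
      (Finset.prod_pos fun r hr => (hs r (Finset.mem_insert_of_mem hr)).pos) ?_
      (hu p (Finset.mem_insert_self p s)) h1 (hm p (Finset.mem_insert_self p s)) h2
    refine Nat.Coprime.prod_right fun r hr => ?_
    exact (Nat.coprime_primes hpp (hs r (Finset.mem_insert_of_mem hr))).2
      fun h => hp (h ▸ hr)

/-! ### Correlations of characters modulo prime powers -/

theorem char_mul_conj_of_isUnit {M : ℕ} (ψ : DirichletCharacter ℂ M) {x : ZMod M}
    (hx : IsUnit x) : ψ x * conj (ψ x) = 1 := by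
  obtain ⟨y, rfl⟩ := hx
  rw [Complex.mul_conj, Complex.normSq_eq_norm_sq, ψ.unit_norm_eq_one]
  simp

/-- A sum of `ψ (P x) * conj (ψ (Q x))` vanishes if an injective substitution multiplies the ratio
of `P` and `Q` by an element at which `ψ` is not `1`. -/
theorem charSum_eq_zero {M : ℕ} [NeZero M] (ψ : DirichletCharacter ℂ M) (P Q k : ZMod M → ZMod M)
    (σ : ZMod M → ZMod M) (hσ : Function.Injective σ) (hk : ∀ x, IsUnit (k x)) (α β : ZMod M)
    (hP : ∀ x, P (σ x) * k x = α * P x) (hQ : ∀ x, Q (σ x) * k x = β * Q x)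
    (h : ψ α * conj (ψ β) ≠ 1) : ∑ x, ψ (P x) * conj (ψ (Q x)) = 0 := by
  have h1 : ∀ x, ψ (P (σ x)) * conj (ψ (Q (σ x))) =
      (ψ α * conj (ψ β)) * (ψ (P x) * conj (ψ (Q x))) := by
    intro x
    have h2 := congrArg ψ (hP x)
    have h3 := congrArg (fun z => conj (ψ z)) (hQ x)
    simp only [map_mul] at h2 h3
    have h4 := char_mul_conj_of_isUnit ψ (hk x)
    calc ψ (P (σ x)) * conj (ψ (Q (σ x)))
        = (ψ (P (σ x)) * ψ (k x)) * (conj (ψ (Q (σ x))) * conj (ψ (k x))) := by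
          linear_combination (-(ψ (P (σ x)) * conj (ψ (Q (σ x))))) * h4
      _ = _ := by rw [h2, h3]; ring
  have h2 : ∑ x, ψ (P x) * conj (ψ (Q x)) = ∑ x, ψ (P (σ x)) * conj (ψ (Q (σ x))) :=
    (Function.Bijective.sum_comp (Finite.injective_iff_bijective.1 hσ)
      (fun x => ψ (P x) * conj (ψ (Q x)))).symm
  simp only [h1] at h2
  rw [← Finset.mul_sum] at h2
  have h3 : (1 - ψ α * conj (ψ β)) * ∑ x, ψ (P x) * conj (ψ (Q x)) = 0 := by
    linear_combination h2
  exact (mul_eq_zero.1 h3).resolve_left (sub_ne_zero.2 h.symm)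

section PrimePower

variable {p L : ℕ}

theorem isUnit_natCast_iff (hp : p.Prime) (hL : 1 ≤ L) (n : ℕ) :
    IsUnit (n : ZMod (p ^ L)) ↔ ¬ p ∣ n := by
  rw [ZMod.isUnit_iff_coprime, Nat.coprime_pow_right_iff (by omega), Nat.coprime_comm,
    hp.coprime_iff_not_dvd]

theorem exists_eq_mul_of_not_isUnit (hp : p.Prime) (hL : 1 ≤ L) {x : ZMod (p ^ L)}
    (hx : ¬ IsUnit x) : ∃ s, x = p * s := by
  have : NeZero (p ^ L) := ⟨(pow_pos hp.pos L).ne'⟩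
  rw [← ZMod.natCast_zmod_val x, isUnit_natCast_iff hp hL, not_not] at hx
  obtain ⟨s, hs⟩ := hx
  exact ⟨s, by rw [← ZMod.natCast_zmod_val x, hs]; push_cast; rfl⟩

theorem natCast_pow_eq_zero (k : ℕ) (hk : L ≤ k) : (p : ZMod (p ^ L)) ^ k = 0 := by
  rw [← Nat.cast_pow, ZMod.natCast_eq_zero_iff]
  exact pow_dvd_pow p hk

theorem isNilpotent_natCast_mul (x : ZMod (p ^ L)) : IsNilpotent ((p : ZMod (p ^ L)) * x) :=
  ⟨L, by rw [mul_pow, natCast_pow_eq_zero L le_rfl, zero_mul]⟩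

theorem isUnit_add_natCast_mul {y : ZMod (p ^ L)} (hy : IsUnit y) (x : ZMod (p ^ L)) :
    IsUnit (y + p * x) :=
  (isNilpotent_natCast_mul x).isUnit_add_left_of_commute hy (Commute.all _ _)

variable (ψ : DirichletCharacter ℂ (p ^ L))

theorem charSum_self (hp : p.Prime) (hL : 1 ≤ L) [NeZero (p ^ L)] :
    ∑ y, ψ y * conj (ψ (y + 0)) = (p : ℂ) ^ L * (1 - 1 / p) := by
  have h1 : ∀ y, ψ y * conj (ψ (y + 0)) = (1 : DirichletCharacter ℂ (p ^ L)) y := by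
    intro y
    rw [add_zero]
    by_cases hy : IsUnit y
    · rw [char_mul_conj_of_isUnit ψ hy, MulChar.one_apply hy]
    · rw [MulChar.map_nonunit _ hy, MulChar.map_nonunit _ hy, zero_mul]
  rw [Finset.sum_congr rfl fun y _ => h1 y, MulChar.sum_one_eq_card_units,
    ZMod.card_units_eq_totient, Nat.totient_prime_pow hp (by omega), Nat.cast_mul,
    Nat.cast_sub hp.one_le]
  obtain ⟨l, rfl⟩ : ∃ l, L = l + 1 := ⟨L - 1, by omega⟩
  have : (p : ℂ) ≠ 0 := by exact_mod_cast hp.ne_zero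
  simp only [Nat.add_sub_cancel]
  push_cast
  field_simp
  ring

theorem charSum_unit_mul [NeZero (p ^ L)] {w : ZMod (p ^ L)} (hw : IsUnit w) (D : ZMod (p ^ L)) :
    ∑ y, ψ y * conj (ψ (y + D * w)) = ∑ y, ψ y * conj (ψ (y + D)) := by
  have h : Function.Injective fun y : ZMod (p ^ L) => y * w := hw.mul_left_injective
  rw [← Function.Bijective.sum_comp (Finite.injective_iff_bijective.1 h)
    (fun y => ψ y * conj (ψ (y + D * w)))]
  refine Finset.sum_congr rfl fun y _ => ?_
  rw [← add_mul, map_mul, map_mul, map_mul]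
  linear_combination (ψ y * conj (ψ (y + D))) * char_mul_conj_of_isUnit ψ hw

/-- Correlations of `ψ` with its shift by `D` vanish if `p ^ (L - 1) ∤ D`: the substitution
`y ↦ y / (1 + s (y + D))` with `D * s = a - 1` multiplies `(y + D) / y` by `a`. -/
theorem charSum_shift_eq_zero [NeZero (p ^ L)] {b u : ZMod (p ^ L)} {m : ℕ} (hm : m + 1 < L)
    (hu : IsUnit u) (hb : ψ (1 + p ^ (L - 1) * b) ≠ 1) :
    ∑ y, ψ y * conj (ψ (y + p ^ m * u)) = 0 := by
  obtain ⟨r, rfl⟩ : ∃ r, L = m + 2 + r := ⟨L - (m + 2), by omega⟩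
  obtain ⟨v, hv⟩ := hu.exists_right_inv
  set D : ZMod (p ^ (m + 2 + r)) := p ^ m * u with hD
  set a : ZMod (p ^ (m + 2 + r)) := 1 + p ^ (m + 2 + r - 1) * b with ha
  set s : ZMod (p ^ (m + 2 + r)) := p * (p ^ r * v * b) with hs
  have hDs : D * s = a - 1 := by
    have : m + 2 + r - 1 = m + 1 + r := by omega
    rw [hD, hs, ha, this]
    linear_combination ((p : ZMod (p ^ (m + 2 + r))) ^ (m + 1 + r) * b) * hv
  have haU : IsUnit a := by
    have : a = 1 + p * (p ^ (m + r) * b) := by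
      rw [ha, show m + 2 + r - 1 = m + r + 1 by omega]; ring
    rw [this]
    exact isUnit_add_natCast_mul isUnit_one _
  have hk : ∀ y, IsUnit (1 + s * (y + D)) := by
    intro y
    rw [hs, mul_assoc]
    exact isUnit_add_natCast_mul isUnit_one _
  have hinv : ∀ y, (1 + s * (y + D))⁻¹ * (1 + s * (y + D)) = 1 := fun y =>
    ZMod.inv_mul_of_unit _ (hk y)
  refine charSum_eq_zero ψ (fun y => y) (fun y => y + D) (fun y => 1 + s * (y + D))
    (fun y => y * (1 + s * (y + D))⁻¹) ?_ hk 1 a ?_ ?_ ?_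
  · intro y z hyz
    have h1 : y * (1 + s * (z + D)) = z * (1 + s * (y + D)) := by
      have h2 := congrArg (fun x => x * (1 + s * (y + D)) * (1 + s * (z + D))) hyz
      simp only at h2
      linear_combination h2 - y * (1 + s * (z + D)) * hinv y + z * (1 + s * (y + D)) * hinv z
    have h2 : (y - z) * a = 0 := by
      linear_combination h1 - (y - z) * hDs
    exact sub_eq_zero.1 ((haU.mul_left_eq_zero).1 h2)
  · intro y
    linear_combination y * hinv y
  · intro y
    linear_combination y * hinv y + (y + D) * hDs
  · intro h
    apply hb
    rw [map_one, one_mul] at h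
    have := congrArg conj h
    simpa using this

/-- At shifts exactly divisible by `p ^ (L - 1)`, the correlation is found from the vanishing of
the sum of the correlations over all the shifts divisible by `p ^ (L - 1)`. -/
theorem charSum_shift_top (hp : p.Prime) (hL : 1 ≤ L) [NeZero (p ^ L)] {b u : ZMod (p ^ L)}
    (hu : IsUnit u) (hbU : IsUnit (1 + p ^ (L - 1) * b)) (hb : ψ (1 + p ^ (L - 1) * b) ≠ 1) :
    ∑ y, ψ y * conj (ψ (y + p ^ (L - 1) * u)) = (p : ℂ) ^ L * (-(1 / p)) := by
  have hp0 : (p : ℂ) ≠ 0 := by exact_mod_cast hp.ne_zero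
  set a : ZMod (p ^ L) := 1 + p ^ (L - 1) * b with ha
  set q : ZMod (p ^ L) := p ^ (L - 1) with hq
  have hqp : q * p = 0 := by
    rw [hq, ← pow_succ]
    exact natCast_pow_eq_zero _ (by omega)
  have h0 : ∑ D, ∑ y, ψ y * conj (ψ (y + q * D)) = 0 := by
    rw [Finset.sum_comm]
    refine Finset.sum_eq_zero fun y _ => ?_
    have hinj : Function.Injective fun D : ZMod (p ^ L) => b * y + a * D := fun D D' h =>
      hbU.mul_right_injective (add_left_cancel h)
    have h1 : ∑ D, conj (ψ (y + q * D)) = conj (ψ a) * ∑ D, conj (ψ (y + q * D)) := by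
      conv_lhs => rw [← Function.Bijective.sum_comp (Finite.injective_iff_bijective.1 hinj)
        (fun D => conj (ψ (y + q * D)))]
      rw [Finset.mul_sum]
      refine Finset.sum_congr rfl fun D _ => ?_
      rw [← map_mul, ← map_mul]
      congr 2
      rw [ha]
      ring
    have h2 : (1 - conj (ψ a)) * ∑ D, conj (ψ (y + q * D)) = 0 := by linear_combination h1
    have h3 : 1 - conj (ψ a) ≠ 0 := by
      intro h
      apply hb
      have := congrArg conj (sub_eq_zero.1 h)
      simpa using this.symm
    rw [← Finset.mul_sum, (mul_eq_zero.1 h2).resolve_left h3, mul_zero]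
  have hS : ∀ D, ∑ y, ψ y * conj (ψ (y + q * D)) =
      (p : ℂ) ^ L * (1 - 1 / p) +
        (1 : DirichletCharacter ℂ (p ^ L)) D * (∑ y, ψ y * conj (ψ (y + q * u)) -
          (p : ℂ) ^ L * (1 - 1 / p)) := by
    intro D
    by_cases hD : IsUnit D
    · rw [MulChar.one_apply hD, charSum_unit_mul ψ hD q, charSum_unit_mul ψ hu q]
      ring
    · obtain ⟨s, rfl⟩ := exists_eq_mul_of_not_isUnit hp hL hD
      rw [MulChar.map_nonunit _ hD, ← mul_assoc, hqp, zero_mul, charSum_self ψ hp hL]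
      ring
  have hcard : ∑ D, (1 : DirichletCharacter ℂ (p ^ L)) D = (p : ℂ) ^ L * (1 - 1 / p) := by
    rw [← charSum_self (1 : DirichletCharacter ℂ (p ^ L)) hp hL]
    refine Finset.sum_congr rfl fun y _ => ?_
    rw [add_zero]
    by_cases hy : IsUnit y
    · rw [MulChar.one_apply hy]; simp
    · rw [MulChar.map_nonunit _ hy]; simp
  rw [Finset.sum_congr rfl fun D _ => hS D, Finset.sum_add_distrib] at h0
  simp only [Finset.sum_const, Finset.card_univ, ZMod.card, nsmul_eq_mul, Nat.cast_pow] at h0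
  rw [← Finset.sum_mul, hcard] at h0
  have h1 : (p : ℂ) ^ L * (1 - 1 / p) ≠ 0 := by
    refine mul_ne_zero (pow_ne_zero _ hp0) ?_
    intro h
    have h3 : (p : ℂ) = 1 := by
      field_simp at h
      linear_combination h
    exact hp.one_lt.ne' (by exact_mod_cast h3)
  have h2 : ((p : ℂ) ^ L * (1 - 1 / p)) * (∑ y, ψ y * conj (ψ (y + q * u)) +
      (p : ℂ) ^ L * (1 / p)) = 0 := by
    linear_combination h0
  linear_combination (mul_eq_zero.1 h2).resolve_left h1

/-- The substitution `z ↦ z / (a - c z)` with `c * u = (a - 1) * p ^ j` multiplies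
`(p ^ j z - u) / z` by `a`. -/
theorem charSum_linear_eq_zero [NeZero (p ^ L)] {a u : ZMod (p ^ L)} {j : ℕ} (hj : 1 ≤ j)
    (hu : IsUnit u) (haU : IsUnit a) (hb : ψ a ≠ 1) :
    ∑ z, ψ (p ^ j * z - u) * conj (ψ z) = 0 := by
  obtain ⟨i, rfl⟩ : ∃ i, j = i + 1 := ⟨j - 1, by omega⟩
  obtain ⟨v, hv⟩ := hu.exists_right_inv
  set c : ZMod (p ^ L) := (a - 1) * p ^ (i + 1) * v with hc
  have hcu : c * u = (a - 1) * p ^ (i + 1) := by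
    linear_combination ((a - 1) * p ^ (i + 1)) * hv
  have hk : ∀ z, IsUnit (a - c * z) := by
    intro z
    have : a - c * z = a + p * (-((a - 1) * p ^ i * v * z)) := by rw [hc]; ring
    rw [this]
    exact isUnit_add_natCast_mul haU _
  have hinv : ∀ z, (a - c * z)⁻¹ * (a - c * z) = 1 := fun z => ZMod.inv_mul_of_unit _ (hk z)
  refine charSum_eq_zero ψ (fun z => p ^ (i + 1) * z - u) (fun z => z) (fun z => a - c * z)
    (fun z => z * (a - c * z)⁻¹) ?_ hk a 1 ?_ ?_ (by simpa using hb)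
  · intro y z hyz
    have h1 : y * (a - c * z) = z * (a - c * y) := by
      have h2 := congrArg (fun x => x * (a - c * y) * (a - c * z)) hyz
      simp only at h2
      linear_combination h2 - y * (a - c * z) * hinv y + z * (a - c * y) * hinv z
    have h2 : (y - z) * a = 0 := by linear_combination h1
    exact sub_eq_zero.1 ((haU.mul_left_eq_zero).1 h2)
  · intro z
    linear_combination p ^ (i + 1) * z * hinv z + z * hcu
  · intro z
    linear_combination z * hinv z

theorem charSum_linear_conj [NeZero (p ^ L)] (u : ZMod (p ^ L)) (j : ℕ) :
    ∑ z, ψ z * conj (ψ (p ^ j * z + u)) = conj (∑ z, ψ (p ^ j * z - -u) * conj (ψ z)) := by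
  rw [map_sum]
  refine Finset.sum_congr rfl fun z _ => ?_
  rw [map_mul, Complex.conj_conj, sub_neg_eq_add, mul_comm]

end PrimePower

section Trivial

variable {p : ℕ}

theorem one_apply_zmod_prime (hp : p.Prime) (y : ZMod (p ^ 1)) :
    (1 : DirichletCharacter ℂ (p ^ 1)) y = if y = 0 then 0 else 1 := by
  have hp0 : (p : ZMod (p ^ 1)) = 0 := by
    simpa using natCast_pow_eq_zero (p := p) (L := 1) 1 le_rfl
  have : Fact (1 < p ^ 1) := ⟨by simpa using hp.one_lt⟩
  split_ifs with h
  · rw [h, MulChar.map_nonunit _ not_isUnit_zero]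
  · refine MulChar.one_apply ?_
    by_contra hy
    obtain ⟨s, rfl⟩ := exists_eq_mul_of_not_isUnit hp le_rfl hy
    exact h (by rw [hp0, zero_mul])

theorem trivialSum_shift (hp : p.Prime) [NeZero (p ^ 1)] {u : ZMod (p ^ 1)} (hu : u ≠ 0) :
    ∑ y, (1 : DirichletCharacter ℂ (p ^ 1)) y *
      conj ((1 : DirichletCharacter ℂ (p ^ 1)) (y + u)) = (p : ℂ) ^ 1 * (1 - 2 / p) := by
  have hp0 : (p : ℂ) ≠ 0 := by exact_mod_cast hp.ne_zero
  have h : ∀ y : ZMod (p ^ 1), (1 : DirichletCharacter ℂ (p ^ 1)) y *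
      conj ((1 : DirichletCharacter ℂ (p ^ 1)) (y + u)) =
      1 - (if y = 0 then 1 else 0) - (if y = -u then 1 else 0) := by
    intro y
    rw [one_apply_zmod_prime hp, one_apply_zmod_prime hp]
    by_cases h1 : y = 0
    · subst h1
      simp [hu, eq_comm]
    · by_cases h2 : y = -u
      · subst h2
        simp [hu]
      · have h3 : y + u ≠ 0 := fun h => h2 (eq_neg_of_add_eq_zero_left h)
        simp [h1, h2, h3]
  rw [Finset.sum_congr rfl fun y _ => h y, Finset.sum_sub_distrib, Finset.sum_sub_distrib]
  simp only [Finset.sum_const, Finset.card_univ, ZMod.card, nsmul_eq_mul, Finset.sum_ite_eq',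
    Finset.mem_univ, if_true, Nat.cast_pow]
  field_simp
  ring

theorem trivialSum_linear (hp : p.Prime) [NeZero (p ^ 1)] {u : ZMod (p ^ 1)} (hu : IsUnit u)
    {j : ℕ} (hj : 1 ≤ j) :
    ∑ z, (1 : DirichletCharacter ℂ (p ^ 1)) ((p : ZMod (p ^ 1)) ^ j * z - u) *
      conj ((1 : DirichletCharacter ℂ (p ^ 1)) z) = (p : ℂ) ^ 1 * (1 - 1 / p) := by
  rw [← charSum_self (1 : DirichletCharacter ℂ (p ^ 1)) hp le_rfl]
  refine Finset.sum_congr rfl fun z _ => ?_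
  rw [natCast_pow_eq_zero j hj, zero_mul, zero_sub, MulChar.one_apply hu.neg, one_mul, add_zero]
  by_cases hz : IsUnit z
  · rw [MulChar.one_apply hz]; simp
  · rw [MulChar.map_nonunit _ hz]; simp

end Trivial

/-! ### Correlations of local functions -/

/-- The function supported on the multiples of `p ^ k` which takes the value `g m` at
`p ^ k * m`. -/
noncomputable def powDilate (p k : ℕ) (g : ℕ → ℂ) (n : ℕ) : ℂ :=
  if p ^ k ∣ n then g (n / p ^ k) else 0

/-- The function `p ^ a * m ↦ c a * ψ m` (for `p ∤ m`) on positive integers: it depends only on `n`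
as a `p`-adic integer. -/
noncomputable def localFun {p L : ℕ} (c : ℕ → ℂ) (ψ : DirichletCharacter ℂ (p ^ L)) (n : ℕ) : ℂ :=
  c (n.factorization p) * ψ ((n / p ^ n.factorization p : ℕ) : ZMod (p ^ L))

section LocalFun

variable {p : ℕ}

theorem factorization_pow_mul (hp : p.Prime) {m : ℕ} (hm : ¬ p ∣ m) (a : ℕ) :
    (p ^ a * m).factorization p = a := by
  have hm0 : m ≠ 0 := by rintro rfl; exact hm (dvd_zero p)
  rw [Nat.factorization_mul (pow_ne_zero _ hp.ne_zero) hm0, Finsupp.add_apply,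
    hp.factorization_pow, Finsupp.single_eq_same, Nat.factorization_eq_zero_of_not_dvd hm,
    add_zero]

theorem pow_mul_inj (hp : p.Prime) {a b m m' : ℕ} (hm : ¬ p ∣ m) (hm' : ¬ p ∣ m')
    (h : p ^ a * m = p ^ b * m') : a = b ∧ m = m' := by
  have h1 : a = b := by
    rw [← factorization_pow_mul hp hm a, h, factorization_pow_mul hp hm']
  subst h1
  exact ⟨rfl, Nat.eq_of_mul_eq_mul_left (pow_pos hp.pos a) h⟩

theorem pow_dvd_pow_mul_iff (hp : p.Prime) {a m k : ℕ} (hm : ¬ p ∣ m) :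
    p ^ k ∣ p ^ a * m ↔ k ≤ a := by
  refine ⟨fun h => ?_, fun h => (pow_dvd_pow p h).mul_right m⟩
  have hm0 : m ≠ 0 := by rintro rfl; exact hm (dvd_zero p)
  have h1 := (hp.pow_dvd_iff_le_factorization
    (mul_ne_zero (pow_ne_zero a hp.ne_zero) hm0)).1 h
  rwa [factorization_pow_mul hp hm] at h1

theorem localFun_pow_mul (hp : p.Prime) {L : ℕ} (c : ℕ → ℂ) (ψ : DirichletCharacter ℂ (p ^ L))
    {m : ℕ} (hm : ¬ p ∣ m) (a : ℕ) : localFun c ψ (p ^ a * m) = c a * ψ m := by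
  rw [localFun, factorization_pow_mul hp hm, Nat.mul_div_cancel_left _ (pow_pos hp.pos a)]

theorem powDilate_pow_mul (hp : p.Prime) {g : ℕ → ℂ} (hg : ∀ m, p ∣ m → g m = 0) {m : ℕ}
    (hm : ¬ p ∣ m) (a k : ℕ) : powDilate p k g (p ^ a * m) = if k = a then g m else 0 := by
  rw [powDilate]
  rcases lt_trichotomy k a with h | h | h
  · rw [if_pos ((pow_dvd_pow_mul_iff hp hm).2 h.le), if_neg h.ne]
    obtain ⟨i, rfl⟩ : ∃ i, a = k + (i + 1) := ⟨a - (k + 1), by omega⟩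
    rw [pow_add, mul_assoc, Nat.mul_div_cancel_left _ (pow_pos hp.pos k)]
    exact hg _ (((dvd_pow_self p (by omega : i + 1 ≠ 0))).mul_right m)
  · subst h
    rw [if_pos (dvd_mul_right _ _), if_pos rfl, Nat.mul_div_cancel_left _ (pow_pos hp.pos k)]
  · rw [if_neg (fun h' => by have := (pow_dvd_pow_mul_iff hp hm).1 h'; omega), if_neg h.ne']

theorem powDilate_periodic (hp : p.Prime) {g : ℕ → ℂ} {k L M : ℕ}
    (hg : Function.Periodic g (p ^ L)) (hM : k + L ≤ M) :
    Function.Periodic (powDilate p k g) (p ^ M) := by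
  obtain ⟨i, rfl⟩ : ∃ i, M = k + (L + i) := ⟨M - (k + L), by omega⟩
  intro n
  have h0 : p ^ (k + (L + i)) = p ^ k * (p ^ i * p ^ L) := by ring
  simp only [powDilate, h0, Nat.dvd_add_left (dvd_mul_right (p ^ k) (p ^ i * p ^ L))]
  split_ifs with h
  · rw [Nat.add_mul_div_left _ _ (pow_pos hp.pos k)]
    exact (hg.nat_mul _) _
  · rfl

theorem natCast_periodic {M : ℕ} (g : ZMod M → ℂ) :
    Function.Periodic (fun n : ℕ => g (n : ZMod M)) M := by
  intro n
  simp

theorem char_natCast_eq_zero (hp : p.Prime) {L : ℕ} (hL : 1 ≤ L)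
    (ψ : DirichletCharacter ℂ (p ^ L)) {m : ℕ} (hm : p ∣ m) : ψ (m : ZMod (p ^ L)) = 0 :=
  ψ.map_nonunit fun h => (isUnit_natCast_iff hp hL m).1 h hm

theorem norm_localFun_le {L : ℕ} {c : ℕ → ℂ} (hc : ∀ a, ‖c a‖ ≤ 1)
    (ψ : DirichletCharacter ℂ (p ^ L)) (n : ℕ) : ‖localFun c ψ n‖ ≤ 1 :=
  norm_mul_le_one (hc _) (ψ.norm_le_one _)

theorem norm_conj_le_one {z : ℂ} (hz : ‖z‖ ≤ 1) : ‖conj z‖ ≤ 1 := by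
  rwa [RCLike.norm_conj]

/-- The part of the correlation of `localFun c ψ` with its shift by `p ^ e * u` coming from the `n`
for which neither `n` nor `n + p ^ e * u` is divisible by `p ^ (K + 1)`, sorted by the exact powers
of `p` dividing `n` and `n + p ^ e * u`: these powers are equal and at most `p ^ e`, or one of them
is `p ^ e` and the other one is larger. -/
noncomputable def correlationTrunc {L : ℕ} (c : ℕ → ℂ) (ψ : DirichletCharacter ℂ (p ^ L))
    (e u K n : ℕ) : ℂ :=
  ∑ a ∈ Finset.range (e + 1), (‖c a‖ : ℂ) ^ 2 * powDilate p a
      (fun m => ψ m * conj (ψ (m + ((p ^ (e - a) * u : ℕ) : ZMod (p ^ L))))) n +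
  ∑ k ∈ Finset.Ioc e K,
    (c e * conj (c k) * powDilate p k
        (fun z => ψ ((p : ZMod (p ^ L)) ^ (k - e) * z - u) * conj (ψ z)) (n + p ^ e * u) +
      conj (c e) * c k * powDilate p k
        (fun z => ψ z * conj (ψ ((p : ZMod (p ^ L)) ^ (k - e) * z + u))) n)

theorem correlationTrunc_eq (hp : p.Prime) {L : ℕ} (hL : 1 ≤ L) (c : ℕ → ℂ)
    (ψ : DirichletCharacter ℂ (p ^ L)) {e u K n : ℕ} (hu : ¬ p ∣ u) (hK : e ≤ K) (hn : 0 < n) :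
    correlationTrunc c ψ e u K n = if p ^ (K + 1) ∣ n ∨ p ^ (K + 1) ∣ n + p ^ e * u then 0
      else localFun c ψ n * conj (localFun c ψ (n + p ^ e * u)) := by
  obtain ⟨a, m, hm, hnm⟩ := Nat.exists_eq_pow_mul_and_not_dvd hn.ne' p hp.ne_one
  obtain ⟨b, m', hm', hnm'⟩ := Nat.exists_eq_pow_mul_and_not_dvd
    (show n + p ^ e * u ≠ 0 by omega) p hp.ne_one
  have z1 : ∀ a m, p ∣ m →
      ψ m * conj (ψ (m + ((p ^ (e - a) * u : ℕ) : ZMod (p ^ L)))) = 0 := fun a m h => by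
    rw [char_natCast_eq_zero hp hL ψ h, zero_mul]
  have z2 : ∀ k m, p ∣ m →
      ψ ((p : ZMod (p ^ L)) ^ (k - e) * m - u) * conj (ψ m) = 0 := fun k m h => by
    rw [char_natCast_eq_zero hp hL ψ h, map_zero, mul_zero]
  have z3 : ∀ k m, p ∣ m →
      ψ m * conj (ψ ((p : ZMod (p ^ L)) ^ (k - e) * m + u)) = 0 := fun k m h => by
    rw [char_natCast_eq_zero hp hL ψ h, zero_mul]
  rw [correlationTrunc, hnm', hnm]
  simp only [powDilate_pow_mul hp (z1 _) hm, powDilate_pow_mul hp (z2 _) hm',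
    powDilate_pow_mul hp (z3 _) hm, pow_dvd_pow_mul_iff hp hm, pow_dvd_pow_mul_iff hp hm',
    localFun_pow_mul hp c ψ hm, localFun_pow_mul hp c ψ hm', mul_ite, mul_zero,
    Finset.sum_add_distrib, Finset.sum_ite_eq', Finset.mem_range, Finset.mem_Ioc]
  have hcc : ∀ z : ℂ, (‖z‖ : ℂ) ^ 2 = z * conj z := fun z => (Complex.mul_conj' z).symm
  rw [hnm] at hnm'
  -- `a` and `b` are the valuations at `p` of `n` and `n + p ^ e * u`; if `a < e`, then `b = a`
  rcases lt_trichotomy a e with h | h | h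
  · obtain ⟨i, rfl⟩ : ∃ i, e = a + (i + 1) := ⟨e - (a + 1), by omega⟩
    have h1 : ¬ p ∣ m + p ^ (i + 1) * u := by
      rwa [Nat.dvd_add_left ((dvd_pow_self p (by omega : i + 1 ≠ 0)).mul_right u)]
    obtain ⟨rfl, rfl⟩ := pow_mul_inj hp (a := a) h1 hm' (by rw [← hnm']; ring)
    rw [if_pos (by omega), if_neg (by omega), if_neg (by omega), if_neg (by omega), hcc,
      Nat.add_sub_cancel_left]
    push_cast
    rw [map_mul]
    ring
  · subst h
    -- if `a = e`, then `b > e` or `b = e` according to whether `p ∣ m + u`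
    by_cases h : p ∣ m + u
    · have hb : a < b := by
        rw [← Nat.add_one_le_iff, ← pow_dvd_pow_mul_iff hp hm' (k := a + 1), ← hnm', ← mul_add,
          pow_succ]
        exact Nat.mul_dvd_mul_left _ h
      obtain ⟨i, rfl⟩ : ∃ i, b = a + (i + 1) := ⟨b - (a + 1), by omega⟩
      have h1 : m + u = p ^ (i + 1) * m' :=
        Nat.eq_of_mul_eq_mul_left (pow_pos hp.pos a) (by rw [mul_add, hnm']; ring)
      have h2 : ψ (m + ((p ^ (a - a) * u : ℕ) : ZMod (p ^ L))) = 0 := by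
        rw [← Nat.cast_add]
        exact char_natCast_eq_zero hp hL ψ (by simpa using h)
      have h3 : (p : ZMod (p ^ L)) ^ (i + 1) * m' - u = m := by
        rw [sub_eq_iff_eq_add]
        have h5 := congrArg (Nat.cast : ℕ → ZMod (p ^ L)) h1.symm
        push_cast at h5
        exact h5
      rw [h2, Nat.add_sub_cancel_left, h3]
      by_cases h4 : a + (i + 1) ≤ K
      · rw [if_pos (by omega), if_pos (by omega), if_neg (by omega), if_neg (by omega), map_mul,
          map_zero]
        ring
      · rw [if_pos (by omega), if_neg (by omega), if_neg (by omega), if_pos (by omega),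
          map_zero]
        ring
    · obtain ⟨rfl, rfl⟩ := pow_mul_inj hp (a := a) h hm' (by rw [← hnm']; ring)
      rw [if_pos (by omega), if_neg (by omega), if_neg (by omega), if_neg (by omega), hcc,
        Nat.sub_self, pow_zero, one_mul, map_mul, Nat.cast_add]
      ring
  -- if `a > e`, then `b = e`
  · obtain ⟨i, rfl⟩ : ∃ i, a = e + (i + 1) := ⟨a - (e + 1), by omega⟩
    have h1 : ¬ p ∣ p ^ (i + 1) * m + u := by
      rwa [Nat.dvd_add_right ((dvd_pow_self p (by omega : i + 1 ≠ 0)).mul_right m)]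
    obtain ⟨rfl, rfl⟩ := pow_mul_inj hp (a := e) h1 hm' (by rw [← hnm']; ring)
    rw [if_neg (by omega), if_neg (by omega), Nat.add_sub_cancel_left]
    by_cases h4 : e + (i + 1) ≤ K
    · rw [if_pos (by omega), if_neg (by omega), map_mul]
      push_cast
      ring
    · rw [if_neg (by omega), if_pos (by omega)]
      ring

theorem correlationTrunc_periodic (hp : p.Prime) {L : ℕ} (c : ℕ → ℂ)
    (ψ : DirichletCharacter ℂ (p ^ L)) {e u K : ℕ} (hK : e ≤ K) :
    Function.Periodic (correlationTrunc c ψ e u K) (p ^ (K + L)) := by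
  intro n
  rw [correlationTrunc, correlationTrunc]
  congr 1
  · refine Finset.sum_congr rfl fun a ha => ?_
    rw [powDilate_periodic hp (natCast_periodic fun x : ZMod (p ^ L) =>
      ψ x * conj (ψ (x + ((p ^ (e - a) * u : ℕ) : ZMod (p ^ L)))))
        (by have := Finset.mem_range.1 ha; omega)]
  · refine Finset.sum_congr rfl fun k hk => ?_
    have hk' : k + L ≤ K + L := by have := (Finset.mem_Ioc.1 hk).2; omega
    rw [powDilate_periodic hp (natCast_periodic fun z : ZMod (p ^ L) =>
        ψ z * conj (ψ ((p : ZMod (p ^ L)) ^ (k - e) * z + u))) hk', add_right_comm,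
      powDilate_periodic hp (natCast_periodic fun z : ZMod (p ^ L) =>
        ψ ((p : ZMod (p ^ L)) ^ (k - e) * z - u) * conj (ψ z)) hk']

theorem hasMean_powDilate (hp : p.Prime) {L : ℕ} [NeZero (p ^ L)] (k : ℕ) (g : ZMod (p ^ L) → ℂ)
    {κ : ℂ} (hκ : ∑ x, g x = (p : ℂ) ^ L * κ) :
    HasMean (powDilate p k fun m => g (m : ZMod (p ^ L))) (κ / (p : ℂ) ^ k) := by
  have hp0 : (p : ℂ) ≠ 0 := by exact_mod_cast hp.ne_zero
  have h := (hasMean_zmod (p ^ L) g).dilate (pow_pos hp.pos k)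
  rw [hκ] at h
  push_cast at h
  rwa [mul_div_cancel_left₀ _ (pow_ne_zero L hp0)] at h

theorem correlationTrunc_hasMean (hp : p.Prime) {L : ℕ} [NeZero (p ^ L)] (c : ℕ → ℂ)
    (ψ : DirichletCharacter ℂ (p ^ L)) {e u : ℕ} {κ : ℕ → ℂ} {T : ℂ}
    (hκ : ∀ a ≤ e, ∑ y, ψ y * conj (ψ (y + ((p ^ (e - a) * u : ℕ) : ZMod (p ^ L)))) =
      (p : ℂ) ^ L * κ a)
    (hT : ∀ j, 1 ≤ j →
      ∑ z, ψ ((p : ZMod (p ^ L)) ^ j * z - u) * conj (ψ z) = (p : ℂ) ^ L * T)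
    (hT' : ∀ j, 1 ≤ j →
      ∑ z, ψ z * conj (ψ ((p : ZMod (p ^ L)) ^ j * z + u)) = (p : ℂ) ^ L * T) (K : ℕ) :
    HasMean (correlationTrunc c ψ e u K)
      (∑ a ∈ Finset.range (e + 1), (‖c a‖ : ℂ) ^ 2 * (κ a / (p : ℂ) ^ a) +
        ∑ k ∈ Finset.Ioc e K, (c e * conj (c k) * (T / (p : ℂ) ^ k) +
          conj (c e) * c k * (T / (p : ℂ) ^ k))) := by
  refine HasMean.add (HasMean.finsetSum _ fun a ha => ?_) (HasMean.finsetSum _ fun k hk => ?_)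
  · exact (hasMean_powDilate hp a _ (hκ a (by have := Finset.mem_range.1 ha; omega))).const_mul _
  · have hk' : 1 ≤ k - e := by have := (Finset.mem_Ioc.1 hk).1; omega
    exact ((((hasMean_powDilate hp k _ (hT _ hk')).shift (p ^ e * u))).const_mul _).add
      ((hasMean_powDilate hp k _ (hT' _ hk')).const_mul _)

theorem card_filter_dvd_add_le {k N d : ℕ} :
    (((Finset.Ioc 0 N).filter fun n => k ∣ n + d).card : ℝ) ≤ ((N + d : ℕ) : ℝ) / k := by
  refine le_trans ?_ (Nat.cast_div_le (α := ℝ) (m := N + d) (n := k))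
  rw [← Nat.Ioc_filter_dvd_card_eq_div]
  have : ((Finset.Ioc 0 N).filter fun n => k ∣ n + d).card ≤
      ((Finset.Ioc 0 (N + d)).filter fun n => k ∣ n).card := by
    refine Finset.card_le_card_of_injOn (fun n => n + d) ?_ (fun a _ b _ h => by simpa using h)
    intro n hn
    simp only [Finset.coe_filter, Finset.mem_Ioc, Set.mem_ofPred_eq] at hn ⊢
    exact ⟨by omega, hn.2⟩
  exact_mod_cast this

/-- Removing the `n` for which `n` or `n + d` is divisible by a high power of `p` changes a function
little on average. -/
theorem exists_sum_norm_sub_le (hp : p.Prime) {w : ℕ → ℂ} (hw : ∀ n, ‖w n‖ ≤ 1) (d : ℕ) {ε : ℝ}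
    (hε : 0 < ε) : ∃ K₀ : ℕ, ∀ K ≥ K₀, ∀ᶠ N : ℕ in atTop, ∑ n ∈ Finset.Ioc 0 N,
      ‖w n - (if p ^ (K + 1) ∣ n ∨ p ^ (K + 1) ∣ n + d then 0 else w n)‖ ≤ ε * N := by
  have hp1 : (1 : ℝ) < p := by exact_mod_cast hp.one_lt
  have h1 : Tendsto (fun K : ℕ => 3 * ((p : ℝ)⁻¹) ^ (K + 1)) atTop (𝓝 (3 * 0)) :=
    ((tendsto_pow_atTop_nhds_zero_of_lt_one (by positivity)
      (inv_lt_one_of_one_lt₀ hp1)).comp (tendsto_add_atTop_nat 1)).const_mul 3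
  rw [mul_zero] at h1
  obtain ⟨K₀, hK₀⟩ := eventually_atTop.1 (h1.eventually_le_const hε)
  refine ⟨K₀, fun K hK => ?_⟩
  filter_upwards [eventually_ge_atTop d] with N hN
  have hP : (0 : ℝ) < (p : ℝ) ^ (K + 1) := by positivity
  have h2 : ∀ n, ‖w n - (if p ^ (K + 1) ∣ n ∨ p ^ (K + 1) ∣ n + d then 0 else w n)‖ ≤
      (if p ^ (K + 1) ∣ n + 0 then (1 : ℝ) else 0) + (if p ^ (K + 1) ∣ n + d then 1 else 0) := by
    intro n
    rw [add_zero]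
    split_ifs <;> simp_all
    linarith [hw n]
  calc _ ≤ _ := Finset.sum_le_sum fun n _ => h2 n
    _ ≤ ((N + 0 : ℕ) : ℝ) / (p ^ (K + 1) : ℕ) + ((N + d : ℕ) : ℝ) / (p ^ (K + 1) : ℕ) := by
        rw [Finset.sum_add_distrib, Finset.sum_boole, Finset.sum_boole]
        exact add_le_add card_filter_dvd_add_le card_filter_dvd_add_le
    _ ≤ 3 * ((p : ℝ)⁻¹) ^ (K + 1) * N := by
        have : (d : ℝ) ≤ N := by exact_mod_cast hN
        push_cast
        rw [← add_div, div_le_iff₀ hP, inv_pow]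
        field_simp
        linarith
    _ ≤ ε * N := by gcongr; exact hK₀ K hK

theorem summable_tail (hp : p.Prime) {c : ℕ → ℂ} (hc : ∀ a, ‖c a‖ ≤ 1) (e : ℕ) :
    Summable fun i : ℕ => c e * conj (c (e + 1 + i)) / (p : ℂ) ^ (e + 1 + i) +
      conj (c e) * c (e + 1 + i) / (p : ℂ) ^ (e + 1 + i) := by
  have hp1 : (1 : ℝ) < p := by exact_mod_cast hp.one_lt
  have hg : Summable fun i : ℕ => 2 * ((p : ℝ)⁻¹) ^ i :=
    (summable_geometric_of_lt_one (by positivity) (inv_lt_one_of_one_lt₀ hp1)).mul_left 2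
  refine Summable.of_norm_bounded hg fun i => ?_
  rw [← add_div, norm_div, norm_pow, Complex.norm_natCast, inv_pow, ← div_eq_mul_inv]
  have h1 : ‖c e * conj (c (e + 1 + i)) + conj (c e) * c (e + 1 + i)‖ ≤ 2 := by
    have h2 := norm_mul_le_one (hc e) (norm_conj_le_one (hc (e + 1 + i)))
    have h3 := norm_mul_le_one (norm_conj_le_one (hc e)) (hc (e + 1 + i))
    exact (norm_add_le _ _).trans (by linarith)
  gcongr
  · exact hp1.le
  · omega

/-- The mean value of the correlation of `localFun c ψ` with its shift by `d = p ^ e * u`, in terms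
of complete character sums. -/
theorem localFun_correlation (hp : p.Prime) {L : ℕ} (hL : 1 ≤ L) [NeZero (p ^ L)] {c : ℕ → ℂ}
    (hc : ∀ a, ‖c a‖ ≤ 1) (ψ : DirichletCharacter ℂ (p ^ L)) {d e u : ℕ} (hd : d = p ^ e * u)
    (hu : ¬ p ∣ u) {κ : ℕ → ℂ} {T : ℂ}
    (hκ : ∀ a ≤ e, ∑ y, ψ y * conj (ψ (y + ((p ^ (e - a) * u : ℕ) : ZMod (p ^ L)))) =
      (p : ℂ) ^ L * κ a)
    (hT : ∀ j, 1 ≤ j →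
      ∑ z, ψ ((p : ZMod (p ^ L)) ^ j * z - u) * conj (ψ z) = (p : ℂ) ^ L * T)
    (hT' : ∀ j, 1 ≤ j →
      ∑ z, ψ z * conj (ψ ((p : ZMod (p ^ L)) ^ j * z + u)) = (p : ℂ) ^ L * T) :
    LimitPeriodic p (fun n => localFun c ψ n * conj (localFun c ψ (n + d))) ∧
    HasMean (fun n => localFun c ψ n * conj (localFun c ψ (n + d)))
      (∑ a ∈ Finset.range (e + 1), κ a * (‖c a‖ : ℂ) ^ 2 / (p : ℂ) ^ a +
        T * ∑' i : ℕ, (c e * conj (c (e + 1 + i)) / (p : ℂ) ^ (e + 1 + i) +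
          conj (c e) * c (e + 1 + i) / (p : ℂ) ^ (e + 1 + i))) := by
  subst hd
  have hw : ∀ n, ‖localFun c ψ n * conj (localFun c ψ (n + p ^ e * u))‖ ≤ 1 := fun n =>
    norm_mul_le_one (norm_localFun_le hc ψ n) (norm_conj_le_one (norm_localFun_le hc ψ _))
  have happ : ∀ ε : ℝ, 0 < ε → ∃ K₀ : ℕ, ∀ K ≥ K₀, ∀ᶠ N : ℕ in atTop, ∑ n ∈ Finset.Ioc 0 N,
      ‖localFun c ψ n * conj (localFun c ψ (n + p ^ e * u)) - correlationTrunc c ψ e u K n‖ ≤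
        ε * N := by
    intro ε hε
    obtain ⟨K₀, h⟩ := exists_sum_norm_sub_le hp hw (p ^ e * u) hε
    refine ⟨max e K₀, fun K hK => ?_⟩
    filter_upwards [h K (le_of_max_le_right hK)] with N hN
    refine le_trans (le_of_eq ?_) hN
    refine Finset.sum_congr rfl fun n hn => ?_
    rw [correlationTrunc_eq hp hL c ψ hu (le_of_max_le_left hK) (Finset.mem_Ioc.1 hn).1]
  refine ⟨⟨hw, fun ε hε => ?_⟩, HasMean.of_approx fun ε hε => ?_⟩
  · obtain ⟨K₀, h⟩ := happ ε hε
    set K := max e K₀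
    have hpos : ∀ n, 0 < n → ‖correlationTrunc c ψ e u K n‖ ≤ 1 := by
      intro n hn
      rw [correlationTrunc_eq hp hL c ψ hu (le_max_left _ _) hn]
      split_ifs
      · simp
      · exact hw n
    refine ⟨correlationTrunc c ψ e u K, K + L,
      correlationTrunc_periodic hp c ψ (le_max_left _ _), fun n => ?_, h K (le_max_right _ _)⟩
    -- `correlationTrunc_eq` needs a positive argument, so `n = 0` is moved by a period
    rw [← correlationTrunc_periodic hp c ψ (le_max_left e K₀) n]
    exact hpos _ (Nat.add_pos_right _ (pow_pos hp.pos _))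
  · obtain ⟨K₀, h⟩ := happ ε hε
    have hsum := ((summable_tail hp hc e).hasSum.tendsto_sum_nat.const_mul T)
    rw [Metric.tendsto_atTop] at hsum
    obtain ⟨J₀, hJ₀⟩ := hsum ε hε
    set J := max J₀ K₀
    refine ⟨correlationTrunc c ψ e u (e + J), _,
      correlationTrunc_hasMean hp c ψ hκ hT hT' (e + J), ?_,
      h _ ((le_max_right _ _).trans (Nat.le_add_left _ _))⟩
    have h1 := (hJ₀ J (le_max_left _ _)).le
    rw [dist_eq_norm] at h1
    refine le_trans (le_of_eq ?_) h1
    congr 1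
    have h2 : ∑ k ∈ Finset.Ioc e (e + J), (c e * conj (c k) * (T / (p : ℂ) ^ k) +
        conj (c e) * c k * (T / (p : ℂ) ^ k)) =
        T * ∑ i ∈ Finset.range J, (c e * conj (c (e + 1 + i)) / (p : ℂ) ^ (e + 1 + i) +
          conj (c e) * c (e + 1 + i) / (p : ℂ) ^ (e + 1 + i)) := by
      rw [Finset.mul_sum, ← Finset.Ico_add_one_add_one_eq_Ioc, Finset.sum_Ico_eq_sum_range]
      rw [show e + J + 1 - (e + 1) = J by omega]
      refine Finset.sum_congr rfl fun i _ => ?_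
      ring
    rw [h2]
    have h3 : ∑ a ∈ Finset.range (e + 1), (‖c a‖ : ℂ) ^ 2 * (κ a / (p : ℂ) ^ a) =
        ∑ a ∈ Finset.range (e + 1), κ a * (‖c a‖ : ℂ) ^ 2 / (p : ℂ) ^ a :=
      Finset.sum_congr rfl fun a _ => by ring
    rw [h3]
    ring

end LocalFun

/-! ### The Turán–Kubilius inequality and exponentials of additive functions -/

theorem sum_boole_dvd (k N : ℕ) :
    ∑ n ∈ Finset.Ioc 0 N, (if k ∣ n then (1 : ℝ) else 0) = ((N / k : ℕ) : ℝ) := by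
  rw [Finset.sum_boole, Nat.Ioc_filter_dvd_card_eq_div]

theorem natCast_div_bounds {k : ℕ} (hk : 0 < k) (N : ℕ) :
    ((N / k : ℕ) : ℝ) ≤ (N : ℝ) / k ∧ (N : ℝ) / k ≤ ((N / k : ℕ) : ℝ) + 1 := by
  refine ⟨Nat.cast_div_le, ?_⟩
  have hk' : (0 : ℝ) < k := by exact_mod_cast hk
  rw [div_le_iff₀ hk']
  have := (Nat.lt_mul_div_succ N hk).le
  have h : (N : ℝ) ≤ (k : ℝ) * ((N / k : ℕ) + 1) := by exact_mod_cast this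
  linarith

/-- The normalized indicator of the multiples of `p`. -/
noncomputable def centeredDvd (p n : ℕ) : ℝ := (if p ∣ n then 1 else 0) - 1 / p

theorem sum_centeredDvd_mul_self_le {p : ℕ} (hp : p.Prime) (N : ℕ) :
    |∑ n ∈ Finset.Ioc 0 N, centeredDvd p n * centeredDvd p n| ≤ N / p := by
  have hp2 : (2 : ℝ) ≤ p := by exact_mod_cast hp.two_le
  rw [abs_of_nonneg (Finset.sum_nonneg fun n _ => mul_self_nonneg _)]
  have h : ∀ n, centeredDvd p n * centeredDvd p n =
      (1 - 2 / p) * (if p ∣ n then (1 : ℝ) else 0) + (1 / (p : ℝ)) * (1 / p) := by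
    intro n
    rw [centeredDvd]
    split_ifs <;> ring
  rw [Finset.sum_congr rfl fun n _ => h n, Finset.sum_add_distrib, ← Finset.mul_sum,
    sum_boole_dvd]
  simp only [Finset.sum_const, Nat.card_Ioc, Nat.sub_zero, nsmul_eq_mul]
  have h1 := (natCast_div_bounds hp.pos N).1
  have h2 : 0 ≤ 1 - 2 / (p : ℝ) := by
    rw [sub_nonneg, div_le_one (by linarith)]
    exact hp2
  calc (1 - 2 / (p : ℝ)) * ((N / p : ℕ) : ℝ) + N * (1 / (p : ℝ) * (1 / p))
      ≤ (1 - 2 / (p : ℝ)) * (N / p) + N * (1 / (p : ℝ) * (1 / p)) := by gcongr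
    _ = N / p - N * (1 / (p : ℝ) * (1 / p)) := by ring
    _ ≤ N / p := sub_le_self _ (by positivity)

theorem sum_centeredDvd_mul_le {p r : ℕ} (hp : p.Prime) (hr : r.Prime) (hpr : p ≠ r) (N : ℕ) :
    |∑ n ∈ Finset.Ioc 0 N, centeredDvd p n * centeredDvd r n| ≤ 1 := by
  have hp2 : (2 : ℝ) ≤ p := by exact_mod_cast hp.two_le
  have hr2 : (2 : ℝ) ≤ r := by exact_mod_cast hr.two_le
  have hc : p.Coprime r := (Nat.coprime_primes hp hr).2 hpr
  have h : ∀ n, centeredDvd p n * centeredDvd r n =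
      (if p * r ∣ n then (1 : ℝ) else 0) - (1 / r) * (if p ∣ n then (1 : ℝ) else 0)
        - (1 / p) * (if r ∣ n then (1 : ℝ) else 0) + (1 / (p : ℝ)) * (1 / r) := by
    intro n
    have h1 : p * r ∣ n ↔ p ∣ n ∧ r ∣ n := ⟨fun h => ⟨dvd_of_mul_right_dvd h,
      dvd_of_mul_left_dvd h⟩, fun h => hc.mul_dvd_of_dvd_of_dvd h.1 h.2⟩
    rw [centeredDvd, centeredDvd]
    by_cases h2 : p ∣ n <;> by_cases h3 : r ∣ n <;> simp [h1, h2, h3] <;> ring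
  rw [Finset.sum_congr rfl fun n _ => h n, Finset.sum_add_distrib, Finset.sum_sub_distrib,
    Finset.sum_sub_distrib, ← Finset.mul_sum, ← Finset.mul_sum, sum_boole_dvd, sum_boole_dvd,
    sum_boole_dvd]
  simp only [Finset.sum_const, Nat.card_Ioc, Nat.sub_zero, nsmul_eq_mul]
  obtain ⟨a1, a2⟩ := natCast_div_bounds (Nat.mul_pos hp.pos hr.pos) N
  obtain ⟨b1, b2⟩ := natCast_div_bounds hp.pos N
  obtain ⟨c1, c2⟩ := natCast_div_bounds hr.pos N
  push_cast at a1 a2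
  set A := ((N / (p * r) : ℕ) : ℝ)
  set B := ((N / p : ℕ) : ℝ)
  set C := ((N / r : ℕ) : ℝ)
  have hp' : 0 < 1 / (p : ℝ) ∧ 1 / (p : ℝ) ≤ 1 / 2 :=
    ⟨by positivity, one_div_le_one_div_of_le (by norm_num) hp2⟩
  have hr' : 0 < 1 / (r : ℝ) ∧ 1 / (r : ℝ) ≤ 1 / 2 :=
    ⟨by positivity, one_div_le_one_div_of_le (by norm_num) hr2⟩
  have hx : (N : ℝ) / (p * r) = N * (1 / p) * (1 / r) := by field_simp
  have hb : (N : ℝ) / p = N * (1 / p) := by ring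
  have hcc : (N : ℝ) / r = N * (1 / r) := by ring
  rw [hx] at a1 a2
  rw [hb] at b1 b2
  rw [hcc] at c1 c2
  set x := 1 / (p : ℝ)
  set y := 1 / (r : ℝ)
  have e1 : 0 ≤ y * (N * x - B) := mul_nonneg hr'.1.le (by linarith)
  have e2 : y * (N * x - B) ≤ 1 / 2 * 1 :=
    mul_le_mul hr'.2 (by linarith) (by linarith) (by norm_num)
  have e3 : 0 ≤ x * (N * y - C) := mul_nonneg hp'.1.le (by linarith)
  have e4 : x * (N * y - C) ≤ 1 / 2 * 1 :=
    mul_le_mul hp'.2 (by linarith) (by linarith) (by norm_num)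
  rw [abs_le]
  constructor <;> nlinarith

/-- The Turán–Kubilius inequality for primes up to `√N`, where the error terms of the covariances
are bounded trivially. -/
theorem turan_kubilius {S : Finset ℕ} {s N : ℕ} (hS : ∀ p ∈ S, p.Prime ∧ p ≤ s) (hs : s * s ≤ N)
    (a : ℕ → ℝ) :
    ∑ n ∈ Finset.Ioc 0 N, (∑ p ∈ S, a p * centeredDvd p n) ^ 2 ≤
      2 * N * ∑ p ∈ S, a p ^ 2 / p := by
  have h1 : ∑ n ∈ Finset.Ioc 0 N, (∑ p ∈ S, a p * centeredDvd p n) ^ 2 =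
      ∑ p ∈ S, ∑ r ∈ S, a p * a r *
        ∑ n ∈ Finset.Ioc 0 N, centeredDvd p n * centeredDvd r n := by
    simp only [sq, Finset.sum_mul_sum]
    simp only [Finset.mul_sum]
    rw [Finset.sum_comm]
    refine Finset.sum_congr rfl fun p _ => ?_
    rw [Finset.sum_comm]
    exact Finset.sum_congr rfl fun r _ => Finset.sum_congr rfl fun n _ => by ring
  have h2 : ∀ p ∈ S, ∀ r ∈ S, a p * a r *
      ∑ n ∈ Finset.Ioc 0 N, centeredDvd p n * centeredDvd r n ≤
        |a p| * |a r| + if p = r then N * (a p ^ 2 / p) else 0 := by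
    intro p hp r hr
    refine (le_abs_self _).trans ?_
    rw [abs_mul, abs_mul]
    split_ifs with h
    · subst h
      have h3 := mul_le_mul_of_nonneg_left (sum_centeredDvd_mul_self_le (hS p hp).1 N)
        (by positivity : 0 ≤ |a p| * |a p|)
      have h4 : |a p| * |a p| * ((N : ℝ) / p) = N * (a p ^ 2 / p) := by
        rw [abs_mul_abs_self]; ring
      rw [h4] at h3
      have : 0 ≤ |a p| * |a p| := by positivity
      linarith
    · rw [add_zero]
      exact mul_le_of_le_one_right (by positivity)
        (sum_centeredDvd_mul_le (hS p hp).1 (hS r hr).1 h N)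
  have h3 : ∑ p ∈ S, (p : ℝ) ≤ N := by
    have h4 : S.card ≤ s := by
      have h5 : S ⊆ Finset.Ioc 0 s := fun p hp =>
        Finset.mem_Ioc.2 ⟨(hS p hp).1.pos, (hS p hp).2⟩
      simpa using Finset.card_le_card h5
    have h6 : ∑ p ∈ S, p ≤ N :=
      (Finset.sum_le_card_nsmul S (fun p => p) s fun p hp => (hS p hp).2).trans
        ((Nat.mul_le_mul_right s h4).trans hs)
    rw [← Nat.cast_sum]
    exact Nat.cast_le.2 h6
  have hD : 0 ≤ ∑ p ∈ S, a p ^ 2 / (p : ℝ) := Finset.sum_nonneg fun p _ => by positivity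
  have h4 : (∑ p ∈ S, |a p|) ^ 2 ≤ (∑ p ∈ S, a p ^ 2 / (p : ℝ)) * ∑ p ∈ S, (p : ℝ) := by
    refine Finset.sum_sq_le_sum_mul_sum_of_sq_le_mul S (fun p _ => by positivity)
      (fun p _ => by positivity) fun p hp => ?_
    have : (p : ℝ) ≠ 0 := by exact_mod_cast (hS p hp).1.ne_zero
    rw [sq_abs]
    field_simp
    exact le_rfl
  calc _ ≤ ∑ p ∈ S, ∑ r ∈ S, (|a p| * |a r| + if p = r then N * (a p ^ 2 / p) else 0) := by
        rw [h1]
        exact Finset.sum_le_sum fun p hp => Finset.sum_le_sum fun r hr => h2 p hp r hr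
    _ = (∑ p ∈ S, |a p|) ^ 2 + N * ∑ p ∈ S, a p ^ 2 / p := by
        simp only [Finset.sum_add_distrib, sq (∑ p ∈ S, |a p|), Finset.sum_mul_sum]
        rw [Finset.mul_sum]
        congr 1
        refine Finset.sum_congr rfl fun p hp => ?_
        rw [Finset.sum_ite_eq, if_pos hp]
    _ ≤ (∑ p ∈ S, a p ^ 2 / (p : ℝ)) * N + N * ∑ p ∈ S, a p ^ 2 / p := by
        gcongr
        exact h4.trans (by gcongr)
    _ = _ := by ring

theorem turan_kubilius_complex {S : Finset ℕ} {s N : ℕ} (hS : ∀ p ∈ S, p.Prime ∧ p ≤ s)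
    (hs : s * s ≤ N) (h : ℕ → ℂ) :
    ∑ n ∈ Finset.Ioc 0 N, ‖∑ p ∈ S, h p * (centeredDvd p n : ℂ)‖ ^ 2 ≤
      2 * N * ∑ p ∈ S, ‖h p‖ ^ 2 / p := by
  have h1 := turan_kubilius hS hs fun p => (h p).re
  have h2 := turan_kubilius hS hs fun p => (h p).im
  have h3 : ∀ z : ℂ, ‖z‖ ^ 2 = z.re ^ 2 + z.im ^ 2 := fun z => by
    rw [← Complex.normSq_eq_norm_sq, Complex.normSq_apply]; ring
  simp only [h3, Complex.re_sum, Complex.im_sum, Complex.re_mul_ofReal, Complex.im_mul_ofReal,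
    Finset.sum_add_distrib, add_div, mul_add]
  exact add_le_add h1 h2

/-- The sum of the reciprocals of the primes between `√N` and `N` is bounded, because an integer up
to `N` has at most one prime factor exceeding `√N`. -/
theorem sum_inv_large_primes_le {S : Finset ℕ} {s N : ℕ}
    (hS : ∀ p ∈ S, p.Prime ∧ s < p ∧ p ≤ N) (hs : N < (s + 1) * (s + 1)) :
    ∑ p ∈ S, (1 / (p : ℝ)) ≤ 2 := by
  rcases Nat.eq_zero_or_pos N with rfl | hN
  · rw [Finset.sum_eq_zero]
    · norm_num
    · intro p hp
      have := hS p hp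
      have := this.1.pos
      omega
  have hN' : (0 : ℝ) < N := by exact_mod_cast hN
  have h1 : ∑ p ∈ S, ((N / p : ℕ) : ℝ) ≤ N := by
    simp only [← sum_boole_dvd]
    rw [Finset.sum_comm]
    have h2 : ∀ n ∈ Finset.Ioc 0 N, ∑ p ∈ S, (if p ∣ n then (1 : ℝ) else 0) ≤ 1 := by
      intro n hn
      rw [Finset.sum_boole]
      have h3 : (S.filter (· ∣ n)).card ≤ 1 := by
        rw [Finset.card_le_one]
        intro p hp r hr
        by_contra hpr
        rw [Finset.mem_filter] at hp hr
        obtain ⟨hp1, hp2, hp3⟩ := hS p hp.1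
        obtain ⟨hr1, hr2, hr3⟩ := hS r hr.1
        have h4 := Nat.le_of_dvd (Finset.mem_Ioc.1 hn).1
          (((Nat.coprime_primes hp1 hr1).2 hpr).mul_dvd_of_dvd_of_dvd hp.2 hr.2)
        have h5 : (s + 1) * (s + 1) ≤ p * r := Nat.mul_le_mul hp2 hr2
        have := (Finset.mem_Ioc.1 hn).2
        omega
      exact_mod_cast h3
    refine (Finset.sum_le_sum h2).trans ?_
    simp
  have h2 : ∑ p ∈ S, (N : ℝ) * (1 / p) ≤ ∑ p ∈ S, 2 * ((N / p : ℕ) : ℝ) := by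
    refine Finset.sum_le_sum fun p hp => ?_
    obtain ⟨hp1, -, hp3⟩ := hS p hp
    have h3 := (natCast_div_bounds hp1.pos N).2
    have h4 : (1 : ℝ) ≤ ((N / p : ℕ) : ℝ) := by exact_mod_cast Nat.div_pos hp3 hp1.pos
    rw [mul_one_div]
    linarith
  rw [← Finset.mul_sum, ← Finset.mul_sum] at h2
  have h3 : (N : ℝ) * ∑ p ∈ S, (1 / (p : ℝ)) ≤ N * 2 := by linarith
  exact le_of_mul_le_mul_left h3 hN'

theorem norm_prod_sub_prod_le {ι : Type*} (s : Finset ι) {a b : ι → ℂ} (ha : ∀ i ∈ s, ‖a i‖ ≤ 1)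
    (hb : ∀ i ∈ s, ‖b i‖ ≤ 1) :
    ‖∏ i ∈ s, a i - ∏ i ∈ s, b i‖ ≤ ∑ i ∈ s, ‖a i - b i‖ := by
  classical
  induction s using Finset.induction_on with
  | empty => simp
  | insert i s hi ih =>
    rw [Finset.prod_insert hi, Finset.prod_insert hi, Finset.sum_insert hi]
    have hprod : ‖∏ i ∈ s, a i‖ ≤ 1 := by
      rw [norm_prod]
      exact Finset.prod_le_one (fun _ _ => norm_nonneg _)
        fun j hj => ha j (Finset.mem_insert_of_mem hj)
    exact (norm_mul_sub_mul_le hprod (hb i (Finset.mem_insert_self i s))).trans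
      (add_le_add le_rfl (ih (fun j hj => ha j (Finset.mem_insert_of_mem hj))
        fun j hj => hb j (Finset.mem_insert_of_mem hj)))

theorem norm_exp_le_one {z : ℂ} (hz : z.re ≤ 0) : ‖Complex.exp z‖ ≤ 1 := by
  rw [Complex.norm_exp]
  exact Real.exp_le_one_iff.2 hz

theorem norm_exp_sub_exp_le {z w : ℂ} (hz : z.re ≤ 0) (hw : w.re ≤ 0) :
    ‖Complex.exp z - Complex.exp w‖ ≤ ‖z - w‖ := by
  have h := (convex_halfSpace_re_le 0).norm_image_sub_le_of_norm_deriv_le (𝕜 := ℂ)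
    (f := Complex.exp) (C := 1) (x := w) (y := z)
    (fun x _ => Complex.differentiable_exp x)
    (fun x hx => by rw [Complex.deriv_exp]; exact norm_exp_le_one hx) hw hz
  simpa using h

theorem norm_one_add_sub_exp_le {h : ℂ} (h1 : ‖1 + h‖ ≤ 1) :
    ‖1 + h - Complex.exp h‖ ≤ 2 * ‖h‖ ^ 2 := by
  rcases le_or_gt ‖h‖ 1 with hh | hh
  · have h2 := Complex.norm_exp_sub_one_sub_id_le hh
    rw [norm_sub_rev, ← sub_sub]
    nlinarith [sq_nonneg ‖h‖]
  · have hre : h.re ≤ 0 := by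
      have := (Complex.re_le_norm (1 + h)).trans h1
      simp only [Complex.add_re, Complex.one_re] at this
      linarith
    have h2 : ‖1 + h - Complex.exp h‖ ≤ 1 + 1 :=
      (norm_sub_le _ _).trans (add_le_add h1 (norm_exp_le_one hre))
    nlinarith

/-! ### The contribution of the large primes -/

theorem sum_div_le_sqrt {S : Finset ℕ} {x y : ℕ → ℝ} (hy : ∀ p ∈ S, 0 < y p) :
    ∑ p ∈ S, x p / y p ≤ √((∑ p ∈ S, x p ^ 2 / y p) * ∑ p ∈ S, 1 / y p) := by
  refine Real.le_sqrt_of_sq_le ?_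
  refine Finset.sum_sq_le_sum_mul_sum_of_sq_le_mul S (fun p hp => ?_) (fun p hp => ?_)
    fun p hp => ?_
  · have := hy p hp; positivity
  · have := hy p hp; positivity
  · have := hy p hp
    field_simp
    exact le_rfl

theorem sum_le_of_sum_sq_le {N : ℕ} {g : ℕ → ℝ} {B : ℝ} (hB : 0 ≤ B)
    (h : ∑ n ∈ Finset.Ioc 0 N, g n ^ 2 ≤ N * B ^ 2) : ∑ n ∈ Finset.Ioc 0 N, g n ≤ N * B := by
  have h1 := sq_sum_le_card_mul_sum_sq (s := Finset.Ioc 0 N) (f := g)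
  simp only [Nat.card_Ioc, Nat.sub_zero] at h1
  refine abs_le_of_sq_le_sq' ?_ (by positivity) |>.2
  calc _ ≤ _ := h1
    _ ≤ N * (N * B ^ 2) := by gcongr
    _ = _ := by ring

theorem sum_sum_primeFactors_le {N y : ℕ} {g : ℕ → ℕ → ℝ} :
    ∑ n ∈ Finset.Ioc 0 N, ∑ p ∈ n.primeFactors.filter (y < ·), g p n =
      ∑ p ∈ (Finset.Ioc y N).filter Nat.Prime,
        ∑ n ∈ (Finset.Ioc 0 N).filter (p ∣ ·), g p n := by
  refine Finset.sum_comm' fun n p => ?_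
  simp only [Finset.mem_Ioc, Finset.mem_filter, Nat.mem_primeFactors]
  constructor
  · rintro ⟨⟨h1, h2⟩, ⟨h3, h4, h5⟩, h6⟩
    exact ⟨⟨⟨h1, h2⟩, h4⟩, ⟨h6, (Nat.le_of_dvd h1 h4).trans h2⟩, h3⟩
  · rintro ⟨⟨⟨h1, h2⟩, h4⟩, ⟨h6, -⟩, h3⟩
    exact ⟨⟨h1, h2⟩, ⟨h3, h4, h1.ne'⟩, h6⟩

theorem sum_primes_inv_sq_le {y : ℕ} (hy : 0 < y) (N : ℕ) :
    ∑ p ∈ (Finset.Ioc y N).filter Nat.Prime, (1 / (p : ℝ) ^ 2) ≤ 1 / (y : ℝ) := by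
  refine (Finset.sum_le_sum_of_subset_of_nonneg (Finset.filter_subset _ _)
    fun _ _ _ => by positivity).trans ?_
  rcases le_or_gt y N with h | h
  · have := sum_Ioc_inv_sq_le_sub (α := ℝ) hy.ne' h
    simp only [one_div]
    refine this.trans (sub_le_self _ (by positivity))
  · rw [Finset.Ioc_eq_empty_of_le h.le]
    simp

theorem norm_sub_one_sq_le {z : ℂ} (hz : ‖z‖ ≤ 1) : ‖z - 1‖ ^ 2 ≤ 2 * (1 - z.re) := by
  have h1 : ‖z‖ ^ 2 ≤ 1 := pow_le_one₀ (norm_nonneg _) hz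
  rw [← Complex.normSq_eq_norm_sq, Complex.normSq_apply] at h1 ⊢
  simp only [Complex.sub_re, Complex.sub_im, Complex.one_re, Complex.one_im]
  nlinarith

theorem re_le_one {z : ℂ} (hz : ‖z‖ ≤ 1) : z.re ≤ 1 := (Complex.re_le_norm z).trans hz

/-- If the primes `p > y` carry little of `∑ (1 - Re (c p 1)) / p`, then the part of a
multiplicative function composed of primes `p > y` is close on average to a constant of absolute
value near `1` (which may depend on the length of the range): it is close to the exponential of the
additive function `∑_{p ∣ n} (c p 1 - 1)`, which concentrates at its mean value. -/
theorem large_primes_near_constant {c : ℕ → ℕ → ℂ} (hc : ∀ p k, ‖c p k‖ ≤ 1) {y N : ℕ} {δ : ℝ}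
    (hy : 0 < y) (hyδ : 1 / (y : ℝ) ≤ δ)
    (hδ : 2 * ∑ p ∈ (Finset.Ioc y N).filter Nat.Prime, (1 - (c p 1).re) / p ≤ δ) :
    ∃ z : ℂ, ‖z‖ ≤ 1 ∧ 1 - ‖z‖ ^ 2 ≤ δ ∧ ∑ n ∈ Finset.Ioc 0 N,
      ‖∏ p ∈ n.primeFactors.filter (y < ·), c p (n.factorization p) - z‖ ≤
        (4 * δ + 2 * √(2 * δ)) * N := by
  -- Turán–Kubilius is applied to the primes up to `s = √N`; larger primes are sparse
  set s := Nat.sqrt N with hs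
  set S := (Finset.Ioc y N).filter Nat.Prime with hS
  set h : ℕ → ℂ := fun p => c p 1 - 1 with hh
  have hS' : ∀ p ∈ S, p.Prime ∧ y < p ∧ p ≤ N := fun p hp => by
    simp only [hS, Finset.mem_filter, Finset.mem_Ioc] at hp
    tauto
  have hpos : ∀ p ∈ S, (0 : ℝ) < p := fun p hp => by exact_mod_cast (hS' p hp).1.pos
  have hre : ∀ p, (h p).re ≤ 0 := fun p => by
    simpa [hh] using re_le_one (hc p 1)
  have h1h : ∀ p, 1 + h p = c p 1 := fun p => by simp [hh]
  have hD : ∑ p ∈ S, ‖h p‖ ^ 2 / (p : ℝ) ≤ δ := by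
    refine le_trans ?_ hδ
    rw [Finset.mul_sum]
    refine Finset.sum_le_sum fun p hp => ?_
    rw [← mul_div_assoc]
    have := hpos p hp
    gcongr
    exact norm_sub_one_sq_le (hc p 1)
  have hδ0 : 0 ≤ δ := le_trans (by positivity) hyδ
  set S₁ := S.filter (· ≤ s) with hS₁
  set S₂ := S.filter (¬ · ≤ s) with hS₂
  have hD₁ : ∑ p ∈ S₁, ‖h p‖ ^ 2 / (p : ℝ) ≤ δ :=
    (Finset.sum_le_sum_of_subset_of_nonneg (Finset.filter_subset _ _)
      fun _ _ _ => by positivity).trans hD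
  have hD₂ : ∑ p ∈ S₂, ‖h p‖ ^ 2 / (p : ℝ) ≤ δ :=
    (Finset.sum_le_sum_of_subset_of_nonneg (Finset.filter_subset _ _)
      fun _ _ _ => by positivity).trans hD
  set A : ℂ := ∑ p ∈ S₁, h p / p with hA
  have hAre : A.re ≤ 0 := by
    rw [hA, Complex.re_sum]
    refine Finset.sum_nonpos fun p _ => ?_
    rw [Complex.div_natCast_re]
    exact div_nonpos_of_nonpos_of_nonneg (hre p) (Nat.cast_nonneg p)
  refine ⟨Complex.exp A, norm_exp_le_one hAre, ?_, ?_⟩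
  · have h2 : -(2 * A.re) ≤ δ := by
      refine le_trans ?_ hδ
      rw [hA, Complex.re_sum, Finset.mul_sum, Finset.mul_sum, ← Finset.sum_neg_distrib]
      refine le_trans (le_of_eq ?_) (Finset.sum_le_sum_of_subset_of_nonneg
        (Finset.filter_subset (· ≤ s) S) fun p _ _ => ?_)
      · refine Finset.sum_congr rfl fun p _ => ?_
        rw [Complex.div_natCast_re, hh]
        simp only [Complex.sub_re, Complex.one_re]
        ring
      · have := re_le_one (hc p 1)
        have h3 : 0 ≤ 1 - (c p 1).re := by linarith
        positivity
    rw [Complex.norm_exp, ← Real.exp_nat_mul]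
    have := Real.add_one_le_exp (((2 : ℕ) : ℝ) * A.re)
    push_cast at this ⊢
    linarith
  set E : ℕ → ℝ := fun p => if p ≤ s then 2 * ‖h p‖ ^ 2 else ‖h p‖ with hE
  have hE0 : ∀ p, 0 ≤ E p := fun p => by
    simp only [hE]
    split_ifs <;> positivity
  set b : ℕ → ℂ := fun p => if p ≤ s then Complex.exp (h p) else 1 with hb
  have hb1 : ∀ p, ‖b p‖ ≤ 1 := fun p => by
    simp only [hb]
    split_ifs
    · exact norm_exp_le_one (hre p)
    · simp
  -- the factor at each prime `p ∣ n`, compared with `b p`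
  have hfac : ∀ n ∈ Finset.Ioc 0 N, ∀ p ∈ n.primeFactors.filter (y < ·),
      ‖c p (n.factorization p) - b p‖ ≤ 2 * (if p ^ 2 ∣ n then 1 else 0) + E p := by
    intro n hn p hp
    simp only [Finset.mem_filter, Nat.mem_primeFactors] at hp
    obtain ⟨⟨hpp, hpn, hn0⟩, hyp⟩ := hp
    split_ifs with h2
    · have := (norm_sub_le (c p (n.factorization p)) (b p)).trans (add_le_add (hc _ _) (hb1 p))
      have := hE0 p
      linarith
    · have h3 : n.factorization p = 1 := by
        have h4 := (hpp.dvd_iff_one_le_factorization hn0).1 hpn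
        have h5 : ¬ 2 ≤ n.factorization p := fun h => h2
          ((hpp.pow_dvd_iff_le_factorization hn0).2 h)
        omega
      rw [h3, mul_zero, zero_add]
      simp only [hb, hE]
      split_ifs
      · rw [← h1h]
        exact norm_one_add_sub_exp_le (by rw [h1h]; exact hc p 1)
      · exact le_rfl
  have hprodb : ∀ n ∈ Finset.Ioc 0 N, ∏ p ∈ n.primeFactors.filter (y < ·), b p =
      Complex.exp (∑ p ∈ S₁, if p ∣ n then h p else 0) := by
    intro n hn
    rw [← Finset.sum_filter, Complex.exp_sum, hb, ← Finset.prod_filter]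
    refine Finset.prod_congr ?_ fun _ _ => rfl
    ext p
    simp only [hS₁, hS, Finset.mem_filter, Nat.mem_primeFactors, Finset.mem_Ioc]
    have hn' := Finset.mem_Ioc.1 hn
    constructor
    · rintro ⟨⟨⟨h1, h2, h3⟩, h4⟩, h5⟩
      exact ⟨⟨⟨⟨h4, (Nat.le_of_dvd hn'.1 h2).trans hn'.2⟩, h1⟩, h5⟩, h2⟩
    · rintro ⟨⟨⟨⟨h4, -⟩, h1⟩, h5⟩, h2⟩
      exact ⟨⟨⟨h1, h2, hn'.1.ne'⟩, h4⟩, h5⟩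
  -- replacing the factors by `b p` and then the additive function by its mean value `A`
  have hmain : ∀ n ∈ Finset.Ioc 0 N,
      ‖∏ p ∈ n.primeFactors.filter (y < ·), c p (n.factorization p) - Complex.exp A‖ ≤
        ∑ p ∈ n.primeFactors.filter (y < ·), (2 * (if p ^ 2 ∣ n then 1 else 0) + E p) +
          ‖∑ p ∈ S₁, h p * (centeredDvd p n : ℂ)‖ := by
    intro n hn
    have h2 := (norm_prod_sub_prod_le (n.primeFactors.filter (y < ·))
      (a := fun p => c p (n.factorization p)) (b := b) (fun p _ => hc _ _)
      fun p _ => hb1 p).trans (Finset.sum_le_sum fun p hp => hfac n hn p hp)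
    have h3 : ‖∏ p ∈ n.primeFactors.filter (y < ·), b p - Complex.exp A‖ ≤
        ‖∑ p ∈ S₁, h p * (centeredDvd p n : ℂ)‖ := by
      rw [hprodb n hn]
      refine (norm_exp_sub_exp_le ?_ hAre).trans (le_of_eq ?_)
      · rw [Complex.re_sum]
        refine Finset.sum_nonpos fun p _ => ?_
        split_ifs
        · exact hre p
        · exact le_rfl
      · rw [hA, ← Finset.sum_sub_distrib]
        congr 1
        refine Finset.sum_congr rfl fun p _ => ?_
        rw [centeredDvd]
        split_ifs <;> push_cast <;> ring
    exact (norm_sub_le_norm_sub_add_norm_sub _ _ _).trans (add_le_add h2 h3)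
  have hTK : ∑ n ∈ Finset.Ioc 0 N, ‖∑ p ∈ S₁, h p * (centeredDvd p n : ℂ)‖ ≤ N * √(2 * δ) := by
    refine sum_le_of_sum_sq_le (Real.sqrt_nonneg _) ?_
    rw [Real.sq_sqrt (by positivity)]
    refine (turan_kubilius_complex (s := s) (fun p hp => ?_) (Nat.sqrt_le N) h).trans ?_
    · rw [hS₁, Finset.mem_filter] at hp
      exact ⟨(hS' p hp.1).1, hp.2⟩
    · calc 2 * (N : ℝ) * ∑ p ∈ S₁, ‖h p‖ ^ 2 / (p : ℝ) ≤ 2 * N * δ := by gcongr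
        _ = N * (2 * δ) := by ring
  have hES : ∑ p ∈ S, E p / (p : ℝ) ≤ 2 * δ + √(2 * δ) := by
    rw [← Finset.sum_filter_add_sum_filter_not S (· ≤ s)]
    refine add_le_add ?_ ?_
    · calc ∑ p ∈ S₁, E p / (p : ℝ) = ∑ p ∈ S₁, 2 * (‖h p‖ ^ 2 / (p : ℝ)) := by
            refine Finset.sum_congr rfl fun p hp => ?_
            rw [hS₁, Finset.mem_filter] at hp
            simp only [hE, if_pos hp.2]
            ring
        _ ≤ 2 * δ := by rw [← Finset.mul_sum]; gcongr
    · calc ∑ p ∈ S₂, E p / (p : ℝ) = ∑ p ∈ S₂, ‖h p‖ / (p : ℝ) := by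
            refine Finset.sum_congr rfl fun p hp => ?_
            rw [hS₂, Finset.mem_filter] at hp
            simp only [hE, if_neg hp.2]
        _ ≤ √((∑ p ∈ S₂, ‖h p‖ ^ 2 / (p : ℝ)) * ∑ p ∈ S₂, 1 / (p : ℝ)) :=
            sum_div_le_sqrt (y := fun p => (p : ℝ))
              fun p hp => hpos p (Finset.mem_filter.1 hp).1
        _ ≤ √(2 * δ) := by
            refine Real.sqrt_le_sqrt ?_
            rw [mul_comm 2 δ]
            refine mul_le_mul hD₂ (sum_inv_large_primes_le (s := s) (N := N) (fun p hp => ?_)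
              (Nat.lt_succ_sqrt N)) (Finset.sum_nonneg fun p _ => by positivity) hδ0
            rw [hS₂, Finset.mem_filter] at hp
            exact ⟨(hS' p hp.1).1, not_le.1 hp.2, (hS' p hp.1).2.2⟩
  have hdouble : ∑ n ∈ Finset.Ioc 0 N, ∑ p ∈ n.primeFactors.filter (y < ·),
      (2 * (if p ^ 2 ∣ n then (1 : ℝ) else 0) + E p) ≤ (4 * δ + √(2 * δ)) * N := by
    rw [sum_sum_primeFactors_le]
    calc _ ≤ ∑ p ∈ S, (N : ℝ) * (2 * (1 / (p : ℝ) ^ 2) + E p / p) := by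
          refine Finset.sum_le_sum fun p hp => ?_
          rw [Finset.sum_add_distrib, ← Finset.mul_sum]
          have hp0 := (hS' p hp).1.pos
          have h2 : ∑ n ∈ (Finset.Ioc 0 N).filter (p ∣ ·), (if p ^ 2 ∣ n then (1 : ℝ) else 0) ≤
              N * (1 / (p : ℝ) ^ 2) := by
            refine (Finset.sum_le_sum_of_subset_of_nonneg (Finset.filter_subset _ _)
              fun _ _ _ => by positivity).trans ?_
            rw [sum_boole_dvd, mul_one_div]
            simpa using (natCast_div_bounds (pow_pos hp0 2) N).1
          have h3 : ∑ n ∈ (Finset.Ioc 0 N).filter (p ∣ ·), E p ≤ N * (E p / p) := by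
            rw [Finset.sum_const, Nat.Ioc_filter_dvd_card_eq_div, nsmul_eq_mul]
            calc ((N / p : ℕ) : ℝ) * E p ≤ (N / p) * E p := by
                  have := hE0 p
                  gcongr
                  exact (natCast_div_bounds hp0 N).1
              _ = _ := by ring
          linarith
      _ = N * (2 * (∑ p ∈ S, 1 / (p : ℝ) ^ 2) + ∑ p ∈ S, E p / p) := by
          rw [← Finset.mul_sum, Finset.sum_add_distrib, ← Finset.mul_sum]
      _ ≤ N * (2 * δ + (2 * δ + √(2 * δ))) := by
          have := (sum_primes_inv_sq_le hy N).trans hyδ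
          gcongr
      _ = _ := by ring
  calc _ ≤ _ := Finset.sum_le_sum hmain
    _ ≤ (4 * δ + √(2 * δ)) * N + N * √(2 * δ) := by
        rw [Finset.sum_add_distrib]
        exact add_le_add hdouble hTK
    _ = _ := by ring

/-! ### Components of a primitive character -/

theorem exists_idempotent {a b : ℕ} (hab : a.Coprime b) :
    ∃ e : ℤ, (a : ℤ) ∣ e - 1 ∧ (b : ℤ) ∣ e := by
  obtain ⟨x, y, h⟩ := Nat.isCoprime_iff_coprime.2 hab
  exact ⟨y * b, ⟨-x, by linear_combination h⟩, dvd_mul_left _ _⟩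

/-- If `e` is `1` modulo `a` and `0` modulo `b`, then `n ↦ 1 + (n - 1) e` is the homomorphism from
`ZMod a` to `ZMod (a * b)` given by the Chinese remainder theorem and `1` in the second component;
composing with it yields the component modulo `a` of a character modulo `a * b`. -/
theorem exists_component {q a b : ℕ} [NeZero a] (hq : q = a * b) {e : ℤ} (hea : (a : ℤ) ∣ e - 1)
    (heb : (b : ℤ) ∣ e) (χ : DirichletCharacter ℂ q) : ∃ ψ : DirichletCharacter ℂ a,
      ∀ n : ℤ, IsUnit (n : ZMod a) → ψ n = χ ((1 + (n - 1) * e : ℤ) : ZMod q) := by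
  have hae : ((a : ℤ) : ZMod q) * e = 0 := by
    rw [← Int.cast_mul, ZMod.intCast_zmod_eq_zero_iff_dvd, hq]
    push_cast
    exact mul_dvd_mul_left _ heb
  have hee : (e : ZMod q) * e = e := by
    rw [← sub_eq_zero, ← Int.cast_mul, ← Int.cast_sub, ZMod.intCast_zmod_eq_zero_iff_dvd, hq]
    push_cast
    rw [show e * e - e = (e - 1) * e by ring]
    exact mul_dvd_mul hea heb
  have hval : ∀ n : ℤ, (1 + (((n : ZMod a).val : ZMod q) - 1) * e : ZMod q) =
      1 + ((n : ZMod q) - 1) * e := by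
    intro n
    have h : (a : ℤ) ∣ ((n : ZMod a).val : ℤ) - n := by
      rw [← ZMod.intCast_zmod_eq_zero_iff_dvd]
      simp
    obtain ⟨k, hk⟩ := h
    have hk' := congrArg (Int.cast : ℤ → ZMod q) hk
    push_cast at hk'
    push_cast at hae
    linear_combination (e : ZMod q) * hk' + k * hae
  let φ : ZMod a →* ZMod q :=
    { toFun := fun x => 1 + ((x.val : ZMod q) - 1) * e
      map_one' := by
        have := hval 1
        push_cast at this
        rw [this]
        ring
      map_mul' := by
        intro x y
        obtain ⟨m, rfl⟩ := ZMod.intCast_surjective x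
        obtain ⟨n, rfl⟩ := ZMod.intCast_surjective y
        rw [← Int.cast_mul, hval, hval, hval]
        push_cast
        linear_combination (-((m : ZMod q) - 1) * (n - 1)) * hee }
  refine ⟨MulChar.ofUnitHom (χ.toUnitHom.comp (Units.map φ)), fun n hn => ?_⟩
  obtain ⟨g, hg⟩ := hn
  have hφ : φ n = ((1 + (n - 1) * e : ℤ) : ZMod q) := by
    change (1 + (((n : ZMod a).val : ZMod q) - 1) * e : ZMod q) = _
    rw [hval]
    push_cast
    rfl
  rw [← hg, MulChar.ofUnitHom_coe, MonoidHom.comp_apply, MulChar.coe_toUnitHom, Units.coe_map,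
    hg, ← hφ]

theorem exists_unit_of_isPrimitive {q : ℕ} [NeZero q] {χ : DirichletCharacter ℂ q}
    (hχ : χ.IsPrimitive) {p : ℕ} (hp : p.Prime) (hpq : p ∣ q) :
    ∃ i : ℤ, ((q / p : ℕ) : ℤ) ∣ i - 1 ∧ IsUnit (i : ZMod q) ∧ χ i ≠ 1 := by
  have hd : q / p ∣ q := Nat.div_dvd_of_dvd hpq
  have h1 : ¬ χ.FactorsThrough (q / p) := by
    intro h
    have h2 : χ.conductor ≤ q / p := Nat.sInf_le h
    rw [show χ.conductor = q from hχ] at h2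
    exact absurd (Nat.div_lt_self (NeZero.pos q) hp.one_lt) (not_lt.2 h2)
  rw [DirichletCharacter.factorsThrough_iff_ker_unitsMap hd] at h1
  obtain ⟨g, hg1, hg2⟩ := SetLike.not_le_iff_exists.1 h1
  refine ⟨((g : ZMod q).val : ℤ), ?_, by simp, ?_⟩
  · rw [MonoidHom.mem_ker] at hg1
    have h3 := congrArg Units.val hg1
    rw [ZMod.unitsMap_def, Units.coe_map, Units.val_one] at h3
    rw [← ZMod.intCast_zmod_eq_zero_iff_dvd]
    have h4 : ((g : ZMod q).val : ZMod (q / p)) = 1 := by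
      rw [← h3, ZMod.natCast_val]
      rfl
    push_cast
    rw [h4, sub_self]
  · intro h
    apply hg2
    rw [MonoidHom.mem_ker]
    ext
    rw [MulChar.coe_toUnitHom]
    simpa using h

theorem eq_of_forall_prime_pow {q : ℕ} (hq : q ≠ 0) {x y : ℤ}
    (h : ∀ p ∈ q.primeFactors, (x : ZMod (p ^ q.factorization p)) = y) :
    (x : ZMod q) = y := by
  rw [← sub_eq_zero, ← Int.cast_sub, ZMod.intCast_zmod_eq_zero_iff_dvd]
  have h1 : (q : ℤ) = ∏ p ∈ q.primeFactors, ((p ^ q.factorization p : ℕ) : ℤ) := by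
    rw [← Nat.cast_prod]
    exact congrArg _ (Nat.prod_factorization_pow_eq_self hq).symm
  rw [h1]
  refine Finset.prod_dvd_of_coprime (fun p hp r hr hpr => ?_) fun p hp => ?_
  · exact Nat.isCoprime_iff_coprime.2 (Nat.Coprime.pow _ _ ((Nat.coprime_primes
      (Nat.prime_of_mem_primeFactors hp) (Nat.prime_of_mem_primeFactors hr)).2 hpr))
  · rw [← ZMod.intCast_zmod_eq_zero_iff_dvd, Int.cast_sub, h p hp, sub_self]

/-- A primitive character modulo `q` is the product of characters modulo the prime powers exactly
dividing `q`, and the component modulo `p ^ l` is not trivial on the residues which are `1` modulo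
`p ^ (l - 1)`. -/
theorem exists_components {q : ℕ} (hq : 0 < q) (χ : DirichletCharacter ℂ q)
    (hχ : χ.IsPrimitive) : ∃ ψ : ∀ p : ℕ, DirichletCharacter ℂ (p ^ q.factorization p),
      (∀ n : ℕ, n.Coprime q → χ n = ∏ p ∈ q.primeFactors, ψ p n) ∧
      ∀ p ∈ q.primeFactors, ∃ b : ZMod (p ^ q.factorization p),
        IsUnit (1 + (p : ZMod (p ^ q.factorization p)) ^ (q.factorization p - 1) * b) ∧
        ψ p (1 + (p : ZMod (p ^ q.factorization p)) ^ (q.factorization p - 1) * b) ≠ 1 := by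
  have : NeZero q := ⟨hq.ne'⟩
  have hsplit : ∀ p, q = p ^ q.factorization p * (q / p ^ q.factorization p) := fun p =>
    (Nat.ordProj_mul_ordCompl_eq_self q p).symm
  have hex : ∀ p : ℕ, ∃ e : ℤ, p ∈ q.primeFactors →
      ((p ^ q.factorization p : ℕ) : ℤ) ∣ e - 1 ∧
        ((q / p ^ q.factorization p : ℕ) : ℤ) ∣ e := by
    intro p
    by_cases hp : p ∈ q.primeFactors
    · obtain ⟨e, he⟩ := exists_idempotent (a := p ^ q.factorization p)
        (b := q / p ^ q.factorization p)
        ((Nat.coprime_ordCompl (Nat.prime_of_mem_primeFactors hp) hq.ne').pow_left _)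
      exact ⟨e, fun _ => he⟩
    · exact ⟨0, fun h => absurd h hp⟩
  choose e he using hex
  have hψ : ∀ p : ℕ, ∃ ψ : DirichletCharacter ℂ (p ^ q.factorization p), p ∈ q.primeFactors →
      ∀ n : ℤ, IsUnit (n : ZMod (p ^ q.factorization p)) →
        ψ n = χ ((1 + (n - 1) * e p : ℤ) : ZMod q) := by
    intro p
    by_cases hp : p ∈ q.primeFactors
    · have : NeZero (p ^ q.factorization p) :=
        ⟨(pow_pos (Nat.prime_of_mem_primeFactors hp).pos _).ne'⟩
      obtain ⟨ψ, hψ⟩ := exists_component (hsplit p) (he p hp).1 (he p hp).2 χ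
      exact ⟨ψ, fun _ => hψ⟩
    · exact ⟨1, fun h => absurd h hp⟩
  choose ψ hψ using hψ
  refine ⟨ψ, fun n hn => ?_, fun p hp => ?_⟩
  · have h1 : ∀ p ∈ q.primeFactors, ψ p n = χ ((1 + (n - 1) * e p : ℤ) : ZMod q) := by
      intro p hp
      have h2 : IsUnit ((n : ℤ) : ZMod (p ^ q.factorization p)) := by
        rw [Int.cast_natCast, ZMod.isUnit_iff_coprime]
        exact hn.coprime_dvd_right (Nat.ordProj_dvd q p)
      have := hψ p hp n h2
      rwa [Int.cast_natCast] at this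
    rw [Finset.prod_congr rfl h1, ← map_prod]
    congr 1
    rw [← Int.cast_prod, ← Int.cast_natCast (R := ZMod q)]
    refine eq_of_forall_prime_pow hq.ne' fun r hr => ?_
    rw [Int.cast_prod, Finset.prod_eq_single r]
    · have h3 : ((e r : ℤ) : ZMod (r ^ q.factorization r)) = 1 := by
        rw [← sub_eq_zero, ← Int.cast_one, ← Int.cast_sub, ZMod.intCast_zmod_eq_zero_iff_dvd]
        exact (he r hr).1
      push_cast
      rw [h3]
      ring
    · intro p hp hpr
      have h3 : ((e p : ℤ) : ZMod (r ^ q.factorization r)) = 0 := by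
        rw [ZMod.intCast_zmod_eq_zero_iff_dvd]
        refine dvd_trans ?_ (he p hp).2
        rw [Int.natCast_dvd_natCast]
        have h4 : r ^ q.factorization r ∣ p ^ q.factorization p * (q / p ^ q.factorization p) := by
          rw [← hsplit]
          exact Nat.ordProj_dvd q r
        refine Nat.Coprime.dvd_of_dvd_mul_left ?_ h4
        exact Nat.Coprime.pow _ _ ((Nat.coprime_primes (Nat.prime_of_mem_primeFactors hr)
          (Nat.prime_of_mem_primeFactors hp)).2 hpr.symm)
      push_cast
      rw [h3]
      ring
    · exact fun h => absurd hr h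
  · have hpp := Nat.prime_of_mem_primeFactors hp
    have hpq := Nat.dvd_of_mem_primeFactors hp
    obtain ⟨i, hi1, hi2, hi3⟩ := exists_unit_of_isPrimitive hχ hpp hpq
    have hl : 1 ≤ q.factorization p := (hpp.dvd_iff_one_le_factorization hq.ne').1 hpq
    set l := q.factorization p with hl'
    have hqp : q / p = p ^ (l - 1) * (q / p ^ l) := by
      refine Nat.div_eq_of_eq_mul_right hpp.pos ?_
      rw [← mul_assoc, ← pow_succ', Nat.sub_add_cancel hl]
      exact hsplit p
    obtain ⟨z, hz⟩ := hi1
    rw [hqp] at hz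
    have h1 : (1 + (p : ZMod (p ^ l)) ^ (l - 1) * (((q / p ^ l : ℕ) : ZMod (p ^ l)) * z)) = i := by
      have := congrArg (Int.cast : ℤ → ZMod (p ^ l)) hz
      simp only [Int.cast_sub, Int.cast_one, Int.cast_mul, Int.cast_natCast, Nat.cast_mul,
        Nat.cast_pow, Int.cast_pow] at this
      linear_combination -this
    have hu : IsUnit (i : ZMod (p ^ l)) := by
      have h2 := hi2.map (ZMod.castHom (Nat.ordProj_dvd q p) (ZMod (p ^ l)))
      rwa [map_intCast] at h2
    refine ⟨((q / p ^ l : ℕ) : ZMod (p ^ l)) * z, by rwa [h1], ?_⟩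
    rw [h1, hψ p hp i hu]
    have h2 : ((1 + (i - 1) * e p : ℤ) : ZMod q) = i := by
      rw [← sub_eq_zero, ← Int.cast_sub, ZMod.intCast_zmod_eq_zero_iff_dvd,
        show 1 + (i - 1) * e p - i = (e p - 1) * (i - 1) by ring]
      have h3 : (q : ℤ) = ((p ^ l : ℕ) : ℤ) * ((q / p ^ l : ℕ) : ℤ) := by
        exact_mod_cast hsplit p
      rw [h3]
      refine mul_dvd_mul (he p hp).1 ⟨((p ^ (l - 1) : ℕ) : ℤ) * z, ?_⟩
      rw [hz]
      push_cast
      ring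
    rwa [h2]

/-! ### Factorization into local functions and evaluation of the local means -/

/-- The coefficient at `r ^ a` in the factorization of `f n * n ^ (- i t)` into local functions:
besides `f (r ^ a) * r ^ (- i a t)` it contains the conjugates of the values at `r ^ a` of the
components of the character at the primes other than `r`, so that the component at `p` is only
evaluated at `n / p ^ v_p(n)`. -/
noncomputable def localCoeff (f : ℕ → ℂ) (t : ℝ) {q : ℕ}
    (ψ : ∀ p : ℕ, DirichletCharacter ℂ (p ^ q.factorization p)) (r a : ℕ) : ℂ :=
  f (r ^ a) * (r : ℂ) ^ (-((a : ℂ) * (t : ℂ) * Complex.I)) *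
    ∏ p ∈ q.primeFactors.erase r, conj (ψ p ((r ^ a : ℕ) : ZMod (p ^ q.factorization p)))

section Coeff

variable {f : ℕ → ℂ} {t : ℝ} {q : ℕ} {ψ : ∀ p : ℕ, DirichletCharacter ℂ (p ^ q.factorization p)}

theorem norm_natCast_cpow_I {r : ℕ} (hr : 0 < r) (a : ℂ) (ha : a.im = 0) (t : ℝ) :
    ‖(r : ℂ) ^ (-(a * (t : ℂ) * Complex.I))‖ = 1 := by
  rw [Complex.norm_natCast_cpow_of_pos hr]
  simp [ha]

theorem norm_localCoeff_le (hf : ∀ n, ‖f n‖ ≤ 1) (r a : ℕ) : ‖localCoeff f t ψ r a‖ ≤ 1 := by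
  rw [localCoeff]
  refine norm_mul_le_one (norm_mul_le_one (hf _) ?_) ?_
  · rcases Nat.eq_zero_or_pos r with rfl | hr
    · by_cases h : -((a : ℂ) * (t : ℂ) * Complex.I) = 0
      · rw [h]; simp
      · rw [Nat.cast_zero, Complex.zero_cpow h]; simp
    · exact (norm_natCast_cpow_I hr _ (by simp) t).le
  · rw [norm_prod]
    refine Finset.prod_le_one (fun _ _ => norm_nonneg _) fun p _ => ?_
    exact norm_conj_le_one ((ψ p).norm_le_one _)

theorem isUnit_prime_pow {r p : ℕ} (hr : r.Prime) (hp : p.Prime) (h : p ≠ r) (a l : ℕ) :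
    IsUnit ((r ^ a : ℕ) : ZMod (p ^ l)) := by
  rw [ZMod.isUnit_iff_coprime]
  exact Nat.Coprime.pow _ _ ((Nat.coprime_primes hr hp).2 h.symm)

theorem norm_localCoeff {r : ℕ} (hr : r.Prime) (a : ℕ) :
    ‖localCoeff f t ψ r a‖ = ‖f (r ^ a)‖ := by
  have h : ∀ p ∈ q.primeFactors.erase r,
      ‖conj (ψ p ((r ^ a : ℕ) : ZMod (p ^ q.factorization p)))‖ = 1 := by
    intro p hp
    obtain ⟨hp1, hp2⟩ := Finset.mem_erase.1 hp
    obtain ⟨g, hg⟩ := isUnit_prime_pow hr (Nat.prime_of_mem_primeFactors hp2) hp1 a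
      (q.factorization p)
    rw [RCLike.norm_conj, ← hg, (ψ p).unit_norm_eq_one]
  rw [localCoeff, norm_mul, norm_mul, norm_natCast_cpow_I hr.pos _ (by simp), norm_prod,
    Finset.prod_congr rfl h, Finset.prod_const_one, mul_one, mul_one]

theorem localCoeff_zero (hf1 : f 1 = 1) (r : ℕ) : localCoeff f t ψ r 0 = 1 := by
  simp [localCoeff, hf1]

theorem localCoeff_eq {χ : DirichletCharacter ℂ q}
    (hψ : ∀ n : ℕ, n.Coprime q → χ n = ∏ p ∈ q.primeFactors, ψ p n) {r : ℕ} (hr : r.Prime)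
    (hrq : ¬ r ∣ q) (a : ℕ) : localCoeff f t ψ r a =
      f (r ^ a) * conj (χ ((r ^ a : ℕ) : ZMod q)) *
        (r : ℂ) ^ (-((a : ℂ) * (t : ℂ) * Complex.I)) := by
  rw [localCoeff, Finset.erase_eq_of_notMem fun h => hrq (Nat.dvd_of_mem_primeFactors h),
    ← map_prod, ← hψ _ (((hr.coprime_iff_not_dvd).2 hrq).pow_left a)]
  ring

theorem ofPrimePowers_prime_pow {g : ℕ → ℕ → ℂ} {p : ℕ} (hp : p.Prime) (hg : g p 0 = 1) (a : ℕ) :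
    ofPrimePowers g (p ^ a) = g p a := by
  rw [ofPrimePowers, hp.factorization_pow, Finsupp.prod_single_index hg]

theorem twist_prime_pow (hf1 : f 1 = 1) {χ : DirichletCharacter ℂ q}
    (hψ : ∀ n : ℕ, n.Coprime q → χ n = ∏ p ∈ q.primeFactors, ψ p n) {p : ℕ} (hp : p.Prime)
    (hpq : ¬ p ∣ q) (a : ℕ) : twist f χ t (p ^ a) = localCoeff f t ψ p a := by
  rw [twist, ofPrimePowers_prime_pow hp (by simp [hpq, hf1]), if_neg hpq, localCoeff_eq hψ hp hpq]

theorem natCast_cpow_eq_prod {n : ℕ} (hn : n ≠ 0) (t : ℝ) :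
    (n : ℂ) ^ (-((t : ℂ) * Complex.I)) = ∏ r ∈ n.primeFactors,
      (r : ℂ) ^ (-(((n.factorization r : ℕ) : ℂ) * (t : ℂ) * Complex.I)) := by
  let φ : ℕ →* ℂ :=
    { toFun := fun n => (n : ℂ) ^ (-((t : ℂ) * Complex.I))
      map_one' := by simp
      map_mul' := fun m n => by
        push_cast
        exact Complex.natCast_mul_natCast_cpow m n _ }
  have h := congrArg φ (Nat.prod_factorization_pow_eq_self hn)
  rw [Finsupp.prod, map_prod, Nat.support_factorization] at h
  refine h.symm.trans (Finset.prod_congr rfl fun r _ => ?_)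
  rw [map_pow]
  change ((r : ℂ) ^ (-((t : ℂ) * Complex.I))) ^ _ = _
  rw [← Complex.cpow_nat_mul]
  congr 1
  ring

theorem div_pow_factorization_eq_prod {n p : ℕ} (hn : n ≠ 0) (hp : p.Prime) :
    n / p ^ n.factorization p = ∏ r ∈ n.primeFactors.erase p, r ^ n.factorization r := by
  have h : ∏ r ∈ n.primeFactors, r ^ n.factorization r = n :=
    Nat.prod_factorization_pow_eq_self hn
  refine Nat.div_eq_of_eq_mul_right (pow_pos hp.pos _) ?_
  by_cases hpn : p ∈ n.primeFactors
  · rw [Finset.mul_prod_erase _ (fun r => r ^ n.factorization r) hpn, h]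
  · have h0 : n.factorization p = 0 := by
      rwa [← Nat.support_factorization, Finsupp.notMem_support_iff] at hpn
    rw [Finset.erase_eq_of_notMem hpn, h, h0, pow_zero, one_mul]

/-- The factorization of `f n * n ^ (- i t)` into functions depending on `n` as a `p`-adic
integer. -/
theorem mul_cpow_eq_prod {f : ArithmeticFunction ℂ} (hf : f.IsMultiplicative) {n : ℕ}
    (hn : n ≠ 0) : f n * (n : ℂ) ^ (-((t : ℂ) * Complex.I)) =
      (∏ r ∈ n.primeFactors, localCoeff f t ψ r (n.factorization r)) *
        ∏ p ∈ q.primeFactors, ψ p ((n / p ^ n.factorization p : ℕ) : ZMod _) := by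
  have h1 : ∏ p ∈ q.primeFactors, ψ p ((n / p ^ n.factorization p : ℕ) : ZMod _) =
      ∏ r ∈ n.primeFactors, ∏ p ∈ q.primeFactors.erase r,
        ψ p ((r ^ n.factorization r : ℕ) : ZMod (p ^ q.factorization p)) := by
    rw [← Finset.prod_comm' (s := q.primeFactors) (t := fun p => n.primeFactors.erase p)]
    · refine Finset.prod_congr rfl fun p hp => ?_
      rw [div_pow_factorization_eq_prod hn (Nat.prime_of_mem_primeFactors hp), Nat.cast_prod,
        map_prod]
    · intro p r
      simp only [Finset.mem_erase]
      tauto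
  have h2 : f n = ∏ r ∈ n.primeFactors, f (r ^ n.factorization r) :=
    hf.multiplicative_factorization f hn
  rw [h1, h2, natCast_cpow_eq_prod hn, ← Finset.prod_mul_distrib, ← Finset.prod_mul_distrib]
  refine Finset.prod_congr rfl fun r hr => ?_
  rw [localCoeff, mul_assoc _ (∏ p ∈ q.primeFactors.erase r, _), ← Finset.prod_mul_distrib]
  rw [Finset.prod_eq_one, mul_one]
  intro p hp
  obtain ⟨hp1, hp2⟩ := Finset.mem_erase.1 hp
  rw [mul_comm]
  exact char_mul_conj_of_isUnit (ψ p) (isUnit_prime_pow (Nat.prime_of_mem_primeFactors hr)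
    (Nat.prime_of_mem_primeFactors hp2) hp1 _ _)

end Coeff

/-- The value of the local correlation at a prime `p ∤ q`, for a shift exactly divisible by `p ^ e`
and a function with values `c a` at `p ^ a`. -/
noncomputable def localMean (c : ℕ → ℂ) (p e : ℕ) : ℂ :=
  (1 - 1 / (p : ℂ)) * ∑ j ∈ Finset.range e, (‖c j‖ : ℂ) ^ 2 / (p : ℂ) ^ j
    + (1 - 2 / (p : ℂ)) * (‖c e‖ : ℂ) ^ 2 / (p : ℂ) ^ e
    + (1 - 1 / (p : ℂ)) *
      ∑' i : ℕ, (c e * conj (c (e + 1 + i)) / (p : ℂ) ^ (e + 1 + i) +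
        conj (c e) * c (e + 1 + i) / (p : ℂ) ^ (e + 1 + i))

theorem conj_localMean (c : ℕ → ℂ) (p e : ℕ) : conj (localMean c p e) = localMean c p e := by
  simp only [localMean, map_add, map_mul, map_sub, map_div₀, map_one, map_sum, map_pow,
    Complex.conj_ofReal, Complex.conj_tsum, Complex.conj_conj, Complex.conj_natCast, map_ofNat]
  congr 2
  refine tsum_congr fun i => ?_
  ring

theorem localFun_one_apply {p : ℕ} (hp : p.Prime) (c : ℕ → ℂ) {n : ℕ} (hn : n ≠ 0) :
    localFun c (1 : DirichletCharacter ℂ (p ^ 1)) n = c (n.factorization p) := by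
  rw [localFun, MulChar.one_apply, mul_one]
  rw [isUnit_natCast_iff hp le_rfl]
  exact Nat.not_dvd_ordCompl hp hn

theorem localFun_one_correlation {p : ℕ} (hp : p.Prime) {c : ℕ → ℂ} (hc : ∀ a, ‖c a‖ ≤ 1)
    {d e u : ℕ} (hd : d = p ^ e * u) (hu : ¬ p ∣ u) :
    LimitPeriodic p (fun n => localFun c (1 : DirichletCharacter ℂ (p ^ 1)) n *
      conj (localFun c (1 : DirichletCharacter ℂ (p ^ 1)) (n + d))) ∧
    HasMean (fun n => localFun c (1 : DirichletCharacter ℂ (p ^ 1)) n *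
      conj (localFun c (1 : DirichletCharacter ℂ (p ^ 1)) (n + d))) (localMean c p e) := by
  have : NeZero (p ^ 1) := ⟨(pow_pos hp.pos 1).ne'⟩
  have hpu : IsUnit (u : ZMod (p ^ 1)) := (isUnit_natCast_iff hp le_rfl u).2 hu
  have : Nontrivial (ZMod (p ^ 1)) := by
    have : Fact (1 < p ^ 1) := ⟨by simpa using hp.one_lt⟩
    infer_instance
  have h := localFun_correlation hp le_rfl hc (1 : DirichletCharacter ℂ (p ^ 1)) hd hu
    (κ := fun a => if a < e then 1 - 1 / (p : ℂ) else 1 - 2 / p) (T := 1 - 1 / (p : ℂ)) ?_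
    (fun j hj => trivialSum_linear hp hpu hj) ?_
  · refine ⟨h.1, ?_⟩
    have h2 := h.2
    rw [Finset.sum_range_succ, if_neg (lt_irrefl e)] at h2
    have h3 : ∑ a ∈ Finset.range e, (if a < e then 1 - 1 / (p : ℂ) else 1 - 2 / p) *
        (‖c a‖ : ℂ) ^ 2 / (p : ℂ) ^ a =
        (1 - 1 / (p : ℂ)) * ∑ j ∈ Finset.range e, (‖c j‖ : ℂ) ^ 2 / (p : ℂ) ^ j := by
      rw [Finset.mul_sum]
      refine Finset.sum_congr rfl fun a ha => ?_
      rw [if_pos (Finset.mem_range.1 ha)]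
      ring
    rw [h3] at h2
    exact h2
  · intro a ha
    split_ifs with h
    · have h0 : ((p ^ (e - a) * u : ℕ) : ZMod (p ^ 1)) = 0 := by
        push_cast
        rw [natCast_pow_eq_zero (e - a) (by omega), zero_mul]
      simp only [h0]
      exact charSum_self _ hp le_rfl
    · have h0 : a = e := by omega
      subst h0
      refine trivialSum_shift hp ?_
      rw [Nat.sub_self, pow_zero, one_mul]
      exact hpu.ne_zero
  · intro j hj
    rw [charSum_linear_conj, trivialSum_linear hp hpu.neg hj]
    simp

theorem localFun_primitive_correlation {p L : ℕ} (hp : p.Prime) (hL : 1 ≤ L) {c : ℕ → ℂ}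
    (hc : ∀ a, ‖c a‖ ≤ 1) (ψ : DirichletCharacter ℂ (p ^ L)) {b : ZMod (p ^ L)}
    (hbU : IsUnit (1 + (p : ZMod (p ^ L)) ^ (L - 1) * b))
    (hb : ψ (1 + (p : ZMod (p ^ L)) ^ (L - 1) * b) ≠ 1)
    {d e u : ℕ} (hd : d = p ^ e * u) (hu : ¬ p ∣ u) :
    LimitPeriodic p (fun n => localFun c ψ n * conj (localFun c ψ (n + d))) ∧
    HasMean (fun n => localFun c ψ n * conj (localFun c ψ (n + d)))
      (∑ a ∈ Finset.range (e + 1), (if a + L ≤ e then 1 - 1 / (p : ℂ) else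
        if a + L = e + 1 then -(1 / p) else 0) * (‖c a‖ : ℂ) ^ 2 / (p : ℂ) ^ a) := by
  have : NeZero (p ^ L) := ⟨(pow_pos hp.pos L).ne'⟩
  have hpu : IsUnit (u : ZMod (p ^ L)) := (isUnit_natCast_iff hp hL u).2 hu
  have h := localFun_correlation hp hL hc ψ hd hu
    (κ := fun a => if a + L ≤ e then 1 - 1 / (p : ℂ) else
      if a + L = e + 1 then -(1 / p) else 0) (T := 0) ?_
    (fun j hj => by rw [mul_zero]; exact charSum_linear_eq_zero ψ hj hpu hbU hb) ?_
  · simpa using h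
  · intro a ha
    rw [Nat.cast_mul, Nat.cast_pow]
    split_ifs with h1 h2
    · simp only [natCast_pow_eq_zero (p := p) (L := L) (e - a) (by omega), zero_mul]
      exact charSum_self ψ hp hL
    · rw [show e - a = L - 1 by omega]
      exact charSum_shift_top ψ hp hL hpu hbU hb
    · rw [mul_zero]
      exact charSum_shift_eq_zero ψ (by omega) hpu hb
  · intro j hj
    rw [charSum_linear_conj, charSum_linear_eq_zero ψ hj hpu.neg hbU hb, map_zero, mul_zero]

theorem charLocalFactor_eq {f c : ℕ → ℂ} {p L e u : ℕ} (hp : p.Prime) (hL : 1 ≤ L)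
    (hu : ¬ p ∣ u) (hf1 : f 1 = 1) (hc : ∀ a, ‖c a‖ = ‖f (p ^ a)‖) {d : ℤ}
    (hd : d.natAbs = p ^ e * u) :
    ∑ a ∈ Finset.range (e + 1), (if a + L ≤ e then 1 - 1 / (p : ℂ) else
      if a + L = e + 1 then -(1 / p) else 0) * (‖c a‖ : ℂ) ^ 2 / (p : ℂ) ^ a =
      (charLocalFactor f p L d : ℂ) := by
  have hp0 : (p : ℂ) ≠ 0 := by exact_mod_cast hp.ne_zero
  have hdvd : ∀ k, (p : ℤ) ^ k ∣ d ↔ k ≤ e := by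
    intro k
    rw [← Nat.cast_pow, Int.natCast_dvd, hd, pow_dvd_pow_mul_iff hp hu]
  have hval : padicValInt p d = e := by
    rw [padicValInt, hd, ← Nat.factorization_def _ hp, factorization_pow_mul hp hu]
  simp only [charLocalFactor, hdvd, hval, hc]
  split_ifs with h1 h2
  · obtain ⟨k, rfl⟩ : ∃ k, e = L + k := ⟨e - L, by omega⟩
    obtain ⟨l, rfl⟩ : ∃ l, L = l + 1 := ⟨L - 1, by omega⟩
    rw [Nat.add_sub_cancel_left, show l + 1 + k + 1 = (k + 1) + 1 + l by ring,
      Finset.sum_range_add, Finset.sum_range_succ]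
    have h3 : ∀ x ∈ Finset.range l, (if k + 1 + 1 + x + (l + 1) ≤ l + 1 + k then 1 - 1 / (p : ℂ)
        else if k + 1 + 1 + x + (l + 1) = k + 1 + 1 + l then -(1 / p) else 0) *
          (‖f (p ^ (k + 1 + 1 + x))‖ : ℂ) ^ 2 / (p : ℂ) ^ (k + 1 + 1 + x) = 0 := by
      intro x _
      rw [if_neg (by omega), if_neg (by omega)]
      simp
    rw [Finset.sum_eq_zero h3, if_neg (by omega), if_pos (by omega)]
    push_cast
    rw [Finset.mul_sum, add_zero, sub_eq_add_neg (Finset.sum _ _)]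
    congr 1
    · refine Finset.sum_congr rfl fun a ha => ?_
      have := Finset.mem_range.1 ha
      rw [if_pos (by omega)]
      ring
    · field_simp
      ring
  · have he : e + 1 = L := by omega
    subst he
    rw [Finset.sum_eq_single 0]
    · simp [hf1]
    · intro a _ ha
      rw [if_neg (by omega), if_neg (by omega)]
      simp
    · simp
  · rw [Complex.ofReal_zero]
    refine Finset.sum_eq_zero fun a ha => ?_
    rw [if_neg (by omega), if_neg (by omega)]
    simp

/-! ### The asymptotic formula for products of local functions -/

theorem eventually_sum_le_of_tendsto_zero {u : ℕ → ℝ} (hu : Tendsto u atTop (𝓝 0)) {ε : ℝ}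
    (hε : 0 < ε) : ∀ᶠ N : ℕ in atTop, ∑ n ∈ Finset.Ioc 0 N, u n ≤ ε * N := by
  have h := ((tendsto_add_atTop_iff_nat 1).2 hu).cesaro
  filter_upwards [h.eventually_le_const hε, eventually_gt_atTop 0] with N hN hN0
  have hN' : (0 : ℝ) < N := by exact_mod_cast hN0
  have h2 : ∑ n ∈ Finset.Ioc 0 N, u n = ∑ n ∈ Finset.range N, u (n + 1) := by
    rw [Finset.range_eq_Ico, Finset.sum_Ico_add' u 0 N 1]
    rfl
  rw [h2]
  rwa [inv_mul_le_iff₀ hN', mul_comm] at hN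

theorem natCast_cpow_I_mul_conj {n : ℕ} (hn : 0 < n) (t : ℝ) :
    (n : ℂ) ^ (-((t : ℂ) * Complex.I)) * conj ((n : ℂ) ^ (-((t : ℂ) * Complex.I))) = 1 := by
  rw [Complex.mul_conj, Complex.normSq_eq_norm_sq, Complex.norm_natCast_cpow_of_pos hn]
  simp

/-- The factor `n ^ (i t)` is almost invariant under the shift by `d`. -/
theorem tendsto_cpow_shift (t : ℝ) (d : ℕ) :
    Tendsto (fun n : ℕ => ‖conj ((n : ℂ) ^ (-((t : ℂ) * Complex.I))) *
      ((n + d : ℕ) : ℂ) ^ (-((t : ℂ) * Complex.I)) - 1‖) atTop (𝓝 0) := by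
  have h1 : Tendsto (fun n : ℕ => Real.log ((n : ℝ) / ((n : ℝ) + d))) atTop (𝓝 0) := by
    have h2 : Tendsto (fun n : ℕ => (n : ℝ) / ((n : ℝ) + d)) atTop (𝓝 1) :=
      tendsto_natCast_div_add_atTop (𝕜 := ℝ) (d : ℝ)
    have h3 := (Real.continuousAt_log (one_ne_zero)).tendsto.comp h2
    rwa [Real.log_one] at h3
  have h4 : Tendsto (fun n : ℕ => ‖Complex.exp
      ((Real.log ((n : ℝ) / ((n : ℝ) + d)) : ℝ) * ((t : ℂ) * Complex.I)) - 1‖) atTop (𝓝 0) := by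
    have h5 : Continuous fun x : ℝ => ‖Complex.exp ((x : ℂ) * ((t : ℂ) * Complex.I)) - 1‖ := by
      fun_prop
    have h6 := (h5.tendsto 0).comp h1
    simpa [Function.comp_def] using h6
  refine h4.congr' ?_
  filter_upwards [eventually_gt_atTop 0] with n hn
  have hn' : (n : ℝ) ≠ 0 := by exact_mod_cast hn.ne'
  have hnd : ((n + d : ℕ) : ℝ) ≠ 0 := by exact_mod_cast (by omega : n + d ≠ 0)
  have hn'' : (n : ℂ) ≠ 0 := by exact_mod_cast hn.ne'
  have hnd' : ((n + d : ℕ) : ℂ) ≠ 0 := by exact_mod_cast (by omega : n + d ≠ 0)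
  congr 2
  rw [Complex.cpow_def_of_ne_zero hn'', Complex.cpow_def_of_ne_zero hnd', ← Complex.exp_conj,
    ← Complex.exp_add]
  congr 1
  rw [← Nat.cast_add (R := ℝ), Real.log_div hn' hnd, ← Complex.natCast_log,
    ← Complex.natCast_log]
  simp only [map_mul, map_neg, Complex.conj_ofReal, Complex.conj_I]
  push_cast
  ring

theorem norm_mul_conj_sub_one_le {a b z : ℂ} (hb : ‖b‖ ≤ 1) (hz : ‖z‖ ≤ 1) {δ : ℝ}
    (h : 1 - ‖z‖ ^ 2 ≤ δ) : ‖a * conj b - 1‖ ≤ ‖a - z‖ + ‖b - z‖ + δ := by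
  have h1 := norm_mul_sub_mul_le (a := a) (a' := z) (b' := conj z) (norm_conj_le_one hb) hz
  rw [← map_sub, RCLike.norm_conj] at h1
  have h2 : ‖z * conj z - 1‖ ≤ δ := by
    rw [Complex.mul_conj']
    have h3 : ‖z‖ ^ 2 ≤ 1 := pow_le_one₀ (norm_nonneg _) hz
    have h4 : ((‖z‖ : ℂ) ^ 2 - 1) = ((‖z‖ ^ 2 - 1 : ℝ) : ℂ) := by push_cast; rfl
    rw [h4, Complex.norm_real, Real.norm_eq_abs, abs_of_nonpos (by linarith)]
    linarith
  calc ‖a * conj b - 1‖ ≤ ‖a * conj b - z * conj z‖ + ‖z * conj z - 1‖ :=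
        norm_sub_le_norm_sub_add_norm_sub _ _ _
    _ ≤ _ := add_le_add h1 h2

/-- A multiplicative function which up to a factor `n ^ (i t)` is a product of local functions
`H p`, with `H p n = c p (v_p n)` for large `p` and `∑ (1 - Re (c p 1)) / p < ∞`, has correlations
given by the product of the local correlations. -/
theorem correlation_asymptotic {g : ℕ → ℂ} {t : ℝ} {c : ℕ → ℕ → ℂ} {H : ℕ → ℕ → ℂ} {m : ℕ → ℂ}
    {d Y : ℕ} (hc : ∀ p k, ‖c p k‖ ≤ 1)
    (hsum : ∀ δ : ℝ, 0 < δ → ∃ y₀ : ℕ, ∀ y ≥ y₀, ∀ N : ℕ,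
      ∑ p ∈ (Finset.Ioc y N).filter Nat.Prime, (1 - (c p 1).re) / p ≤ δ)
    (hfac : ∀ y ≥ Y, ∀ n, 0 < n → g n * (n : ℂ) ^ (-((t : ℂ) * Complex.I)) =
      (∏ p ∈ (Finset.Ioc 0 y).filter Nat.Prime, H p n) *
        ∏ p ∈ n.primeFactors.filter (y < ·), c p (n.factorization p))
    (hH1 : ∀ p n, ‖H p n‖ ≤ 1)
    (hH : ∀ p, p.Prime → LimitPeriodic p fun n => H p n * conj (H p (n + d)))
    (hm : ∀ p, p.Prime → HasMean (fun n => H p n * conj (H p (n + d))) (m p))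
    (hm1 : ∀ p, p.Prime → Y < p → ‖m p - 1‖ ≤ 2 * ((1 - (c p 1).re) / p) + 4 * (1 / (p : ℝ) ^ 2)) :
    Tendsto (fun N : ℕ => (∑ n ∈ Finset.Ioc 0 N, g n * conj (g (n + d))) / (N : ℂ) -
      ∏ p ∈ (Finset.Ioc 0 N).filter Nat.Prime, m p) atTop (𝓝 0) := by
  refine tendsto_avg_sub_of_approx (K := fun N => ∏ p ∈ (Finset.Ioc 0 N).filter Nat.Prime, m p)
    fun ε hε => ?_
  -- `17 δ + 8 √(2 δ)` bounds the error from the primes `p > y`, using `N + d ≤ 2 N`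
  obtain ⟨δ, hδ0, hδ1, hδ2⟩ : ∃ δ : ℝ, 0 < δ ∧ 17 * δ ≤ ε / 4 ∧ 8 * √(2 * δ) ≤ ε / 4 := by
    refine ⟨min (ε / 68) (ε ^ 2 / 2048), by positivity, ?_, ?_⟩
    · have := min_le_left (ε / 68) (ε ^ 2 / 2048)
      linarith
    · have h1 : 2 * min (ε / 68) (ε ^ 2 / 2048) ≤ (ε / 32) ^ 2 := by
        have := min_le_right (ε / 68) (ε ^ 2 / 2048)
        nlinarith
      have h2 := Real.sqrt_le_sqrt h1
      rw [Real.sqrt_sq (by positivity)] at h2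
      linarith
  obtain ⟨y₀, hy₀⟩ := hsum (δ / 2) (by positivity)
  obtain ⟨y₁, hy₁⟩ := exists_nat_gt (1 / δ)
  set y := max (max y₀ y₁) (max Y 1) with hy
  have hyy₀ : y₀ ≤ y := (le_max_left _ _).trans (le_max_left _ _)
  have hyy₁ : y₁ ≤ y := (le_max_right _ _).trans (le_max_left _ _)
  have hyY : Y ≤ y := (le_max_left _ _).trans (le_max_right _ _)
  have hy1 : 0 < y := (le_max_right Y 1).trans (le_max_right _ _)
  have hyδ : 1 / (y : ℝ) ≤ δ := by
    have h1 : 1 / δ < y := hy₁.trans_le (by exact_mod_cast hyy₁)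
    rw [div_lt_iff₀ hδ0] at h1
    rw [div_le_iff₀ (by exact_mod_cast hy1)]
    linarith
  have htail : ∀ N, 2 * ∑ p ∈ (Finset.Ioc y N).filter Nat.Prime, (1 - (c p 1).re) / p ≤ δ := by
    intro N
    have := hy₀ y hyy₀ N
    linarith
  set P := (Finset.Ioc 0 y).filter Nat.Prime with hP
  have hPp : ∀ p ∈ P, p.Prime := fun p hp => (Finset.mem_filter.1 hp).2
  obtain ⟨hLP, hHM⟩ := LimitPeriodic.finsetProd P hPp (fun p hp => hH p (hPp p hp))
    (fun p hp => hm p (hPp p hp))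
  refine ⟨_, _, hHM, ?_, ?_⟩
  -- the primes `y < p ≤ N` contribute a factor close to `1` to the product of the mean values
  · filter_upwards [eventually_ge_atTop y] with N hN
    set R := (Finset.Ioc y N).filter Nat.Prime with hR
    have hsplit : ∏ p ∈ (Finset.Ioc 0 N).filter Nat.Prime, m p =
        (∏ p ∈ P, m p) * ∏ p ∈ R, m p := by
      rw [hP, hR, ← Finset.prod_union, ← Finset.filter_union,
        Finset.Ioc_union_Ioc_eq_Ioc (Nat.zero_le y) hN]
      refine Finset.disjoint_filter_filter (Finset.disjoint_left.2 fun p h1 h2 => ?_)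
      have := (Finset.mem_Ioc.1 h1).2
      have := (Finset.mem_Ioc.1 h2).1
      omega
    have hRp : ∀ p ∈ R, p.Prime ∧ Y < p := fun p hp => by
      simp only [hR, Finset.mem_filter, Finset.mem_Ioc] at hp
      exact ⟨hp.2, lt_of_le_of_lt hyY hp.1.1⟩
    have h1 : ‖1 - ∏ p ∈ R, m p‖ ≤ 5 * δ := by
      have h2 := norm_prod_sub_prod_le R (a := fun p => m p) (b := fun _ => 1)
        (fun p hp => (hm p (hRp p hp).1).norm_le_one (hH p (hRp p hp).1).norm_le_one) (by simp)
      rw [Finset.prod_const_one] at h2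
      rw [norm_sub_rev]
      refine h2.trans ((Finset.sum_le_sum fun p hp => hm1 p (hRp p hp).1 (hRp p hp).2).trans ?_)
      rw [Finset.sum_add_distrib, ← Finset.mul_sum, ← Finset.mul_sum]
      have h3 := (sum_primes_inv_sq_le hy1 N).trans hyδ
      have h4 := htail N
      linarith
    rw [hsplit, ← mul_one_sub, norm_mul]
    have h3 := hHM.norm_le_one hLP.norm_le_one
    calc _ ≤ 1 * (5 * δ) := by gcongr
      _ ≤ ε := by linarith
  · have hces := eventually_sum_le_of_tendsto_zero (tendsto_cpow_shift t d)
      (by positivity : 0 < ε / 2)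
    filter_upwards [hces, eventually_ge_atTop d] with N hN hNd
    set s : ℕ → ℂ := fun n => (n : ℂ) ^ (-((t : ℂ) * Complex.I)) with hs
    set G : ℕ → ℂ := fun n => ∏ p ∈ P, H p n with hG
    set Λ : ℕ → ℂ := fun n => ∏ p ∈ n.primeFactors.filter (y < ·), c p (n.factorization p) with hΛ
    have hG1 : ∀ n, ‖G n‖ ≤ 1 := fun n => by
      simp only [hG, norm_prod]
      exact Finset.prod_le_one (fun _ _ => norm_nonneg _) fun p _ => hH1 p n
    have hΛ1 : ∀ n, ‖Λ n‖ ≤ 1 := fun n => by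
      simp only [hΛ, norm_prod]
      exact Finset.prod_le_one (fun _ _ => norm_nonneg _) fun p _ => hc p _
    have hg : ∀ n, 0 < n → g n = conj (s n) * (G n * Λ n) := fun n hn => by
      rw [← hfac y hyY n hn]
      have := natCast_cpow_I_mul_conj hn t
      linear_combination (-g n) * this
    obtain ⟨z, hz1, hz2, hz3⟩ := large_primes_near_constant hc (N := N + d) hy1 hyδ (htail _)
    have hpt : ∀ n ∈ Finset.Ioc 0 N,
        ‖g n * conj (g (n + d)) - ∏ p ∈ P, H p n * conj (H p (n + d))‖ ≤
          ‖conj (s n) * s (n + d) - 1‖ + (‖Λ n - z‖ + ‖Λ (n + d) - z‖ + δ) := by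
      intro n hn
      have hn0 := (Finset.mem_Ioc.1 hn).1
      have h1 : g n * conj (g (n + d)) - ∏ p ∈ P, H p n * conj (H p (n + d)) =
          (G n * conj (G (n + d))) *
            ((conj (s n) * s (n + d)) * (Λ n * conj (Λ (n + d))) - 1 * 1) := by
        rw [Finset.prod_mul_distrib, ← map_prod, hg n hn0, hg (n + d) (by omega)]
        simp only [map_mul, Complex.conj_conj, hG]
        ring
      rw [h1, norm_mul]
      refine (mul_le_of_le_one_left (norm_nonneg _)
        (norm_mul_le_one (hG1 n) (norm_conj_le_one (hG1 _)))).trans ?_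
      exact (norm_mul_sub_mul_le (norm_mul_le_one (hΛ1 n) (norm_conj_le_one (hΛ1 _)))
        (by simp)).trans (add_le_add le_rfl (norm_mul_conj_sub_one_le (hΛ1 _) hz1 hz2))
    have hA : ∑ n ∈ Finset.Ioc 0 N, ‖Λ n - z‖ ≤ (4 * δ + 2 * √(2 * δ)) * ((N + d : ℕ) : ℝ) := by
      refine le_trans ?_ hz3
      exact Finset.sum_le_sum_of_subset_of_nonneg (Finset.Ioc_subset_Ioc_right (by omega))
        fun _ _ _ => norm_nonneg _
    have hB : ∑ n ∈ Finset.Ioc 0 N, ‖Λ (n + d) - z‖ ≤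
        (4 * δ + 2 * √(2 * δ)) * ((N + d : ℕ) : ℝ) := by
      refine le_trans ?_ hz3
      rw [← Finset.sum_image (f := fun n => ‖Λ n - z‖) (s := Finset.Ioc 0 N)
        (g := fun n => n + d) (fun a _ b _ h => by simpa using h)]
      refine Finset.sum_le_sum_of_subset_of_nonneg ?_ fun _ _ _ => norm_nonneg _
      intro n hn
      obtain ⟨k, hk, rfl⟩ := Finset.mem_image.1 hn
      have := Finset.mem_Ioc.1 hk
      exact Finset.mem_Ioc.2 ⟨by omega, by omega⟩
    have hNd' : ((N + d : ℕ) : ℝ) ≤ 2 * N := by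
      have : (d : ℝ) ≤ N := by exact_mod_cast hNd
      push_cast
      linarith
    have hη : 0 ≤ 4 * δ + 2 * √(2 * δ) := by positivity
    calc _ ≤ _ := Finset.sum_le_sum hpt
      _ = ∑ n ∈ Finset.Ioc 0 N, ‖conj (s n) * s (n + d) - 1‖ +
          (∑ n ∈ Finset.Ioc 0 N, ‖Λ n - z‖ + ∑ n ∈ Finset.Ioc 0 N, ‖Λ (n + d) - z‖ + N * δ) := by
          simp [Finset.sum_add_distrib]
      _ ≤ ε / 2 * N + ((4 * δ + 2 * √(2 * δ)) * (2 * N) + (4 * δ + 2 * √(2 * δ)) * (2 * N) +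
            N * δ) := by
          gcongr
          · exact hA.trans (by gcongr)
          · exact hB.trans (by gcongr)
      _ = (ε / 2 + (17 * δ + 8 * √(2 * δ))) * N := by ring
      _ ≤ ε * N := by
          gcongr
          linarith

/-! ### Shifts of either sign, the tail of the distance, and local correlations -/

/-- The passage from averages over `n ≤ N` with a positive shift to the correlation: a negative
shift conjugates the average up to a bounded number of terms, which does not affect real main
terms. -/
theorem tendsto_correlation_sub {g : ℕ → ℂ} (hg : ∀ n, ‖g n‖ ≤ 1) {d : ℤ} {K : ℕ → ℂ}
    (hK1 : ∀ N, ‖K N‖ ≤ 1) (hKr : ∀ N, conj (K N) = K N)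
    (h : Tendsto (fun N : ℕ =>
      (∑ n ∈ Finset.Ioc 0 N, g n * conj (g (n + d.natAbs))) / (N : ℂ) - K N) atTop (𝓝 0)) :
    Tendsto (fun x : ℝ => correlation g d x - K ⌊x⌋₊) atTop (𝓝 0) := by
  set B : ℕ → ℂ := fun N => ∑ n ∈ (Finset.Icc 1 N).filter (fun n : ℕ => 0 < (n : ℤ) + d),
    g n * conj (g ((n : ℤ) + d).toNat) with hB
  have hgg : ∀ n m, ‖g n * conj (g m)‖ ≤ 1 := fun n m =>
    norm_mul_le_one (hg n) (norm_conj_le_one (hg m))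
  have h1 : Tendsto (fun N : ℕ => B N / (N : ℂ) - K N) atTop (𝓝 0) := by
    obtain ⟨k, rfl | rfl⟩ := d.eq_nat_or_neg
    · refine h.congr fun N => ?_
      have hf : (Finset.Icc 1 N).filter (fun n : ℕ => 0 < (n : ℤ) + (k : ℤ)) =
          Finset.Ioc 0 N := by
        ext n
        simp only [Finset.mem_filter, Finset.mem_Icc, Finset.mem_Ioc]
        omega
      simp only [hB, hf, Int.natAbs_natCast]
      congr 2
    · rw [Int.natAbs_neg, Int.natAbs_natCast] at h
      set S : ℕ → ℂ := fun N => ∑ n ∈ Finset.Ioc 0 N, g n * conj (g (n + k)) with hS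
      have hBS : ∀ N, B N = conj (S (N - k)) := by
        intro N
        simp only [hB, hS, map_sum]
        refine Finset.sum_bij' (fun n _ => n - k) (fun n _ => n + k) ?_ ?_ ?_ ?_ ?_
        · intro n hn
          simp only [Finset.mem_filter, Finset.mem_Icc, Finset.mem_Ioc] at hn ⊢
          omega
        · intro n hn
          simp only [Finset.mem_filter, Finset.mem_Icc, Finset.mem_Ioc] at hn ⊢
          omega
        · intro n hn
          simp only [Finset.mem_filter, Finset.mem_Icc] at hn
          omega
        · intro n _
          simp
        · intro n hn
          simp only [Finset.mem_filter, Finset.mem_Icc] at hn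
          rw [show ((n : ℤ) + -k).toNat = n - k by omega, map_mul, Complex.conj_conj,
            Nat.sub_add_cancel (by omega), mul_comm]
      have hbd : ∀ N, ‖S (N - k) - S N‖ ≤ k := by
        intro N
        have h2 : S (N - k) - S N = -∑ n ∈ Finset.Ioc (N - k) N, g n * conj (g (n + k)) := by
          have h3 := Finset.sum_Ioc_consecutive (fun n => g n * conj (g (n + k)))
            (Nat.zero_le (N - k)) (Nat.sub_le N k)
          simp only [hS]
          rw [← h3]
          ring
        rw [h2, norm_neg]
        refine (norm_sum_le_of_le _ fun n _ => hgg n (n + k)).trans ?_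
        simp only [Finset.sum_const, Nat.card_Ioc, nsmul_eq_mul, mul_one]
        exact_mod_cast (by omega : N - (N - k) ≤ k)
      have h2 : Tendsto (fun N : ℕ => (S (N - k) - S N) / (N : ℂ)) atTop (𝓝 0) := by
        refine squeeze_zero_norm (a := fun N : ℕ => (k : ℝ) / (N : ℝ)) (fun N => ?_)
          (tendsto_const_div_atTop_nhds_zero_nat _)
        rw [norm_div, Complex.norm_natCast]
        exact div_le_div_of_nonneg_right (hbd N) (Nat.cast_nonneg N)
      have h23 := h2.add h
      rw [add_zero] at h23
      have h3 := (Complex.continuous_conj.tendsto 0).comp h23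
      rw [map_zero] at h3
      have h4 : Tendsto (fun N : ℕ => conj ((S (N - k) - S N) / (N : ℂ) + (S N / (N : ℂ) - K N)))
          atTop (𝓝 0) := h3
      refine h4.congr fun N => ?_
      rw [hBS, map_add, map_sub, hKr, map_div₀, map_div₀, map_sub, Complex.conj_natCast]
      ring
  have h2 : Tendsto (fun x : ℝ => ((⌊x⌋₊ : ℝ) / x : ℝ)) atTop (𝓝 1) :=
    tendsto_nat_floor_div_atTop
  have h3 : Tendsto (fun x : ℝ => (((⌊x⌋₊ : ℝ) / x : ℝ) : ℂ)) atTop (𝓝 1) := by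
    simpa [Function.comp_def] using (Complex.continuous_ofReal.tendsto 1).comp h2
  have h4 := h1.comp (tendsto_nat_floor_atTop (α := ℝ))
  have h5 : Tendsto (fun x : ℝ => ((((⌊x⌋₊ : ℝ) / x : ℝ) : ℂ) - 1) * K ⌊x⌋₊) atTop (𝓝 0) := by
    have h6 : Tendsto (fun x : ℝ => (((⌊x⌋₊ : ℝ) / x : ℝ) : ℂ) - 1) atTop (𝓝 0) := by
      simpa using h3.sub_const 1
    refine squeeze_zero_norm (fun x => ?_) (tendsto_zero_iff_norm_tendsto_zero.1 h6)
    rw [norm_mul]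
    exact mul_le_of_le_one_right (norm_nonneg _) (hK1 _)
  have h6 := (h3.mul h4).add h5
  rw [mul_zero, add_zero] at h6
  refine h6.congr' ?_
  filter_upwards [eventually_ge_atTop 1] with x hx
  have hx0 : (x : ℂ) ≠ 0 := by
    have : x ≠ 0 := by linarith
    exact_mod_cast this
  have hN : ((⌊x⌋₊ : ℕ) : ℂ) ≠ 0 := by
    have : 0 < ⌊x⌋₊ := Nat.floor_pos.2 hx
    exact_mod_cast this.ne'
  have hcorr : correlation g d x = 1 / (x : ℂ) * B ⌊x⌋₊ := rfl
  simp only [Function.comp_apply, hcorr]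
  push_cast
  field_simp
  ring

theorem conj_natCast_cpow_I {p : ℕ} (hp : p ≠ 0) (t : ℝ) :
    conj ((p : ℂ) ^ ((t : ℂ) * Complex.I)) = (p : ℂ) ^ (-((t : ℂ) * Complex.I)) := by
  have hp' : (p : ℂ) ≠ 0 := by exact_mod_cast hp
  rw [Complex.cpow_def_of_ne_zero hp', Complex.cpow_def_of_ne_zero hp', ← Complex.exp_conj,
    ← Complex.natCast_log]
  simp only [map_mul, Complex.conj_ofReal, Complex.conj_I]
  congr 1
  ring

section

variable {f : ArithmeticFunction ℂ} {t : ℝ} {q : ℕ} {χ : DirichletCharacter ℂ q}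
  {ψ : ∀ p : ℕ, DirichletCharacter ℂ (p ^ q.factorization p)}

/-- Finite distance makes the tails of `∑ (1 - Re (c p)) / p` small, where `c p` is the local
coefficient at `p`; the finitely many `p ∣ q` are left out. -/
theorem exists_tail_le (hf1 : ∀ n : ℕ, ‖f n‖ ≤ 1)
    (hdist : distInfty f (twistedChar χ t) < ∞) (hq : 0 < q)
    (hψ : ∀ n : ℕ, n.Coprime q → χ n = ∏ p ∈ q.primeFactors, ψ p n) {δ : ℝ} (hδ : 0 < δ) :
    ∃ y₀ : ℕ, ∀ y ≥ y₀, ∀ N : ℕ, ∑ p ∈ (Finset.Ioc y N).filter Nat.Prime,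
      (1 - (localCoeff f t ψ p 1).re) / (p : ℝ) ≤ δ := by
  have ht : ∀ n, ‖twistedChar χ t n‖ ≤ 1 := by
    intro n
    refine norm_mul_le_one ?_ (χ.norm_le_one _)
    rcases Nat.eq_zero_or_pos n with rfl | hn
    · by_cases h : (t : ℂ) * Complex.I = 0
      · rw [h]; simp
      · rw [Nat.cast_zero, Complex.zero_cpow h]; simp
    · rw [Complex.norm_natCast_cpow_of_pos hn]
      simp
  set a : Nat.Primes → ℝ := fun p =>
    (1 - (f p * conj (twistedChar χ t p)).re) / ((p : ℕ) : ℝ) with ha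
  have ha0 : ∀ p, 0 ≤ a p := fun p => by
    have := re_le_one (norm_mul_le_one (hf1 p) (norm_conj_le_one (ht p)))
    exact div_nonneg (by linarith) (Nat.cast_nonneg _)
  have hsum : Summable a := by
    rw [distInfty, ENNReal.rpow_lt_top_iff_of_pos (by norm_num)] at hdist
    refine (ENNReal.summable_toReal hdist.ne).congr fun p => ?_
    exact ENNReal.toReal_ofReal (ha0 p)
  obtain ⟨s, hs⟩ := summable_iff_vanishing_norm.1 hsum δ hδ
  refine ⟨max q (s.sup fun p => (p : ℕ)), fun y hy N => ?_⟩
  have hdisj : Disjoint ((Finset.Ioc y N).subtype Nat.Prime) s := by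
    refine Finset.disjoint_left.2 fun p h1 h2 => ?_
    rw [Finset.mem_subtype, Finset.mem_Ioc] at h1
    have h3 : (p : ℕ) ≤ s.sup fun p => (p : ℕ) :=
      Finset.le_sup (f := fun p : Nat.Primes => (p : ℕ)) h2
    have := (le_max_right _ _).trans hy
    have := h1.1
    omega
  have h1 := (le_abs_self _).trans (hs _ hdisj).le
  have h2 : ∑ p ∈ (Finset.Ioc y N).subtype Nat.Prime, a p =
      ∑ p ∈ (Finset.Ioc y N).filter Nat.Prime,
        (1 - (f p * conj (twistedChar χ t p)).re) / ((p : ℕ) : ℝ) :=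
    Finset.sum_subtype_eq_sum_filter (p := Nat.Prime)
      (fun p : ℕ => (1 - (f p * conj (twistedChar χ t p)).re) / (p : ℝ))
  refine le_trans (le_of_eq ?_) (h2.symm.trans_le h1)
  refine Finset.sum_congr rfl fun p hp => ?_
  obtain ⟨hp1, hpp⟩ := Finset.mem_filter.1 hp
  have hpq : ¬ p ∣ q := fun h => by
    have := Nat.le_of_dvd hq h
    have := (Finset.mem_Ioc.1 hp1).1
    have := (le_max_left _ _).trans hy
    omega
  rw [localCoeff_eq hψ hpp hpq, twistedChar, map_mul, conj_natCast_cpow_I hpp.ne_zero, pow_one,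
    Nat.cast_one, one_mul]
  congr 3
  ring

/-- The function of `n` as a `p`-adic integer that a prime `p` contributes to
`f n * n ^ (- i t)`. -/
noncomputable def localPiece (f : ℕ → ℂ) (t : ℝ) {q : ℕ}
    (ψ : ∀ p : ℕ, DirichletCharacter ℂ (p ^ q.factorization p)) (p n : ℕ) : ℂ :=
  if p ∣ q then localFun (localCoeff f t ψ p) (ψ p) n
  else localFun (localCoeff f t ψ p) (1 : DirichletCharacter ℂ (p ^ 1)) n

theorem localPiece_eq {p n : ℕ} (hp : p.Prime) (hn : n ≠ 0) :
    localPiece f t ψ p n = localCoeff f t ψ p (n.factorization p) *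
      if p ∣ q then ψ p ((n / p ^ n.factorization p : ℕ) : ZMod _) else 1 := by
  rw [localPiece]
  split_ifs
  · rfl
  · rw [localFun_one_apply hp _ hn, mul_one]

theorem mul_cpow_eq_prod_localPiece (hf : f.IsMultiplicative) (hq : 0 < q) {y n : ℕ} (hy : q ≤ y)
    (hn : 0 < n) : f n * (n : ℂ) ^ (-((t : ℂ) * Complex.I)) =
      (∏ p ∈ (Finset.Ioc 0 y).filter Nat.Prime, localPiece f t ψ p n) *
        ∏ p ∈ n.primeFactors.filter (y < ·), localCoeff f t ψ p (n.factorization p) := by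
  rw [mul_cpow_eq_prod hf hn.ne' (ψ := ψ), Finset.prod_congr rfl fun p hp =>
    localPiece_eq (f := f) (t := t) (ψ := ψ) (Finset.mem_filter.1 hp).2 hn.ne',
    Finset.prod_mul_distrib, ← Finset.prod_filter, Finset.filter_filter]
  have h1 : (Finset.Ioc 0 y).filter (fun p => p.Prime ∧ p ∣ q) = q.primeFactors := by
    ext p
    simp only [Finset.mem_filter, Finset.mem_Ioc, Nat.mem_primeFactors]
    constructor
    · rintro ⟨-, h1, h2⟩
      exact ⟨h1, h2, hq.ne'⟩
    · rintro ⟨h1, h2, -⟩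
      exact ⟨⟨h1.pos, (Nat.le_of_dvd hq h2).trans hy⟩, h1, h2⟩
  have h2 : ∏ p ∈ n.primeFactors.filter (¬ y < ·), localCoeff f t ψ p (n.factorization p) =
      ∏ p ∈ (Finset.Ioc 0 y).filter Nat.Prime, localCoeff f t ψ p (n.factorization p) := by
    refine Finset.prod_subset (fun p hp => ?_) fun p hp hpn => ?_
    · simp only [Finset.mem_filter, Finset.mem_Ioc, Nat.mem_primeFactors] at hp ⊢
      exact ⟨⟨hp.1.1.pos, not_lt.1 hp.2⟩, hp.1.1⟩
    · simp only [Finset.mem_filter, Finset.mem_Ioc, Nat.mem_primeFactors] at hp hpn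
      have h3 : ¬ p ∣ n := fun h => hpn ⟨⟨hp.2, h, hn.ne'⟩, not_lt.2 hp.1.2⟩
      rw [Nat.factorization_eq_zero_of_not_dvd h3, localCoeff_zero hf.1]
  rw [h1, ← h2, ← Finset.prod_filter_mul_prod_filter_not n.primeFactors (y < ·)]
  ring

end

theorem norm_localMean_sub_one_le {c : ℕ → ℂ} (hc : ∀ k, ‖c k‖ ≤ 1) (hc0 : c 0 = 1) {p : ℕ}
    (hp : p.Prime) :
    ‖localMean c p 0 - 1‖ ≤ 2 * ((1 - (c 1).re) / p) + 4 * (1 / (p : ℝ) ^ 2) := by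
  have hp0 : (p : ℂ) ≠ 0 := by exact_mod_cast hp.ne_zero
  have hp2 : (2 : ℝ) ≤ p := by exact_mod_cast hp.two_le
  have hs := summable_tail hp hc 0
  set w : ℂ := ∑' i : ℕ, (c 0 * conj (c (0 + 1 + (i + 1))) / (p : ℂ) ^ (0 + 1 + (i + 1)) +
        conj (c 0) * c (0 + 1 + (i + 1)) / (p : ℂ) ^ (0 + 1 + (i + 1))) with hw
  have hw1 : ‖w‖ ≤ 2 / (p : ℝ) ^ 2 * (1 - (p : ℝ)⁻¹)⁻¹ := by
    have hg := (hasSum_geometric_of_lt_one (r := (p : ℝ)⁻¹) (by positivity)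
      (inv_lt_one_of_one_lt₀ (by linarith))).mul_left (2 / (p : ℝ) ^ 2)
    refine tsum_of_norm_bounded hg fun i => ?_
    rw [← add_div, norm_div, norm_pow, Complex.norm_natCast]
    have h1 : ‖c 0 * conj (c (0 + 1 + (i + 1))) + conj (c 0) * c (0 + 1 + (i + 1))‖ ≤ 2 := by
      have h2 := norm_mul_le_one (hc 0) (norm_conj_le_one (hc (0 + 1 + (i + 1))))
      have h3 := norm_mul_le_one (norm_conj_le_one (hc 0)) (hc (0 + 1 + (i + 1)))
      exact (norm_add_le _ _).trans (by linarith)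
    calc _ ≤ 2 / (p : ℝ) ^ (0 + 1 + (i + 1)) := by gcongr
      _ = _ := by
          rw [show 0 + 1 + (i + 1) = 2 + i by ring, pow_add, inv_pow]
          field_simp
  have hp' : 0 < 1 - (p : ℝ)⁻¹ := by
    have := inv_lt_one_of_one_lt₀ (by linarith : (1 : ℝ) < p)
    linarith
  have hw2 : ‖(1 - 1 / (p : ℂ)) * w‖ ≤ 2 / (p : ℝ) ^ 2 := by
    have h1 : (1 - 1 / (p : ℂ)) = ((1 - (p : ℝ)⁻¹ : ℝ) : ℂ) := by push_cast; rw [one_div]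
    rw [norm_mul, h1, Complex.norm_real, Real.norm_of_nonneg hp'.le]
    calc _ ≤ (1 - (p : ℝ)⁻¹) * (2 / (p : ℝ) ^ 2 * (1 - (p : ℝ)⁻¹)⁻¹) := by gcongr
      _ = _ := by rw [mul_left_comm, mul_inv_cancel₀ hp'.ne', mul_one]
  have hre : (c 1).re ≤ 1 := re_le_one (hc 1)
  have hre' : |(c 1).re| ≤ 1 := (Complex.abs_re_le_norm _).trans (hc 1)
  have h1 : localMean c p 0 - 1 =
      ((-(2 * ((1 - (c 1).re) / p)) - 2 * (c 1).re / (p : ℝ) ^ 2 : ℝ) : ℂ) +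
        (1 - 1 / (p : ℂ)) * w := by
    rw [localMean, hs.tsum_eq_zero_add, ← hw, hc0]
    have h2 : conj (c 1) = 2 * ((c 1).re : ℂ) - c 1 := by
      rw [eq_sub_iff_add_eq, add_comm, Complex.add_conj]
      push_cast
      ring
    simp only [Finset.range_zero, Finset.sum_empty, norm_one, map_one, one_mul, zero_add, add_zero,
      pow_zero, pow_one, h2]
    push_cast
    field_simp
    ring
  rw [h1]
  refine (norm_add_le _ _).trans ?_
  have h3 : ‖((-(2 * ((1 - (c 1).re) / p)) - 2 * (c 1).re / (p : ℝ) ^ 2 : ℝ) : ℂ)‖ ≤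
      2 * ((1 - (c 1).re) / p) + 2 / (p : ℝ) ^ 2 := by
    rw [Complex.norm_real, Real.norm_eq_abs]
    refine (abs_sub _ _).trans (add_le_add ?_ ?_)
    · rw [abs_neg, abs_of_nonneg]
      have : 0 ≤ 1 - (c 1).re := by linarith
      positivity
    · rw [abs_div, abs_mul, abs_two, abs_of_nonneg (by positivity : 0 ≤ (p : ℝ) ^ 2)]
      gcongr
      linarith
  calc _ ≤ 2 * ((1 - (c 1).re) / p) + 2 / (p : ℝ) ^ 2 + 2 / (p : ℝ) ^ 2 := add_le_add h3 hw2
    _ = _ := by ring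

theorem localPart_apply {F : ℕ → ℂ} (hF : F 1 = 1) (p n : ℕ) :
    localPart p F n = F (p ^ n.factorization p) := by
  rw [localPart, ofPrimePowers, Finsupp.prod]
  simp only [Finset.prod_ite_eq']
  split_ifs with h
  · rfl
  · rw [Finsupp.notMem_support_iff.1 h, pow_zero, hF]

theorem tendsto_localCorrelation {F : ℕ → ℂ} (hF1 : F 1 = 1) {p e u : ℕ} (hp : p.Prime)
    (hF : ∀ a, ‖F (p ^ a)‖ ≤ 1) (hu : ¬ p ∣ u) {d : ℤ} (hd : d.natAbs = p ^ e * u) :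
    Tendsto (fun x : ℝ => correlation (localPart p F) d x) atTop
      (𝓝 (localMean (fun j => F (p ^ j)) p e)) := by
  obtain ⟨h1, h2⟩ := localFun_one_correlation hp hF hd hu
  have h3 : HasMean (fun n => localPart p F n * conj (localPart p F (n + d.natAbs)))
      (localMean (fun j => F (p ^ j)) p e) := by
    refine h2.congr fun n hn => ?_
    rw [localFun_one_apply hp _ hn.ne', localFun_one_apply hp _ (by omega),
      localPart_apply hF1, localPart_apply hF1]
  have h4 := tendsto_correlation_sub (g := localPart p F) (d := d)
    (K := fun _ => localMean (fun j => F (p ^ j)) p e)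
    (fun n => by rw [localPart_apply hF1]; exact hF _)
    (fun _ => h2.norm_le_one h1.norm_le_one) (fun _ => conj_localMean _ _ _) (by
      have := Tendsto.sub_const h3 (localMean (fun j => F (p ^ j)) p e)
      rwa [sub_self] at this)
  simpa using h4.add_const (localMean (fun j => F (p ^ j)) p e)

theorem localMean_of_norm_eq_one {c : ℕ → ℂ} {p e : ℕ} (hp : p.Prime) (h : ∀ j ≤ e, ‖c j‖ = 1) :
    localMean c p e = 1 - 2 / (p : ℂ) ^ (e + 1) + (1 - 1 / (p : ℂ)) *
      ∑' i : ℕ, (c e * conj (c (e + 1 + i)) / (p : ℂ) ^ (e + 1 + i) +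
        conj (c e) * c (e + 1 + i) / (p : ℂ) ^ (e + 1 + i)) := by
  have hp0 : (p : ℂ) ≠ 0 := by exact_mod_cast hp.ne_zero
  have h1 : ∀ e', e' ≤ e → (1 - 1 / (p : ℂ)) *
      ∑ j ∈ Finset.range e', (‖c j‖ : ℂ) ^ 2 / (p : ℂ) ^ j = 1 - 1 / (p : ℂ) ^ e' := by
    intro e'
    induction e' with
    | zero => simp
    | succ k ih =>
      intro hk
      rw [Finset.sum_range_succ, mul_add, ih (by omega), h k (by omega)]
      push_cast
      field_simp
      ring
  rw [localMean, h1 e le_rfl, h e le_rfl]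
  push_cast
  congr 1
  field_simp
  ring

/-! ### The asymptotic formula -/

theorem exists_pow_mul_natAbs {d : ℤ} (hd : d ≠ 0) {p : ℕ} (hp : p.Prime) :
    ∃ u, ¬ p ∣ u ∧ d.natAbs = p ^ d.natAbs.factorization p * u :=
  ⟨_, Nat.not_dvd_ordCompl hp (Int.natAbs_ne_zero.2 hd),
    (Nat.ordProj_mul_ordCompl_eq_self d.natAbs p).symm⟩

theorem twist_one {f : ℕ → ℂ} {q : ℕ} {χ : DirichletCharacter ℂ q} {t : ℝ} : twist f χ t 1 = 1 := by
  simp [twist, ofPrimePowers]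

section

variable {f : ArithmeticFunction ℂ} {t : ℝ} {q : ℕ} {χ : DirichletCharacter ℂ q}
  {ψ : ∀ p : ℕ, DirichletCharacter ℂ (p ^ q.factorization p)}

/-- The mean value of the local factor at `p` of the correlation. -/
noncomputable def localValue (f : ℕ → ℂ) (t : ℝ) {q : ℕ}
    (ψ : ∀ p : ℕ, DirichletCharacter ℂ (p ^ q.factorization p)) (d : ℤ) (p : ℕ) : ℂ :=
  if p ∣ q then (charLocalFactor f p (q.factorization p) d : ℂ)
  else localMean (localCoeff f t ψ p) p (d.natAbs.factorization p)

theorem conj_localValue (d : ℤ) (p : ℕ) : conj (localValue f t ψ d p) = localValue f t ψ d p := by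
  rw [localValue]
  split_ifs
  · exact Complex.conj_ofReal _
  · exact conj_localMean _ _ _

theorem localPiece_correlation (hf : f.IsMultiplicative) (hf1 : ∀ n : ℕ, ‖f n‖ ≤ 1) (hq : 0 < q)
    (hprim : ∀ p ∈ q.primeFactors, ∃ b : ZMod (p ^ q.factorization p),
      IsUnit (1 + (p : ZMod (p ^ q.factorization p)) ^ (q.factorization p - 1) * b) ∧
      ψ p (1 + (p : ZMod (p ^ q.factorization p)) ^ (q.factorization p - 1) * b) ≠ 1)
    {d : ℤ} (hd : d ≠ 0) {p : ℕ} (hp : p.Prime) :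
    LimitPeriodic p (fun n => localPiece f t ψ p n * conj (localPiece f t ψ p (n + d.natAbs))) ∧
    HasMean (fun n => localPiece f t ψ p n * conj (localPiece f t ψ p (n + d.natAbs)))
      (localValue f t ψ d p) := by
  obtain ⟨u, hu, hdu⟩ := exists_pow_mul_natAbs hd hp
  have hc := norm_localCoeff_le (t := t) (ψ := ψ) hf1 p
  by_cases hpq : p ∣ q
  · have hpQ : p ∈ q.primeFactors := Nat.mem_primeFactors.2 ⟨hp, hpq, hq.ne'⟩
    obtain ⟨b, hb1, hb2⟩ := hprim p hpQ
    have hL := (hp.dvd_iff_one_le_factorization hq.ne').1 hpq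
    have h := localFun_primitive_correlation hp hL hc (ψ p) hb1 hb2 hdu hu
    rw [charLocalFactor_eq (f := f) hp hL hu hf.1 (norm_localCoeff hp) hdu] at h
    simpa only [localPiece, localValue, if_pos hpq] using h
  · have h := localFun_one_correlation hp hc hdu hu
    simpa only [localPiece, localValue, if_neg hpq] using h

theorem tendsto_correlation_sub_prod (hf : f.IsMultiplicative) (hf1 : ∀ n : ℕ, ‖f n‖ ≤ 1)
    (hdist : distInfty f (twistedChar χ t) < ∞) (hq : 0 < q)
    (hψ : ∀ n : ℕ, n.Coprime q → χ n = ∏ p ∈ q.primeFactors, ψ p n)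
    (hprim : ∀ p ∈ q.primeFactors, ∃ b : ZMod (p ^ q.factorization p),
      IsUnit (1 + (p : ZMod (p ^ q.factorization p)) ^ (q.factorization p - 1) * b) ∧
      ψ p (1 + (p : ZMod (p ^ q.factorization p)) ^ (q.factorization p - 1) * b) ≠ 1)
    {d : ℤ} (hd : d ≠ 0) :
    Tendsto (fun x : ℝ => correlation f d x -
      ∏ p ∈ (Finset.Ioc 0 ⌊x⌋₊).filter Nat.Prime, localValue f t ψ d p) atTop (𝓝 0) := by
  have hloc := fun (p : ℕ) (hp : p.Prime) =>
    localPiece_correlation (t := t) hf hf1 hq hprim hd hp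
  have hd0 : 0 < d.natAbs := Int.natAbs_pos.2 hd
  refine tendsto_correlation_sub (K := fun N => ∏ p ∈ (Finset.Ioc 0 N).filter Nat.Prime,
    localValue f t ψ d p) hf1 (fun N => ?_) (fun N => ?_) ?_
  · rw [norm_prod]
    refine Finset.prod_le_one (fun _ _ => norm_nonneg _) fun p hp => ?_
    have h := hloc p (Finset.mem_filter.1 hp).2
    exact h.2.norm_le_one h.1.norm_le_one
  · rw [map_prod]
    exact Finset.prod_congr rfl fun p _ => conj_localValue d p
  · refine correlation_asymptotic (t := t) (c := localCoeff f t ψ) (H := localPiece f t ψ)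
      (m := localValue f t ψ d) (Y := max q d.natAbs) (fun p k => norm_localCoeff_le hf1 p k)
      (fun δ hδ => exists_tail_le hf1 hdist hq hψ hδ)
      (fun y hy n hn => mul_cpow_eq_prod_localPiece hf hq ((le_max_left _ _).trans hy) hn)
      (fun p n => ?_) (fun p hp => (hloc p hp).1) (fun p hp => (hloc p hp).2) fun p hp hpY => ?_
    · rw [localPiece]
      split_ifs <;> exact norm_localFun_le (fun a => norm_localCoeff_le hf1 p a) _ n
    · have hpq : ¬ p ∣ q := fun h =>
        absurd (Nat.le_of_dvd hq h) (not_le.2 ((le_max_left _ _).trans_lt hpY))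
      have hpd : ¬ p ∣ d.natAbs := fun h =>
        absurd (Nat.le_of_dvd hd0 h) (not_le.2 ((le_max_right _ _).trans_lt hpY))
      rw [localValue, if_neg hpq, Nat.factorization_eq_zero_of_not_dvd hpd]
      exact norm_localMean_sub_one_le (fun k => norm_localCoeff_le hf1 p k)
        (localCoeff_zero hf.1 p) hp

end

theorem exists_charLocalFactor_eq_zero {f : ℕ → ℂ} {q : ℕ} (hq : 0 < q) {d : ℤ}
    (h : ¬ (q : ℤ) ∣ d * ∏ p ∈ q.primeFactors, (p : ℤ)) :
    ∃ p ∈ q.primeFactors, charLocalFactor f p (q.factorization p) d = 0 := by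
  by_contra! hne
  apply h
  have h1 : ∀ p ∈ q.primeFactors, (p : ℤ) ^ (q.factorization p - 1) ∣ d := by
    intro p hp
    by_contra h2
    exact hne p hp (by rw [charLocalFactor, if_pos h2])
  have h2 : (q : ℤ) = (∏ p ∈ q.primeFactors, (p : ℤ) ^ (q.factorization p - 1)) *
      ∏ p ∈ q.primeFactors, (p : ℤ) := by
    have h3 : (q : ℤ) = ((∏ p ∈ q.primeFactors, p ^ q.factorization p : ℕ) : ℤ) :=
      congrArg _ (Nat.prod_factorization_pow_eq_self hq.ne').symm
    rw [h3, ← Finset.prod_mul_distrib, Nat.cast_prod]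
    refine Finset.prod_congr rfl fun p hp => ?_
    have h4 := ((Nat.prime_of_mem_primeFactors hp).dvd_iff_one_le_factorization hq.ne').1
      (Nat.dvd_of_mem_primeFactors hp)
    rw [← pow_succ, Nat.sub_add_cancel h4, Nat.cast_pow]
  rw [h2]
  refine mul_dvd_mul_right (Finset.prod_dvd_of_coprime (fun p hp r hr hpr => ?_) h1) _
  exact IsCoprime.pow (Nat.isCoprime_iff_coprime.2 ((Nat.coprime_primes
    (Nat.prime_of_mem_primeFactors hp) (Nat.prime_of_mem_primeFactors hr)).2 hpr))

end Klurman

open Klurman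

theorem theorem1p4 (f : ArithmeticFunction ℂ) (hf : f.IsMultiplicative) (hf1 : ∀ n : ℕ, ‖f n‖ ≤ 1)
    (q : ℕ) (hq : 0 < q) (χ : DirichletCharacter ℂ q) (hχ : χ.IsPrimitive) (t : ℝ)
    (hdist : Klurman.distInfty f (Klurman.twistedChar χ t) < ∞) (d : ℤ) (hd : d ≠ 0) :
    -- the local correlations at the primes not dividing `q` exist
    (∀ p : ℕ, p.Prime → ¬ p ∣ q →
      Tendsto
        (fun x : ℝ => Klurman.correlation (Klurman.localPart p (Klurman.twist f χ t)) d x)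
        atTop (𝓝 (Klurman.localCorrelation p (Klurman.twist f χ t) d))) ∧
    -- the asymptotic formula
    Tendsto
      (fun x : ℝ => Klurman.correlation f d x -
        (∏ p ∈ (Finset.Icc 1 ⌊x⌋₊).filter (fun p : ℕ => p.Prime ∧ ¬ p ∣ q),
          Klurman.localCorrelation p (Klurman.twist f χ t) d) *
        ∏ p ∈ q.primeFactors, (Klurman.charLocalFactor f p (q.factorization p) d : ℂ))
      atTop (𝓝 0) ∧
    -- evaluation of the local correlations, `p ^ n ∥ d`
    (∀ p : ℕ, p.Prime → ¬ p ∣ q → ∀ n : ℕ, (p : ℤ) ^ n ∣ d → ¬ (p : ℤ) ^ (n + 1) ∣ d →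
      Summable (fun i : ℕ => Klurman.tailTerm (Klurman.twist f χ t) p n (n + 1 + i)) ∧
      Klurman.localCorrelation p (Klurman.twist f χ t) d =
        (1 - 1 / (p : ℂ)) *
            ∑ j ∈ Finset.range n, (‖Klurman.twist f χ t (p ^ j)‖ : ℂ) ^ 2 / (p : ℂ) ^ j
          + (1 - 2 / (p : ℂ)) * (‖Klurman.twist f χ t (p ^ n)‖ : ℂ) ^ 2 / (p : ℂ) ^ n
          + (1 - 1 / (p : ℂ)) *
            ∑' i : ℕ, Klurman.tailTerm (Klurman.twist f χ t) p n (n + 1 + i) ∧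
      ((∀ j ≤ n, ‖f (p ^ j)‖ = 1) →
        Klurman.localCorrelation p (Klurman.twist f χ t) d =
          1 - 2 / (p : ℂ) ^ (n + 1) + (1 - 1 / (p : ℂ)) *
            ∑' i : ℕ, Klurman.tailTerm (Klurman.twist f χ t) p n (n + 1 + i))) ∧
    -- vanishing
    (¬ (q : ℤ) ∣ d * ∏ p ∈ q.primeFactors, (p : ℤ) →
      Tendsto (fun x : ℝ => Klurman.correlation f d x) atTop (𝓝 0)) := by
  obtain ⟨ψ, hψ, hprim⟩ := exists_components hq χ hχ
  have htw : ∀ p : ℕ, p.Prime → ¬ p ∣ q → ∀ a, twist f χ t (p ^ a) = localCoeff f t ψ p a :=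
    fun p hp hpq a => twist_prime_pow hf.1 hψ hp hpq a
  have hF1 : ∀ p : ℕ, p.Prime → ¬ p ∣ q → ∀ a, ‖twist f χ t (p ^ a)‖ ≤ 1 := fun p hp hpq a => by
    rw [htw p hp hpq]
    exact norm_localCoeff_le hf1 p a
  have hlim : ∀ p : ℕ, p.Prime → ¬ p ∣ q → ∀ e u, ¬ p ∣ u → d.natAbs = p ^ e * u →
      Tendsto (fun x : ℝ => correlation (localPart p (twist f χ t)) d x) atTop
        (𝓝 (localMean (fun j => twist f χ t (p ^ j)) p e)) := fun p hp hpq e u hu hdu =>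
    tendsto_localCorrelation twist_one hp (hF1 p hp hpq) hu hdu
  have hval : ∀ p : ℕ, p.Prime → ¬ p ∣ q → ∀ e u, ¬ p ∣ u → d.natAbs = p ^ e * u →
      localCorrelation p (twist f χ t) d = localMean (fun j => twist f χ t (p ^ j)) p e :=
    fun p hp hpq e u hu hdu => (hlim p hp hpq e u hu hdu).limUnder_eq
  have hasymp : Tendsto (fun x : ℝ => correlation f d x -
      (∏ p ∈ (Finset.Icc 1 ⌊x⌋₊).filter (fun p : ℕ => p.Prime ∧ ¬ p ∣ q),
        localCorrelation p (twist f χ t) d) *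
      ∏ p ∈ q.primeFactors, (charLocalFactor f p (q.factorization p) d : ℂ)) atTop (𝓝 0) := by
    refine (tendsto_correlation_sub_prod hf hf1 hdist hq hψ hprim hd).congr' ?_
    filter_upwards [eventually_ge_atTop (q : ℝ)] with x hx
    have hqx : q ≤ ⌊x⌋₊ := Nat.le_floor hx
    congr 1
    rw [← Finset.prod_filter_mul_prod_filter_not ((Finset.Ioc 0 ⌊x⌋₊).filter Nat.Prime)
      (fun p => ¬ p ∣ q), Finset.filter_filter, Finset.filter_filter]
    congr 1
    · refine Finset.prod_congr rfl fun p hp => ?_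
      obtain ⟨-, hp, hpq⟩ := Finset.mem_filter.1 hp
      obtain ⟨u, hu, hdu⟩ := exists_pow_mul_natAbs hd hp
      rw [localValue, if_neg hpq, hval p hp hpq _ u hu hdu]
      simp only [htw p hp hpq]
    · have hQ : (Finset.Ioc 0 ⌊x⌋₊).filter (fun p => p.Prime ∧ ¬ ¬ p ∣ q) = q.primeFactors := by
        ext p
        simp only [Finset.mem_filter, Finset.mem_Ioc, Nat.mem_primeFactors, not_not]
        constructor
        · rintro ⟨-, h1, h2⟩
          exact ⟨h1, h2, hq.ne'⟩
        · rintro ⟨h1, h2, -⟩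
          exact ⟨⟨h1.pos, (Nat.le_of_dvd hq h2).trans hqx⟩, h1, h2⟩
      rw [hQ]
      refine Finset.prod_congr rfl fun p hp => ?_
      rw [localValue, if_pos (Nat.dvd_of_mem_primeFactors hp)]
  refine ⟨fun p hp hpq => ?_, hasymp, fun p hp hpq n hn hn' => ?_, fun h => ?_⟩
  · obtain ⟨u, hu, hdu⟩ := exists_pow_mul_natAbs hd hp
    rw [hval p hp hpq _ u hu hdu]
    exact hlim p hp hpq _ u hu hdu
  · rw [← Nat.cast_pow, Int.natCast_dvd] at hn hn'
    obtain ⟨u, hdu⟩ := hn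
    have hu : ¬ p ∣ u := fun h => hn' (by
      rw [hdu, pow_succ]
      exact Nat.mul_dvd_mul_left _ h)
    have hv := hval p hp hpq n u hu hdu
    refine ⟨summable_tail hp (hF1 p hp hpq) n, hv, fun h1 => ?_⟩
    rw [hv]
    refine localMean_of_norm_eq_one hp fun j hj => ?_
    rw [htw p hp hpq, norm_localCoeff hp]
    exact h1 j hj
  · obtain ⟨p, hp, hp0⟩ := exists_charLocalFactor_eq_zero (f := f) hq h
    have hzero : ∏ p ∈ q.primeFactors, (charLocalFactor f p (q.factorization p) d : ℂ) = 0 :=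
      Finset.prod_eq_zero hp (by rw [hp0, Complex.ofReal_zero])
    simpa only [hzero, mul_zero, sub_zero] using hasymp
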